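/- **Setting.** Let $D\ge 1$ and let $X=(x_1,\dots,x_n)$ be i.i.d. with a continuous bounded density $f$ with respect to Lebesgue measure on $\mathbb{R}^D$. For $t>0$ let $\mathcal{C}_t$ be the family of connected components of $\{x: f(x)\ge t\}$, and for a set $C$ let $C^{\oplus r}=\{x : d(x,C)\le r\}$. Fix constants $\beta,\check C_\beta,\hat C_\beta,r_s,r_c,\lambda_0,F>0$. Assume $f\le F$, $\lambda>\lambda_0$, and that for each $C\in\mathcal{C}_\lambda$ there is $A_C\in\mathcal{C}_{\lambda_0}$ such that * $A_C$ meets no other member of $\mathcal{C}_\lambda$, and there is a set $S_C$ that meets every path from $A_C$ to $\{f\ge\lambda_0\}\setminus A_C$ and satisfies $\sup_{S_C+B(0,r_s)}f<\inf_{\{f\ge\lambda_0\}}f$; * $C^{\oplus r_c}\subseteq A_C$; * $\check C_\beta\, d(x,C)^\beta\le\lambda-f(x)\le\hat C_\beta\, d(x,C)^\beta$ for all $x\in C^{\oplus r_c}\setminus C$. Put $\gamma(f)=\lambda-\sup\{f(x): x\notin\bigcup_{C\in\mathcal{C}_\lambda}C^{\oplus r_c}\}$. **Procedure.** DBSCAN(minPts,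 $\varepsilon$) calls a sample point a core-point if at least minPts sample points lie within distance $\varepsilon$ of it; sample points within $\varepsilon$ of a core-point are directly reachable from it; the clusters are the sets of points reachable from a core-point through chains of direct reachability. For $C_0>0$ and $0<\delta<1$ let $C_{\delta,n}=C_0\log(2/\delta)\sqrt{D\log n}$, let $v_D$ be the volume of the unit ball, and set $$\varepsilon=\Big(\frac{k}{n\,v_D(\lambda-\lambda C_{\delta,n}^2/\sqrt k)}\Big)^{1/D},\qquad \tilde\varepsilon=\Big(\frac{k}{n\,v_D(\lambda-\lambda C_{\delta,n}^2/\sqrt[3]{k})}\Big)^{1/D}.$$ Let $\widehat{\mathcal{C}}_\lambda$ and $\widehat{\mathcal{D}}_\lambda$ be the clusters of DBSCAN($k,\varepsilon$) and DBSCAN($k,\tilde\varepsilon$), and let $\widetilde{\mathcal{C}}_\lambda$ be obtained from $\widehat{\mathcal{C}}_\lambda$ by merging the clusters that are subsets of the same cluster of $\widehat{\mathcal{D}}_\lambda$. **Theorem.** There is a universal constant $C_0>0$ such that the following holds for all $D\ge1$, $0<\delta<1$ and all values of the constants above. 1. (Hausdorff error) There are $K_l,K_u>0$, depending only on $D,\delta,\beta,\check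 C_\beta,\hat C_\beta,r_s,r_c,\lambda_0,F$, such that for all $\lambda$ and $f$ as above, all $n\ge2$ and all $k$ with $$K_l(\log n)^2\le k\le K_u(\log n)^{2D/(2\beta+D)}\,n^{2\beta/(2\beta+D)},$$ with probability at least $1-\delta$: for each $C\in\mathcal{C}_\lambda$ there is $\widehat C\in\widehat{\mathcal{C}}_\lambda$ with $$d_{\rm Haus}(C,\widehat C)\le 2\,(4\lambda/\check C_\beta)^{1/\beta}\,C_{\delta,n}^{2/\beta}\,k^{-1/(2\beta)}.$$ 2. (Removal of false clusters) For every $\gamma>0$ there are $K_l,K_u>0$, depending only on these constants and $\gamma$, such that for all $\lambda$ and $f$ as above with $\gamma(f)\ge\gamma$, all $n\ge2$ and all $k$ with $$K_l(\log n)^3\le k\le K_u(\log n)^{2D/(2\beta+D)}\,n^{2\beta/(2\beta+D)},$$ with probability at least $1-\delta$: for each $\widehat C\in\widetilde{\mathcal{C}}_\lambda$ there is $C\in\mathcal{C}_\lambda$ satisfying the same bound. Moreover $\gamma(f)>0$ whenever $f(x)\to0$ as $|x|\to\infty$. 3. (Rate) For all $a_1,a_2>0$ there are $N$ and $R$, depending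 only on $a_1,a_2$ and the constants in 1 (in 2, respectively), such that for all $n\ge N$ and all $k$ with $a_1n^{2\beta/(2\beta+D)}\le k\le a_2n^{2\beta/(2\beta+D)}$, the conclusions of 1 and of 2 each hold with the bound $R\,(\log n)^{1/\beta}\,n^{-1/(2\beta+D)}=\widetilde O(n^{-1/(2\beta+D)})$. 4. (Optimality up to logarithms) For all $D\ge1$ and $\beta,\lambda>0$ there are values of the remaining constants $\check C_\beta,\hat C_\beta,r_s,r_c,\lambda_0,F$ and $\gamma,c>0$ such that for every $n\ge1$ and every set-valued estimator $T$ of the sample there is an $f$ as above with $\gamma(f)\ge\gamma$ and $\mathcal{C}_\lambda=\{C\}$ for a single $C$, for which $d_{\rm Haus}(C,T(X))>c\,n^{-1/(2\beta+D)}$ with probability at least $1/4$. -/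

import Mathlib

open MeasureTheory Filter Topology
open scoped ENNReal Pointwise

namespace LevelSetDBSCAN

/-! ### DBSCAN -/

section DBSCAN

variable {α : Type*} [PseudoMetricSpace α] {n : ℕ}

/-- Core-points: sample points having at least `m` sample points within distance `ε`
(sample points are counted with multiplicity). -/
def corePoints (X : Fin n → α) (m : ℕ) (ε : ℝ) : Set α :=
  {p | p ∈ Set.range X ∧ m ≤ {i : Fin n | dist (X i) p ≤ ε}.ncard}

/-- `q` is directly reachable from `p`: `p` is a core-point and `q` is a sample point in its
`ε`-neighborhood. -/
def DirectlyReachable (X : Fin n → α) (m : ℕ) (ε : ℝ) (q p : α) : Prop :=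
  p ∈ corePoints X m ε ∧ q ∈ Set.range X ∧ dist q p ≤ ε

/-- `q` is reachable from `p`: there is a path from `q` to `p` in which each point is directly
reachable from the next one. -/
def Reachable (X : Fin n → α) (m : ℕ) (ε : ℝ) (q p : α) : Prop :=
  Relation.ReflTransGen (DirectlyReachable X m ε) q p

/-- The clusters returned by DBSCAN(minPts, `ε`) on the sample `X`: for each core-point, the set
of points reachable from it. -/
def dbscan (X : Fin n → α) (minPts : ℕ) (ε : ℝ) : Set (Set α) :=
  {K | ∃ p ∈ corePoints X minPts ε, K = {q | Reachable X minPts ε q p}}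

/-- Merge the clusters of `𝒞` that are subsets of the same cluster of `𝒟`. -/
def mergeClusters (𝒞 𝒟 : Set (Set α)) : Set (Set α) :=
  {E | ∃ W ∈ 𝒟, (∃ K ∈ 𝒞, K ⊆ W) ∧ E = ⋃₀ {K | K ∈ 𝒞 ∧ K ⊆ W}}

end DBSCAN

noncomputable section

/-- Euclidean space `ℝ^D`. -/
abbrev Euc (D : ℕ) : Type := EuclideanSpace ℝ (Fin D)

/-! ### Level sets and the separation conditions -/

section Conditions

variable {D : ℕ}

/-- The upper level set `{x : f x ≥ t}`. -/
def levelSet (f : Euc D → ℝ) (t : ℝ) : Set (Euc D) := {x | t ≤ f x}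

/-- The family of connected components of `{x : f x ≥ t}`. -/
def levelComponents (f : Euc D → ℝ) (t : ℝ) : Set (Set (Euc D)) :=
  {C | ∃ x ∈ levelSet f t, C = connectedComponentIn (levelSet f t) x}

/-- `A` and `A'` are `r`-separated by `S`: every path from `A` to `A'` meets `S`, and
`sup_{S + B(0, r)} f < inf_{A ∪ A'} f` (supremum and infimum in the extended reals). -/
def SeparatedBy (f : Euc D → ℝ) (r : ℝ) (A A' S : Set (Euc D)) : Prop :=
  (∀ x ∈ A, ∀ y ∈ A', ∀ p : Path x y, ∃ t, p t ∈ S) ∧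
    (⨆ x ∈ S + Metric.ball (0 : Euc D) r, (f x : EReal)) < ⨅ x ∈ A ∪ A', (f x : EReal)

/-- The constants of the regularity and separation conditions; `fmax` bounds `‖f‖_∞`. -/
structure Params where
  (beta cLow cUp rs rc lam0 fmax : ℝ)
  beta_pos : 0 < beta
  cLow_pos : 0 < cLow
  cUp_pos : 0 < cUp
  rs_pos : 0 < rs
  rc_pos : 0 < rc
  lam0_pos : 0 < lam0
  fmax_pos : 0 < fmax

/-- `f` is a continuous bounded probability density with respect to Lebesgue measure on `ℝ^D`
satisfying the separation conditions at level `lam` with the constants `P`. -/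
structure Admissible (P : Params) (lam : ℝ) (f : Euc D → ℝ) : Prop where
  continuous : Continuous f
  nonneg : ∀ x, 0 ≤ f x
  le_fmax : ∀ x, f x ≤ P.fmax
  lintegral_eq_one : ∫⁻ x, ENNReal.ofReal (f x) = 1
  lam0_lt : P.lam0 < lam
  separation : ∀ C ∈ levelComponents f lam, ∃ A ∈ levelComponents f P.lam0,
    (∀ C' ∈ levelComponents f lam, C' ≠ C → Disjoint A C') ∧
    (∃ S, SeparatedBy f P.rs A (levelSet f P.lam0 \ A) S) ∧
    Metric.cthickening P.rc C ⊆ A ∧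
    ∀ x ∈ Metric.cthickening P.rc C \ C,
      P.cLow * Metric.infDist x C ^ P.beta ≤ lam - f x ∧
        lam - f x ≤ P.cUp * Metric.infDist x C ^ P.beta

/-- `γ = lam - sup f` over the points at distance more than `rc` from every connected component
of `{f ≥ lam}`. -/
def gap (f : Euc D → ℝ) (lam rc : ℝ) : ℝ :=
  lam - sSup (f '' (⋃ C ∈ levelComponents f lam, Metric.cthickening rc C)ᶜ)

/-- The law of `n` i.i.d. draws from the density `f` with respect to Lebesgue measure. -/
def sampleLaw (f : Euc D → ℝ) (n : ℕ) : Measure (Fin n → Euc D) :=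
  Measure.pi fun _ => (volume : Measure (Euc D)).withDensity fun x => ENNReal.ofReal (f x)

end Conditions

/-! ### Parameter settings -/

/-- The volume `v_D` of the unit ball of `ℝ^D`. -/
def unitBallVol (D : ℕ) : ℝ := (volume (Metric.ball (0 : Euc D) 1)).toReal

/-- `C_{δ,n} = C₀ log(2/δ) √(D log n)`. -/
def confConst (C₀ δ : ℝ) (D n : ℕ) : ℝ :=
  C₀ * Real.log (2 / δ) * Real.sqrt (D * Real.log n)

/-- `ε = (k / (n v_D (λ - λ C_{δ,n}² / √k)))^{1/D}`. -/
def eps (C₀ δ lam : ℝ) (D n k : ℕ) : ℝ :=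
  ((k : ℝ) / (n * unitBallVol D * (lam - lam * confConst C₀ δ D n ^ 2 / Real.sqrt k)))
    ^ (1 / (D : ℝ))

/-- `ε̃ = (k / (n v_D (λ - λ C_{δ,n}² / k^{1/3})))^{1/D}`. -/
def epsTilde (C₀ δ lam : ℝ) (D n k : ℕ) : ℝ :=
  ((k : ℝ) / (n * unitBallVol D * (lam - lam * confConst C₀ δ D n ^ 2 / (k : ℝ) ^ (1 / 3 : ℝ))))
    ^ (1 / (D : ℝ))

/-- The estimated clusters `Ĉ_λ`: the output of DBSCAN(k, `ε`). -/
def estClusters (C₀ δ lam : ℝ) {D n : ℕ} (k : ℕ) (X : Fin n → Euc D) : Set (Set (Euc D)) :=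
  dbscan X k (eps C₀ δ lam D n k)

/-- The pruned clusters `C̃_λ`: clusters of DBSCAN(k, `ε`) merged along those of
DBSCAN(k, `ε̃`). -/
def prunedClusters (C₀ δ lam : ℝ) {D n : ℕ} (k : ℕ) (X : Fin n → Euc D) : Set (Set (Euc D)) :=
  mergeClusters (dbscan X k (eps C₀ δ lam D n k)) (dbscan X k (epsTilde C₀ δ lam D n k))

/-- `K_l (log n)^a ≤ k ≤ K_u (log n)^{2D/(2β+D)} n^{2β/(2β+D)}`. -/
def InRange (Kl Ku β : ℝ) (a D n k : ℕ) : Prop :=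
  Kl * Real.log n ^ a ≤ k ∧
    (k : ℝ) ≤ Ku * Real.log n ^ (2 * D / (2 * β + D)) * (n : ℝ) ^ (2 * β / (2 * β + D))

/-- The Hausdorff error bound `2 (4λ/Č_β)^{1/β} C_{δ,n}^{2/β} k^{-1/(2β)}`. -/
def errBound (C₀ δ lam : ℝ) (P : Params) (D n k : ℕ) : ℝ :=
  2 * (4 * lam / P.cLow) ^ (1 / P.beta) * confConst C₀ δ D n ^ (2 / P.beta) *
    (k : ℝ) ^ (-(1 / (2 * P.beta)))

/-- Every true cluster has an estimate within Hausdorff distance `ρ`. -/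
def AllRecovered {D : ℕ} (true_ est : Set (Set (Euc D))) (ρ : ℝ) : Prop :=
  ∀ C ∈ true_, ∃ K ∈ est, Metric.hausdorffEDist C K ≤ ENNReal.ofReal ρ

/-- Every estimate is within Hausdorff distance `ρ` of a true cluster. -/
def NoFalseCluster {D : ℕ} (true_ est : Set (Set (Euc D))) (ρ : ℝ) : Prop :=
  ∀ K ∈ est, ∃ C ∈ true_, Metric.hausdorffEDist C K ≤ ENNReal.ofReal ρ

end

end LevelSetDBSCAN

/-!
The number of sample points in a ball of mass `p` deviates from `n p` by `O(√(n p log(1/δ')))`, and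
a union bound over a net of centers and over the balls around sample points makes this uniform. At
the radius `ε`, chosen so that a ball of constant density `λ (1 - η)` with `η = C_{δ,n}² / √k` has
mass `k / n`, every sample point near a component of `{f ≥ λ}` is therefore a core-point and no
sample point where `f < λ (1 - 2η)` nearby is one. The falloff condition turns the slack `η` in the
density into the distance `(2λη/Č_β)^{1/β}`; since it forces `f` below this threshold on a whole
shell of width more than `ε` around the component, chains cannot leave the component, and since a
connected set covered by balls with core-points is joined by chains, they reach all of it. For the
pruning, the coarser radius `ε̃ ≥ ε` has a slack that tends to zero as well, so that a gap keeps all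
its core-points near the components.

The lower bound is Le Cam's two-point method: moving the apex of a peak `λ - κ |x - z|^β` by `s`
changes the density by `O(s^β)` on a ball of volume `O(s^D)`, so the `χ²`-divergence is
`O(s^{2β+D})` and `s ≍ n^{-1/(2β+D)}` cannot be detected with `n` draws.
-/

namespace LevelSetDBSCAN

section Metric

lemma mem_cthickening_add_of_dist_le {α : Type*} [PseudoMetricSpace α] {C : Set α} {x y : α}
    {r s : ℝ} (hr : 0 ≤ r) (hx : x ∈ Metric.cthickening r C) (hyx : dist y x ≤ s) :
    y ∈ Metric.cthickening (r + s) C := by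
  have hs : 0 ≤ s := dist_nonneg.trans hyx
  rw [add_comm]
  exact Metric.cthickening_cthickening_subset hs hr C
    (Metric.mem_cthickening_of_dist_le y x s _ hx hyx)

lemma isPreconnected_cthickening {E : Type*} [NormedAddCommGroup E] [NormedSpace ℝ E]
    [ProperSpace E] {C : Set E} (hC : IsPreconnected C) {r : ℝ} (hr : 0 ≤ r) :
    IsPreconnected (Metric.cthickening r C) := by
  have hsum : Metric.cthickening r C = Set.image2 (· + ·) (closure C) (Metric.closedBall 0 r) := by
    rw [Metric.cthickening_eq_biUnion_closedBall C hr, ← Set.iUnion_image_left]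
    simp
  rw [hsum, ← Set.image_uncurry_prod]
  exact (hC.closure.prod (convex_closedBall _ _).isPreconnected).image _
    continuous_add.continuousOn

end Metric

section Reachability

variable {α : Type*} [PseudoMetricSpace α] {n : ℕ} {X : Fin n → α} {m : ℕ} {ε : ℝ} {p q : α}

lemma Reachable.symm (h : Reachable X m ε q p) (hq : q ∈ corePoints X m ε) :
    Reachable X m ε p q := by
  induction h using Relation.ReflTransGen.head_induction_on with
  | refl => exact .refl
  | head h' _ ih => exact (ih h'.1).tail ⟨hq, h'.1.1, by rw [dist_comm]; exact h'.2.2⟩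

lemma Reachable.mem_range (h : Reachable X m ε q p) (hp : p ∈ Set.range X) :
    q ∈ Set.range X := by
  induction h using Relation.ReflTransGen.head_induction_on with
  | refl => exact hp
  | head h' _ _ => exact h'.2.1

lemma subset_range_of_mem_dbscan {K : Set α} (hK : K ∈ dbscan X m ε) : K ⊆ Set.range X := by
  obtain ⟨p, hp, rfl⟩ := hK
  exact fun q hq => Reachable.mem_range hq hp.1

lemma corePoints_mono {ε' : ℝ} (h : ε ≤ ε') : corePoints X m ε ⊆ corePoints X m ε' := by
  rintro p ⟨hp, hm⟩
  exact ⟨hp, hm.trans (Set.ncard_le_ncard (fun i hi => le_trans hi h) (Set.toFinite _))⟩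

lemma Reachable.mem_cthickening {C : Set α} {r R : ℝ} (hr : 0 ≤ r) (hε : 0 ≤ ε) (hrR : r + ε ≤ R)
    (hcore : corePoints X m ε ∩ Metric.cthickening R C ⊆ Metric.cthickening r C)
    (hp : p ∈ corePoints X m ε ∩ Metric.cthickening R C) (h : Reachable X m ε q p) :
    q ∈ Metric.cthickening (r + ε) C := by
  induction h using Relation.ReflTransGen.head_induction_on with
  | refl => exact Metric.cthickening_mono (le_add_of_nonneg_right hε) C (hcore hp)
  | head h' _ ih =>
    exact mem_cthickening_add_of_dist_le hr
      (hcore ⟨h'.1, Metric.cthickening_mono hrR C ih⟩) h'.2.2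

/-- Being joined by chains is locally constant along `S`: nearby points of `S` are served by
sample points at distance at most `ε`. -/
lemma reachable_of_isPreconnected {S : Set α} (hS : IsPreconnected S) (hε : 0 < ε)
    (hcover : ∀ x ∈ S, ∃ i, dist (X i) x ≤ ε / 3)
    (hcore : ∀ x ∈ S, ∀ i, dist (X i) x ≤ ε / 3 → X i ∈ corePoints X m ε)
    {x y : α} (hx : x ∈ S) (hy : y ∈ S) {i j : Fin n} (hi : dist (X i) x ≤ ε / 3)
    (hj : dist (X j) y ≤ ε / 3) : Reachable X m ε (X i) (X j) := by
  suffices key : ∀ i j, dist (X i) x ≤ ε / 3 → dist (X j) y ≤ ε / 3 →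
      Reachable X m ε (X i) (X j) from key i j hi hj
  refine hS.induction₂ (fun x y => ∀ i j, dist (X i) x ≤ ε / 3 → dist (X j) y ≤ ε / 3 →
    Reachable X m ε (X i) (X j)) ?_ ?_ ?_ hx hy
  · intro x _
    filter_upwards [mem_nhdsWithin_of_mem_nhds (Metric.ball_mem_nhds x (by positivity : 0 < ε / 3)),
      self_mem_nhdsWithin] with y hyx hyS i j hi hj
    refine .single ⟨hcore y hyS j hj, ⟨i, rfl⟩, ?_⟩
    rw [Metric.mem_ball'] at hyx
    rw [dist_comm] at hj
    linarith [dist_triangle4 (X i) x y (X j)]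
  · intro x y z _ hy _ hxy hyz i j hi hj
    obtain ⟨l, hl⟩ := hcover y hy
    exact (hxy i l hi hl).trans (hyz l j hl hj)
  · intro x y hx _ hxy i j hi hj
    exact (hxy j i hj hi).symm (hcore x hx j hj)

end Reachability

section LevelSets

variable {D : ℕ} {f : Euc D → ℝ} {t : ℝ} {C : Set (Euc D)}

lemma isClosed_levelSet (hf : Continuous f) (t : ℝ) : IsClosed (levelSet f t) :=
  isClosed_le continuous_const hf

lemma subset_levelSet_of_mem_levelComponents (hC : C ∈ levelComponents f t) :
    C ⊆ levelSet f t := by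
  obtain ⟨x, -, rfl⟩ := hC
  exact connectedComponentIn_subset _ _

lemma isConnected_of_mem_levelComponents (hC : C ∈ levelComponents f t) : IsConnected C := by
  obtain ⟨x, hx, rfl⟩ := hC
  exact isConnected_connectedComponentIn_iff.mpr hx

lemma exists_mem_levelComponents {x : Euc D} (hx : x ∈ levelSet f t) :
    ∃ C ∈ levelComponents f t, x ∈ C :=
  ⟨_, ⟨x, hx, rfl⟩, mem_connectedComponentIn hx⟩

lemma exists_mem_cthickening_of_lt {lam rc γ : ℝ} (hf : BddAbove (Set.range f))
    (hγ : γ ≤ gap f lam rc) {x : Euc D} (hx : lam - γ < f x) :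
    ∃ C ∈ levelComponents f lam, x ∈ Metric.cthickening rc C := by
  by_contra! hfar
  have hmem : f x ∈ f '' (⋃ C ∈ levelComponents f lam, Metric.cthickening rc C)ᶜ :=
    ⟨x, by simpa using hfar, rfl⟩
  have hle := le_csSup (hf.mono (Set.image_subset_range _ _)) hmem
  unfold gap at hγ
  linarith

end LevelSets

/-- The analytic half of `Admissible`: a continuous density bounded by `fmax` which falls off like
the `β`-th power of the distance to each component of `{f ≥ lam}`. Nothing is required of the level
`lam0` components, so the components at level `lam` need not be separated by a valley. -/
structure LevelRegular {D : ℕ} (P : Params) (lam : ℝ) (f : Euc D → ℝ) : Prop where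
  continuous : Continuous f
  nonneg : ∀ x, 0 ≤ f x
  le_fmax : ∀ x, f x ≤ P.fmax
  lintegral_eq_one : ∫⁻ x, ENNReal.ofReal (f x) = 1
  lam0_lt : P.lam0 < lam
  falloff : ∀ C ∈ levelComponents f lam, ∀ x ∈ Metric.cthickening P.rc C \ C,
    P.cLow * Metric.infDist x C ^ P.beta ≤ lam - f x ∧
      lam - f x ≤ P.cUp * Metric.infDist x C ^ P.beta

lemma Admissible.levelRegular {D : ℕ} {P : Params} {lam : ℝ} {f : Euc D → ℝ}
    (h : Admissible P lam f) : LevelRegular P lam f where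
  continuous := h.continuous
  nonneg := h.nonneg
  le_fmax := h.le_fmax
  lintegral_eq_one := h.lintegral_eq_one
  lam0_lt := h.lam0_lt
  falloff C hC := by
    obtain ⟨A, -, -, -, -, hfalloff⟩ := h.separation C hC
    exact hfalloff

/-- The distance `(2λη/Č_β)^{1/β}` from a component beyond which, within its `rc`-neighbourhood,
a density regular at level `lam` is below `lam (1 - 2η)`. -/
noncomputable def Params.falloffRadius (P : Params) (lam η : ℝ) : ℝ :=
  (2 * lam * η / P.cLow) ^ (1 / P.beta)

lemma Params.falloffRadius_nonneg (P : Params) {lam η : ℝ} (hlam : 0 ≤ lam) (hη : 0 ≤ η) :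
    0 ≤ P.falloffRadius lam η :=
  Real.rpow_nonneg (div_nonneg (by positivity) P.cLow_pos.le) _

namespace LevelRegular

variable {D : ℕ} {P : Params} {lam η r : ℝ} {f : Euc D → ℝ} {C : Set (Euc D)} {x : Euc D}

lemma lam_pos (h : LevelRegular P lam f) : 0 < lam := P.lam0_pos.trans h.lam0_lt

lemma lam_le_fmax (h : LevelRegular P lam f) (hC : C ∈ levelComponents f lam) : lam ≤ P.fmax :=
  have ⟨x, hx⟩ := (isConnected_of_mem_levelComponents hC).nonempty
  (subset_levelSet_of_mem_levelComponents hC hx).trans (h.le_fmax x)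

lemma bddAbove_range (h : LevelRegular P lam f) : BddAbove (Set.range f) :=
  ⟨P.fmax, Set.forall_mem_range.2 h.le_fmax⟩

lemma sub_le_of_mem_cthickening (h : LevelRegular P lam f) (hC : C ∈ levelComponents f lam)
    (hr : 0 ≤ r) (hrc : r ≤ P.rc) (hx : x ∈ Metric.cthickening r C) :
    lam - P.cUp * r ^ P.beta ≤ f x := by
  have hdrop : 0 ≤ P.cUp * r ^ P.beta := mul_nonneg P.cUp_pos.le (Real.rpow_nonneg hr _)
  by_cases hxC : x ∈ C
  · have : lam ≤ f x := subset_levelSet_of_mem_levelComponents hC hxC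
    linarith
  · have hdist : Metric.infDist x C ≤ r := ENNReal.toReal_le_of_le_ofReal hr hx
    have hfx := (h.falloff C hC x ⟨Metric.cthickening_mono hrc C hx, hxC⟩).2
    have := mul_le_mul_of_nonneg_left
      (Real.rpow_le_rpow Metric.infDist_nonneg hdist P.beta_pos.le) P.cUp_pos.le
    linarith

lemma mem_cthickening_falloffRadius (h : LevelRegular P lam f) (hη : 0 ≤ η)
    (hC : C ∈ levelComponents f lam) (hx : x ∈ Metric.cthickening P.rc C)
    (hfx : lam * (1 - 2 * η) ≤ f x) : x ∈ Metric.cthickening (P.falloffRadius lam η) C := by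
  by_cases hxC : x ∈ C
  · exact Metric.self_subset_cthickening C hxC
  have hfalloff := (h.falloff C hC x ⟨hx, hxC⟩).1
  have hpow : Metric.infDist x C ^ P.beta ≤ 2 * lam * η / P.cLow := by
    rw [le_div_iff₀' P.cLow_pos]; linarith
  have hdist : Metric.infDist x C ≤ P.falloffRadius lam η := by
    have hquot : 0 ≤ 2 * lam * η / P.cLow :=
      div_nonneg (by have := h.lam_pos; positivity) P.cLow_pos.le
    rw [Params.falloffRadius, one_div]
    exact (Real.le_rpow_inv_iff_of_pos Metric.infDist_nonneg hquot P.beta_pos).2 hpow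
  have hfinite : Metric.infEDist x C ≠ ⊤ :=
    Metric.infEDist_ne_top (isConnected_of_mem_levelComponents hC).nonempty
  exact (ENNReal.le_ofReal_iff_toReal_le hfinite
    (P.falloffRadius_nonneg h.lam_pos.le hη)).2 hdist

end LevelRegular

/-- What the concentration of the empirical measure yields at scale `ε` with relative slack `η`:
sample points with high density around them are core-points, core-points have high density nearby,
and every point within `ρ` of `{f ≥ lam}` is close to a sample point. -/
structure GoodSample {D n : ℕ} (f : Euc D → ℝ) (lam : ℝ) (X : Fin n → Euc D) (k : ℕ)
    (ε η ρ : ℝ) : Prop where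
  mem_corePoints : ∀ i, (∀ y, dist y (X i) ≤ ε → lam * (1 - η / 2) ≤ f y) → X i ∈ corePoints X k ε
  exists_le : ∀ p ∈ corePoints X k ε, ∃ y, dist y p ≤ ε ∧ lam * (1 - 2 * η) ≤ f y
  cover : ∀ x ∈ Metric.cthickening ρ (levelSet f lam), ∃ i, dist (X i) x ≤ ε / 3

/-- The scale `ε` and the collar width `ρ` are small enough for the slack `η`: `f` stays above
`lam (1 - η / 2)` on the `(ρ + 2ε)`-neighbourhood of each component, and clusters cannot leave its
`rc`-neighbourhood. -/
structure FineScale (P : Params) (lam ε η ρ : ℝ) : Prop where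
  eps_pos : 0 < ε
  slack_nonneg : 0 ≤ η
  collar_nonneg : 0 ≤ ρ
  height : P.cUp * (ρ + 2 * ε) ^ P.beta ≤ lam * η / 2
  collar_le : ρ + 2 * ε ≤ P.rc
  falloff_le : P.falloffRadius lam η + 3 * ε ≤ P.rc

namespace GoodSample

variable {D n k : ℕ} {P : Params} {lam ε η ρ : ℝ} {f : Euc D → ℝ} {X : Fin n → Euc D}
  {C : Set (Euc D)}

lemma mem_corePoints_of_mem_cthickening (G : GoodSample f lam X k ε η ρ)
    (h : LevelRegular P lam f) (S : FineScale P lam ε η ρ) (hC : C ∈ levelComponents f lam)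
    {i : Fin n} (hi : X i ∈ Metric.cthickening (ρ + ε) C) : X i ∈ corePoints X k ε := by
  have hρ := S.collar_nonneg
  have hε := S.eps_pos
  refine G.mem_corePoints i fun y hy => ?_
  have hyC := mem_cthickening_add_of_dist_le (by positivity) hi hy
  have := h.sub_le_of_mem_cthickening hC (by positivity) S.collar_le
    (Metric.cthickening_mono (by linarith) C hyC)
  linarith [S.height]

lemma reachable_of_mem_cthickening (G : GoodSample f lam X k ε η ρ) (h : LevelRegular P lam f)
    (S : FineScale P lam ε η ρ) (hC : C ∈ levelComponents f lam) {i j : Fin n}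
    (hi : X i ∈ Metric.cthickening ρ C) (hj : X j ∈ Metric.cthickening ρ C) :
    Reachable X k ε (X i) (X j) := by
  have hε := S.eps_pos
  have hthird : ∀ l, dist (X l) (X l) ≤ ε / 3 := fun l => by rw [dist_self]; positivity
  refine reachable_of_isPreconnected
    (isPreconnected_cthickening (isConnected_of_mem_levelComponents hC).isPreconnected
      S.collar_nonneg) hε
    (fun x hx => G.cover x (Metric.cthickening_subset_of_subset ρ
      (subset_levelSet_of_mem_levelComponents hC) hx))
    (fun x hx l hl => G.mem_corePoints_of_mem_cthickening h S hC ?_) hi hj (hthird i) (hthird j)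
  exact Metric.cthickening_mono (by linarith) C
    (mem_cthickening_add_of_dist_le S.collar_nonneg hx hl)

lemma corePoints_inter_cthickening_subset (G : GoodSample f lam X k ε η ρ)
    (h : LevelRegular P lam f) (S : FineScale P lam ε η ρ) (hC : C ∈ levelComponents f lam) :
    corePoints X k ε ∩ Metric.cthickening (P.rc - ε) C ⊆
      Metric.cthickening (P.falloffRadius lam η + ε) C := by
  rintro p ⟨hp, hpC⟩
  have hr := P.falloffRadius_nonneg h.lam_pos.le S.slack_nonneg
  have hε := S.eps_pos
  obtain ⟨y, hy, hfy⟩ := G.exists_le p hp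
  have hyC := mem_cthickening_add_of_dist_le (by linarith [S.falloff_le]) hpC hy
  rw [sub_add_cancel] at hyC
  exact mem_cthickening_add_of_dist_le hr
    (h.mem_cthickening_falloffRadius S.slack_nonneg hC hyC hfy) (by rwa [dist_comm])

lemma setOf_reachable_subset_cthickening (G : GoodSample f lam X k ε η ρ)
    (h : LevelRegular P lam f) (S : FineScale P lam ε η ρ) (hC : C ∈ levelComponents f lam)
    {p : Euc D} (hp : p ∈ corePoints X k ε ∩ Metric.cthickening (P.rc - ε) C) :
    {q | Reachable X k ε q p} ⊆ Metric.cthickening (P.falloffRadius lam η + 2 * ε) C := by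
  intro q hq
  have hr := P.falloffRadius_nonneg h.lam_pos.le S.slack_nonneg
  have hε := S.eps_pos
  have := hq.mem_cthickening (by positivity) hε.le (by linarith [S.falloff_le])
    (G.corePoints_inter_cthickening_subset h S hC) hp
  rwa [show P.falloffRadius lam η + 2 * ε = P.falloffRadius lam η + ε + ε by ring]

theorem exists_cluster (G : GoodSample f lam X k ε η ε) (h : LevelRegular P lam f)
    (S : FineScale P lam ε η ε) (hC : C ∈ levelComponents f lam) :
    ∃ K ∈ dbscan X k ε, K ⊆ Metric.cthickening (P.falloffRadius lam η + 2 * ε) C ∧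
      C ⊆ Metric.cthickening ε K := by
  have hε := S.eps_pos
  have hnear : ∀ c ∈ C, ∃ i, X i ∈ Metric.cthickening ε C ∧ dist c (X i) ≤ ε := fun c hc => by
    obtain ⟨i, hi⟩ := G.cover c (Metric.self_subset_cthickening _
      (subset_levelSet_of_mem_levelComponents hC hc))
    have hiε : dist (X i) c ≤ ε := by linarith
    exact ⟨i, Metric.mem_cthickening_of_dist_le _ c ε C hc hiε, by rwa [dist_comm]⟩
  obtain ⟨c₀, hc₀⟩ := (isConnected_of_mem_levelComponents hC).nonempty
  obtain ⟨i, hi, -⟩ := hnear c₀ hc₀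
  have hcore : X i ∈ corePoints X k ε := G.mem_corePoints_of_mem_cthickening h S hC
    (Metric.cthickening_mono (by linarith) C hi)
  refine ⟨{q | Reachable X k ε q (X i)}, ⟨X i, hcore, rfl⟩, ?_, fun c hc => ?_⟩
  · exact G.setOf_reachable_subset_cthickening h S hC
      ⟨hcore, Metric.cthickening_mono (by linarith [S.collar_le]) C hi⟩
  · obtain ⟨j, hj, hcj⟩ := hnear c hc
    exact Metric.mem_cthickening_of_dist_le c (X j) ε _
      (G.reachable_of_mem_cthickening h S hC hj hi) hcj

theorem allRecovered (G : GoodSample f lam X k ε η ε) (h : LevelRegular P lam f)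
    (S : lam ≤ P.fmax → FineScale P lam ε η ε) {r : ℝ}
    (hr : P.falloffRadius lam η + 2 * ε ≤ r) :
    AllRecovered (levelComponents f lam) (dbscan X k ε) r := by
  intro C hC
  have hS := S (h.lam_le_fmax hC)
  have hε := hS.eps_pos
  have hrad := P.falloffRadius_nonneg h.lam_pos.le hS.slack_nonneg
  obtain ⟨K, hK, hKC, hCK⟩ := G.exists_cluster h hS hC
  exact ⟨K, hK, Metric.hausdorffEDist_le_of_infEDist
    (hCK.trans (Metric.cthickening_mono (by linarith) K))
    (hKC.trans (Metric.cthickening_mono hr C))⟩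

lemma exists_component_of_mem_corePoints (G : GoodSample f lam X k ε η ρ)
    (h : LevelRegular P lam f) {γ : ℝ} (hγ : γ ≤ gap f lam P.rc) (hη : 0 ≤ η) (hη4 : η ≤ 1 / 4)
    (hηγ : 4 * P.fmax * η < γ) {p : Euc D} (hp : p ∈ corePoints X k ε) :
    ∃ C ∈ levelComponents f lam, p ∈ Metric.cthickening (P.falloffRadius lam η + ε) C := by
  obtain ⟨y, hy, hfy⟩ := G.exists_le p hp
  have hlam := h.lam_pos
  have hlam2 : lam ≤ 2 * P.fmax := by nlinarith [h.le_fmax y]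
  have hlt : lam - γ < f y := by nlinarith
  obtain ⟨C, hC, hyC⟩ := exists_mem_cthickening_of_lt h.bddAbove_range hγ hlt
  exact ⟨C, hC, mem_cthickening_add_of_dist_le (P.falloffRadius_nonneg hlam.le hη)
    (h.mem_cthickening_falloffRadius hη hC hyC hfy) (by rwa [dist_comm])⟩

/-- A cluster of the coarse scale that contains a fine core-point stays near one component `C`, and
it absorbs the fine cluster of `C`: the merged cluster is therefore close to the whole of `C`. -/
theorem noFalseCluster {ε' η' γ r : ℝ}
    (G : GoodSample f lam X k ε η ε)
    (G' : GoodSample f lam X k ε' η' (P.falloffRadius lam η + 2 * ε))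
    (h : LevelRegular P lam f) (hγ : γ ≤ gap f lam P.rc) (hη : 0 ≤ η) (hη4 : η ≤ 1 / 4)
    (hηγ : 4 * P.fmax * η < γ) (hεε' : ε ≤ ε')
    (S : lam ≤ P.fmax → FineScale P lam ε η ε)
    (S' : lam ≤ P.fmax → FineScale P lam ε' η' (P.falloffRadius lam η + 2 * ε))
    (hr : P.falloffRadius lam η + 2 * ε ≤ r) :
    NoFalseCluster (levelComponents f lam) (mergeClusters (dbscan X k ε) (dbscan X k ε')) r := by
  rintro _ ⟨W, ⟨w, -, rfl⟩, ⟨_, ⟨p, hp, rfl⟩, hpW⟩, rfl⟩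
  obtain ⟨C, hC, hpC⟩ := G.exists_component_of_mem_corePoints h hγ hη hη4 hηγ hp
  replace S := S (h.lam_le_fmax hC)
  replace S' := S' (h.lam_le_fmax hC)
  have hε := S.eps_pos
  have hrad := P.falloffRadius_nonneg h.lam_pos.le hη
  have hp' : p ∈ corePoints X k ε' := corePoints_mono hεε' hp
  have hpw : Reachable X k ε' p w := hpW .refl
  have hpC' : p ∈ Metric.cthickening (P.falloffRadius lam η + 2 * ε) C :=
    Metric.cthickening_mono (by linarith) C hpC
  have hWC : {q | Reachable X k ε' q w} ⊆
      Metric.cthickening (P.falloffRadius lam η' + 2 * ε') C := fun q hq =>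
    G'.setOf_reachable_subset_cthickening h S' hC
      ⟨hp', Metric.cthickening_mono (by linarith [S'.collar_le]) C hpC'⟩
      (hq.trans (hpw.symm hp'))
  obtain ⟨K, hK, hKC, hCK⟩ := G.exists_cluster h S hC
  have hKW : K ⊆ {q | Reachable X k ε' q w} := by
    intro q hq
    obtain ⟨i, rfl⟩ := subset_range_of_mem_dbscan hK hq
    obtain ⟨j, rfl⟩ := hp.1
    exact (G'.reachable_of_mem_cthickening h S' hC (hKC hq) hpC').trans hpw
  refine ⟨C, hC, Metric.hausdorffEDist_le_of_infEDist ?_ ?_⟩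
  · have hKE : K ⊆ ⋃₀ {K | K ∈ dbscan X k ε ∧ K ⊆ {q | Reachable X k ε' q w}} :=
      Set.subset_sUnion_of_mem (show _ ∧ _ from ⟨hK, hKW⟩)
    exact (hCK.trans (Metric.cthickening_subset_of_subset ε hKE)).trans
      (Metric.cthickening_mono (by linarith) _)
  · refine Set.sUnion_subset ?_
    rintro _ ⟨⟨v, hv, rfl⟩, hvW⟩
    have hreach : P.falloffRadius lam η' + 2 * ε' ≤ P.rc - ε := by linarith [S'.falloff_le]
    have hvC := Metric.cthickening_mono hreach C (hWC (hvW .refl))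
    exact (G.setOf_reachable_subset_cthickening h S hC ⟨hv, hvC⟩).trans
      (Metric.cthickening_mono hr C)

end GoodSample

section Concentration

open ProbabilityTheory

lemma exp_mul_indicator {α : Type*} (B : Set α) (s : ℝ) (x : α) :
    Real.exp (s * B.indicator (fun _ => (1 : ℝ)) x) =
      1 + B.indicator (fun _ => Real.exp s - 1) x := by
  by_cases hx : x ∈ B <;> simp [hx]

lemma ncard_neighbours_eq_one_add {E : Type*} [PseudoMetricSpace E] {m : ℕ}
    (X : Fin (m + 1) → E) (i : Fin (m + 1)) {ε : ℝ} (hε : 0 ≤ ε) :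
    ({j | dist (X j) (X i) ≤ ε}.ncard : ℝ) = 1 + ∑ j : Fin m,
      (Metric.closedBall (X i) ε).indicator (fun _ => (1 : ℝ)) (X (i.succAbove j)) := by
  classical
  rw [← Set.coe_toFinset {j | dist (X j) (X i) ≤ ε}, Set.ncard_coe_finset, Set.toFinset_ofPred,
    Finset.card_filter]
  push_cast
  rw [Fin.sum_univ_succAbove _ i]
  simp [hε, Set.indicator_apply]

lemma exp_sub_one_le_add_sq {x : ℝ} (hx : |x| ≤ 1) : Real.exp x - 1 ≤ x + x ^ 2 := by
  linarith [(abs_le.mp (Real.abs_exp_sub_one_sub_id_le hx)).2]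

lemma measure_exists_le {Ω : Type*} [MeasurableSpace Ω] (ν : Measure Ω) {n : ℕ}
    {A : Fin n → Ω → Prop} {c : ℝ} (hA : ∀ i, ν {ω | A i ω} ≤ ENNReal.ofReal c) :
    ν {ω | ∃ i, A i ω} ≤ ENNReal.ofReal (n * c) := by
  rw [Set.ofPred_exists]
  calc ν (⋃ i, {ω | A i ω}) ≤ ∑ i, ν {ω | A i ω} := measure_iUnion_fintype_le _ _
    _ ≤ ∑ _i : Fin n, ENNReal.ofReal c := Finset.sum_le_sum fun i _ => hA i
    _ = ENNReal.ofReal (n * c) := by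
      rw [Finset.sum_const, Finset.card_fin, nsmul_eq_mul, ENNReal.ofReal_mul n.cast_nonneg,
        ENNReal.ofReal_natCast]

variable {E : Type*} [MeasurableSpace E] (μ : Measure E) [IsProbabilityMeasure μ]

lemma integral_exp_mul_indicator {B : Set E} (hB : MeasurableSet B) (s : ℝ) :
    ∫ x, Real.exp (s * B.indicator (fun _ => (1 : ℝ)) x) ∂μ =
      1 + μ.real B * (Real.exp s - 1) := by
  simp_rw [exp_mul_indicator]
  rw [integral_add (integrable_const _) ((integrable_const _).indicator hB),
    integral_indicator_const _ hB]
  simp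

/-- Chernoff's bound in both directions at once: `s < 0` bounds the probability of few hits. -/
lemma measure_pi_le_sum_indicator_le {ι : Type*} [Fintype ι] {B : Set E} (hB : MeasurableSet B)
    (s a : ℝ) :
    (Measure.pi fun _ : ι => μ) {Y | s * a ≤ s * ∑ j, B.indicator (fun _ => (1 : ℝ)) (Y j)} ≤
      ENNReal.ofReal
        (Real.exp (-(s * a) + Fintype.card ι * μ.real B * (Real.exp s - 1))) := by
  set hit : E → ℝ := B.indicator fun _ => 1
  set ν : Measure (ι → E) := Measure.pi fun _ => μ
  have hprod : ∀ Y : ι → E, Real.exp (1 * (s * ∑ j, hit (Y j))) = ∏ j, Real.exp (s * hit (Y j)) :=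
    fun Y => by rw [one_mul, Finset.mul_sum, Real.exp_sum]
  have hint : Integrable (fun x => Real.exp (s * hit x)) μ := by
    simp_rw [hit, exp_mul_indicator]
    exact (integrable_const _).add ((integrable_const _).indicator hB)
  have hmgf : mgf (fun Y => s * ∑ j, hit (Y j)) ν 1 =
      (1 + μ.real B * (Real.exp s - 1)) ^ Fintype.card ι := by
    simp only [mgf, hprod]
    rw [integral_fintype_prod_eq_pow (fun x => Real.exp (s * hit x)),
      integral_exp_mul_indicator μ hB]
  have hmarkov := measure_ge_le_exp_mul_mgf (μ := ν) (X := fun Y => s * ∑ j, hit (Y j)) (s * a)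
    zero_le_one (by simpa only [hprod] using Integrable.fintype_prod fun _ : ι => hint)
  have hpow : (1 + μ.real B * (Real.exp s - 1)) ^ Fintype.card ι ≤
      Real.exp (Fintype.card ι * μ.real B * (Real.exp s - 1)) := by
    rw [mul_assoc, Real.exp_nat_mul]
    gcongr
    · rw [← integral_exp_mul_indicator μ hB]
      positivity
    · linarith [Real.add_one_le_exp (μ.real B * (Real.exp s - 1))]
  rw [← ofReal_measureReal, Real.exp_add]
  refine ENNReal.ofReal_le_ofReal (hmarkov.trans ?_)
  rw [hmgf, neg_one_mul]
  gcongr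

variable [PseudoMetricSpace E] [OpensMeasurableSpace E] [SecondCountableTopology E]

lemma measurable_measureReal_closedBall (ε : ℝ) :
    Measurable fun x => μ.real (Metric.closedBall x ε) := by
  have hS : MeasurableSet {p : E × E | dist p.2 p.1 ≤ ε} :=
    measurableSet_le (measurable_snd.dist measurable_fst) measurable_const
  exact (measurable_measure_prodMk_left hS).ennreal_toReal

lemma measure_pi_neighbours_le (m : ℕ) {T : Set E} (hT : MeasurableSet T) {ε : ℝ} (hε : 0 ≤ ε)
    (s a b : ℝ)
    (hb : ∀ x ∈ T, -(s * a) + m * μ.real (Metric.closedBall x ε) * (Real.exp s - 1) ≤ b)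
    (i : Fin (m + 1)) :
    (Measure.pi fun _ : Fin (m + 1) => μ) {X | X i ∈ T ∧
      s * (a + 1) ≤ s * ({j | dist (X j) (X i) ≤ ε}.ncard : ℝ)} ≤ ENNReal.ofReal (Real.exp b) := by
  set S : Set (E × (Fin m → E)) := {p | p.1 ∈ T ∧ s * a ≤ s * ∑ j,
    (Metric.closedBall p.1 ε).indicator (fun _ => (1 : ℝ)) (p.2 j)}
  have hS : MeasurableSet S := by
    have hclose : ∀ j, MeasurableSet {p : E × (Fin m → E) | dist (p.2 j) p.1 ≤ ε} := fun j =>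
      measurableSet_le (((measurable_pi_apply j).comp measurable_snd).dist measurable_fst)
        measurable_const
    exact (measurable_fst hT).inter <| measurableSet_le measurable_const <|
      (Finset.measurable_fun_sum _ fun j _ => measurable_const.indicator (hclose j)).const_mul s
  have hsection : ∀ x, (Measure.pi fun _ : Fin m => μ) (Prod.mk x ⁻¹' S) ≤
      ENNReal.ofReal (Real.exp b) := by
    intro x
    by_cases hx : x ∈ T
    · refine (measure_mono fun Y hY => hY.2).trans ((measure_pi_le_sum_indicator_le μ
        (Metric.isClosed_closedBall (x := x) (ε := ε)).measurableSet s a).trans ?_)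
      rw [Fintype.card_fin]
      exact ENNReal.ofReal_le_ofReal (Real.exp_le_exp.mpr (hb x hx))
    · simp [S, hx]
  have hpre : {X : Fin (m + 1) → E | X i ∈ T ∧
      s * (a + 1) ≤ s * ({j | dist (X j) (X i) ≤ ε}.ncard : ℝ)} ⊆
      MeasurableEquiv.piFinSuccAbove (fun _ => E) i ⁻¹' S := by
    rintro X ⟨hiT, hi⟩
    rw [ncard_neighbours_eq_one_add X i hε] at hi
    refine ⟨hiT, ?_⟩
    change s * a ≤ s * ∑ j : Fin m, (Metric.closedBall (X i) ε).indicator (fun _ => (1 : ℝ))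
      (X (i.succAbove j))
    linarith
  refine (measure_mono hpre).trans ?_
  rw [(measurePreserving_piFinSuccAbove (fun _ : Fin (m + 1) => μ) i).measure_preimage
    hS.nullMeasurableSet, Measure.prod_apply hS]
  calc ∫⁻ x, (Measure.pi fun _ : Fin m => μ) (Prod.mk x ⁻¹' S) ∂μ
      ≤ ∫⁻ _, ENNReal.ofReal (Real.exp b) ∂μ := lintegral_mono hsection
    _ = ENNReal.ofReal (Real.exp b) := by simp

lemma measure_few_neighbours_le {n : ℕ} {ε : ℝ} (hε : 0 ≤ ε) (k : ℕ) {η : ℝ} (hη : 0 ≤ η)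
    (hη4 : η ≤ 1 / 4) :
    (Measure.pi fun _ : Fin n => μ) {X | ∃ i,
      k * (1 + η / 2) ≤ n * μ.real (Metric.closedBall (X i) ε) ∧
      ({j | dist (X j) (X i) ≤ ε}.ncard : ℝ) ≤ k} ≤
      ENNReal.ofReal (n * Real.exp (1 - k * η ^ 2 / 32)) := by
  rcases n with _ | m
  · simp
  refine measure_exists_le _ fun i => ?_
  have hT : MeasurableSet
      {x | (k : ℝ) * (1 + η / 2) ≤ (m + 1 : ℕ) * μ.real (Metric.closedBall x ε)} :=
    measurableSet_le measurable_const ((measurable_measureReal_closedBall μ ε).const_mul _)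
  refine (measure_mono ?_).trans
    (measure_pi_neighbours_le μ m hT hε (-(η / 4)) k (1 - k * η ^ 2 / 32) (fun x hx => ?_) i)
  · rintro X ⟨hmass, hfew⟩
    exact ⟨hmass, by nlinarith⟩
  · replace hx : (k : ℝ) * (1 + η / 2) ≤ (m + 1 : ℕ) * μ.real (Metric.closedBall x ε) := hx
    push_cast at hx
    have hmass : (k : ℝ) * (1 + η / 2) - 1 ≤ m * μ.real (Metric.closedBall x ε) := by
      linarith [measureReal_le_one (μ := μ) (s := Metric.closedBall x ε)]
    have hexp := exp_sub_one_le_add_sq (x := -(η / 4)) (by rw [abs_le]; constructor <;> linarith)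
    have hexp_le_one : Real.exp (-(η / 4)) ≤ 1 := Real.exp_le_one_iff.mpr (by linarith)
    have hlin := mul_le_mul_of_nonpos_right hmass (sub_nonpos.2 hexp_le_one)
    have hquad := mul_le_mul_of_nonneg_left hexp (by positivity : 0 ≤ (k : ℝ) * (1 + η / 2))
    have hcubic : (k : ℝ) * η ^ 2 * η ≤ k * η ^ 2 * (1 / 4) := by gcongr
    nlinarith [Real.exp_pos (-(η / 4)), mul_nonneg k.cast_nonneg (sq_nonneg η)]

lemma measure_many_neighbours_le {n : ℕ} {ε : ℝ} (hε : 0 ≤ ε) (k : ℕ) {η : ℝ} (hη : 0 ≤ η)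
    (hη4 : η ≤ 1 / 4) :
    (Measure.pi fun _ : Fin n => μ) {X | ∃ i,
      n * μ.real (Metric.closedBall (X i) ε) ≤ k * (1 - η) ∧
      (k : ℝ) ≤ ({j | dist (X j) (X i) ≤ ε}.ncard : ℝ)} ≤
      ENNReal.ofReal (n * Real.exp (1 - k * η ^ 2 / 32)) := by
  rcases n with _ | m
  · simp
  refine measure_exists_le _ fun i => ?_
  have hT : MeasurableSet
      {x | (m + 1 : ℕ) * μ.real (Metric.closedBall x ε) ≤ (k : ℝ) * (1 - η)} :=
    measurableSet_le ((measurable_measureReal_closedBall μ ε).const_mul _) measurable_const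
  refine (measure_mono ?_).trans
    (measure_pi_neighbours_le μ m hT hε (η / 4) (k - 1) (1 - k * η ^ 2 / 32) (fun x hx => ?_) i)
  · rintro X ⟨hmass, hmany⟩
    exact ⟨hmass, by nlinarith⟩
  · replace hx : (m + 1 : ℕ) * μ.real (Metric.closedBall x ε) ≤ (k : ℝ) * (1 - η) := hx
    push_cast at hx
    have hmass : m * μ.real (Metric.closedBall x ε) ≤ k * (1 - η) := by
      linarith [measureReal_nonneg (μ := μ) (s := Metric.closedBall x ε)]
    have hexp := exp_sub_one_le_add_sq (x := η / 4) (by rw [abs_le]; constructor <;> linarith)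
    have hone_le_exp : 1 ≤ Real.exp (η / 4) := Real.one_le_exp (by linarith)
    have hlin := mul_le_mul_of_nonneg_right hmass (sub_nonneg.2 hone_le_exp)
    have hquad := mul_le_mul_of_nonneg_left hexp
      (mul_nonneg k.cast_nonneg (by linarith) : 0 ≤ (k : ℝ) * (1 - η))
    have hcubic : 0 ≤ (k : ℝ) * η ^ 2 * η := by positivity
    nlinarith [mul_nonneg k.cast_nonneg (sq_nonneg η)]

end Concentration

section Covering

lemma measure_pi_forall_notMem_le {E : Type*} [MeasurableSpace E] (μ : Measure E)
    [IsProbabilityMeasure μ] (n : ℕ) {B : Set E} (hB : MeasurableSet B) {q : ℝ}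
    (hq : q ≤ μ.real B) :
    (Measure.pi fun _ : Fin n => μ) {X | ∀ i, X i ∉ B} ≤ ENNReal.ofReal (Real.exp (-(n * q))) := by
  have hpi : {X : Fin n → E | ∀ i, X i ∉ B} = Set.univ.pi fun _ => Bᶜ := by
    ext; simp
  rw [hpi, Measure.pi_pi, Finset.prod_const, Finset.card_univ, Fintype.card_fin,
    ← ofReal_measureReal (μ := μ), ← ENNReal.ofReal_pow measureReal_nonneg]
  refine ENNReal.ofReal_le_ofReal ?_
  rw [← mul_neg, Real.exp_nat_mul]
  refine pow_le_pow_left₀ measureReal_nonneg ?_ n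
  rw [probReal_compl_eq_one_sub hB]
  linarith [Real.add_one_le_exp (-q)]

variable {E : Type*} [MeasurableSpace E] [PseudoMetricSpace E] [OpensMeasurableSpace E]
  (μ : Measure E) [IsProbabilityMeasure μ]

open scoped NNReal

lemma card_mul_le_one_of_isSeparated {Z : Finset E} {r : ℝ≥0} {q : ℝ}
    (hsep : Metric.IsSeparated (2 * r : ℝ≥0) (Z : Set E))
    (hZ : ∀ z ∈ Z, q ≤ μ.real (Metric.ball z r)) : Z.card * q ≤ 1 := by
  have hdisj : (Z : Set E).PairwiseDisjoint fun z => Metric.ball z (r : ℝ) := by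
    intro x hx y hy hxy
    have hdist : ((2 * r : ℝ≥0) : ℝ≥0∞) < edist x y := hsep hx hy hxy
    rw [edist_nndist, ENNReal.coe_lt_coe, ← NNReal.coe_lt_coe, coe_nndist] at hdist
    push_cast at hdist
    exact Metric.ball_disjoint_ball (by linarith)
  calc Z.card * q = ∑ _z ∈ Z, q := by simp
    _ ≤ ∑ z ∈ Z, μ.real (Metric.ball z r) := Finset.sum_le_sum hZ
    _ = μ.real (⋃ z ∈ Z, Metric.ball z r) :=
        (measureReal_biUnion_finset hdisj fun z _ => Metric.isOpen_ball.measurableSet).symm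
    _ ≤ 1 := measureReal_le_one

lemma packingNumber_two_mul_le_floor {S : Set E} {r : ℝ≥0} {q : ℝ} (hq : 0 < q)
    (hS : ∀ x ∈ S, q ≤ μ.real (Metric.ball x r)) :
    Metric.packingNumber (2 * r) S ≤ ⌊1 / q⌋₊ := by
  refine iSup₂_le fun Z hZS => iSup_le fun hsep => ?_
  by_contra! hlarge
  obtain ⟨Z', hZ', hcard⟩ := Set.exists_subset_encard_eq (Order.add_one_le_of_lt hlarge)
  have hfin : Z'.Finite := Set.finite_of_encard_eq_coe (k := ⌊1 / q⌋₊ + 1) (by simpa using hcard)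
  lift Z' to Finset E using hfin
  rw [Set.encard_coe_eq_coe_finsetCard] at hcard
  have hbound := card_mul_le_one_of_isSeparated μ (hsep.subset hZ')
    fun z hz => hS z (hZS (hZ' hz))
  have hle : Z'.card ≤ ⌊1 / q⌋₊ := Nat.le_floor ((le_div_iff₀ hq).mpr hbound)
  have : Z'.card = ⌊1 / q⌋₊ + 1 := by exact_mod_cast hcard
  omega

lemma exists_finset_isCover {S : Set E} {r : ℝ≥0} {q : ℝ} (hq : 0 < q)
    (hS : ∀ x ∈ S, q ≤ μ.real (Metric.ball x r)) :
    ∃ Z : Finset E, (Z : Set E) ⊆ S ∧ Z.card * q ≤ 1 ∧ Metric.IsCover (2 * r) S Z := by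
  have hfinite : Metric.packingNumber (2 * r) S ≠ ⊤ :=
    ((packingNumber_two_mul_le_floor μ hq hS).trans_lt (ENat.natCast_lt_top _)).ne
  obtain ⟨Z, hZ⟩ : ∃ Z : Finset E, (Z : Set E) = Metric.maximalSeparatedSet (2 * r) S := by
    refine (Set.encard_ne_top_iff.mp ?_).exists_finset_coe
    rwa [Metric.encard_maximalSeparatedSet hfinite]
  have hZS : (Z : Set E) ⊆ S := hZ ▸ Metric.maximalSeparatedSet_subset
  exact ⟨Z, hZS,
    card_mul_le_one_of_isSeparated μ (hZ ▸ Metric.isSeparated_maximalSeparatedSet)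
      fun z hz => hS z (hZS hz), hZ ▸ Metric.isCover_maximalSeparatedSet hfinite⟩

lemma measure_exists_uncovered_le (n : ℕ) (S : Set E) {r q : ℝ} (hr : 0 ≤ r) (hq : 0 < q)
    (hS : ∀ x ∈ S, q ≤ μ.real (Metric.ball x r)) :
    (Measure.pi fun _ : Fin n => μ) {X | ∃ x ∈ S, ∀ i, 4 * r < dist (X i) x} ≤
      ENNReal.ofReal (q⁻¹ * Real.exp (-(n * q))) := by
  lift r to ℝ≥0 using hr
  obtain ⟨Z, hZS, hcard, hcover⟩ := exists_finset_isCover μ hq hS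
  have hsub : {X : Fin n → E | ∃ x ∈ S, ∀ i, 4 * r < dist (X i) x} ⊆
      ⋃ z ∈ Z, {X | ∀ i, X i ∉ Metric.ball z r} := by
    rintro X ⟨x, hx, hX⟩
    obtain ⟨z, hz, hxz⟩ := hcover hx
    have hdist : dist z x ≤ 2 * r := by
      rw [dist_comm]
      exact_mod_cast (edist_le_coe.mp hxz)
    simp only [Set.mem_iUnion]
    refine ⟨z, hz, fun i hi => ?_⟩
    linarith [hX i, dist_triangle (X i) z x, Metric.mem_ball.mp hi, r.coe_nonneg]
  calc _ ≤ ∑ z ∈ Z, (Measure.pi fun _ : Fin n => μ) {X | ∀ i, X i ∉ Metric.ball z r} :=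
        (measure_mono hsub).trans (measure_biUnion_finset_le _ _)
    _ ≤ ∑ _z ∈ Z, ENNReal.ofReal (Real.exp (-(n * q))) := Finset.sum_le_sum fun z hz =>
        measure_pi_forall_notMem_le μ n Metric.isOpen_ball.measurableSet (hS z (hZS hz))
    _ = ENNReal.ofReal (Z.card * Real.exp (-(n * q))) := by
        rw [Finset.sum_const, nsmul_eq_mul, ENNReal.ofReal_mul (by positivity),
          ENNReal.ofReal_natCast]
    _ ≤ ENNReal.ofReal (q⁻¹ * Real.exp (-(n * q))) := by
        gcongr
        rwa [← one_div, le_div_iff₀ hq]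

end Covering

section BallMass

variable {D : ℕ}

lemma unitBallVol_pos (D : ℕ) : 0 < unitBallVol D :=
  ENNReal.toReal_pos (Metric.measure_ball_pos _ _ one_pos).ne' measure_ball_lt_top.ne

lemma volume_ball_eq (x : Euc D) {r : ℝ} (hr : 0 < r) :
    volume (Metric.ball x r) = ENNReal.ofReal (unitBallVol D * r ^ D) := by
  rw [Measure.addHaar_ball_of_pos _ _ hr, finrank_euclideanSpace_fin, mul_comm (unitBallVol D),
    ENNReal.ofReal_mul (by positivity), unitBallVol, ENNReal.ofReal_toReal measure_ball_lt_top.ne]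

lemma volume_closedBall_eq (x : Euc D) {r : ℝ} (hr : 0 < r) :
    volume (Metric.closedBall x r) = ENNReal.ofReal (unitBallVol D * r ^ D) := by
  rw [Measure.addHaar_closedBall _ _ hr.le, finrank_euclideanSpace_fin, mul_comm (unitBallVol D),
    ENNReal.ofReal_mul (by positivity), unitBallVol, ENNReal.ofReal_toReal measure_ball_lt_top.ne]

/-- The distribution with density `f` with respect to Lebesgue measure, so that `sampleLaw f n` is
its `n`-fold product. -/
noncomputable def densityLaw (f : Euc D → ℝ) : Measure (Euc D) :=
  (volume : Measure (Euc D)).withDensity fun x => ENNReal.ofReal (f x)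

variable {t w : ℝ} {f : Euc D → ℝ} {B : Set (Euc D)}

lemma isProbabilityMeasure_densityLaw (hf : ∫⁻ x, ENNReal.ofReal (f x) = 1) :
    IsProbabilityMeasure (densityLaw f) :=
  ⟨by rw [densityLaw, withDensity_apply _ MeasurableSet.univ, setLIntegral_univ, hf]⟩

lemma le_densityLaw_real [IsFiniteMeasure (densityLaw f)] (hB : MeasurableSet B) (ht : 0 ≤ t)
    (hw : volume B = ENNReal.ofReal w) (hf : ∀ x ∈ B, t ≤ f x) :
    t * w ≤ (densityLaw f).real B := by
  rw [measureReal_def, ← ENNReal.ofReal_le_iff_le_toReal (measure_ne_top _ _), densityLaw,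
    withDensity_apply _ hB, ENNReal.ofReal_mul ht, ← hw, ← setLIntegral_const]
  exact setLIntegral_mono' hB fun x hx => ENNReal.ofReal_le_ofReal (hf x hx)

lemma densityLaw_real_le (hB : MeasurableSet B) (ht : 0 ≤ t) (hw0 : 0 ≤ w)
    (hw : volume B = ENNReal.ofReal w) (hf : ∀ x ∈ B, f x ≤ t) :
    (densityLaw f).real B ≤ t * w := by
  rw [measureReal_def]
  refine ENNReal.toReal_le_of_le_ofReal (by positivity) ?_
  rw [densityLaw, withDensity_apply _ hB, ENNReal.ofReal_mul ht, ← hw, ← setLIntegral_const]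
  exact setLIntegral_mono' hB fun x hx => ENNReal.ofReal_le_ofReal (hf x hx)

end BallMass

section GoodSampleProbability

variable {D n k : ℕ} {P : Params} {lam ε η ρ δ₀ : ℝ} {f : Euc D → ℝ}

lemma le_mul_densityLaw_closedBall [IsFiniteMeasure (densityLaw f)] (hlam : 0 ≤ lam)
    (hη : η ≤ 2) (hε : 0 < ε) (hk : n * unitBallVol D * ε ^ D * (lam - lam * η) = k) {x : Euc D}
    (hf : ∀ y, dist y x ≤ ε → lam * (1 - η / 2) ≤ f y) :
    k * (1 + η / 2) ≤ n * (densityLaw f).real (Metric.closedBall x ε) := by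
  have hV : 0 ≤ unitBallVol D * ε ^ D := mul_nonneg (unitBallVol_pos D).le (by positivity)
  have hmass := le_densityLaw_real (t := lam * (1 - η / 2)) Metric.isClosed_closedBall.measurableSet
    (mul_nonneg hlam (by linarith)) (volume_closedBall_eq x hε) (fun y hy => hf y hy)
  calc k * (1 + η / 2) = n * (lam * (1 - η / 2) * (unitBallVol D * ε ^ D)) -
        n * (unitBallVol D * ε ^ D) * lam * (η ^ 2 / 2) := by rw [← hk]; ring
    _ ≤ n * (lam * (1 - η / 2) * (unitBallVol D * ε ^ D)) := sub_le_self _ (by positivity)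
    _ ≤ n * (densityLaw f).real (Metric.closedBall x ε) := by gcongr

lemma mul_densityLaw_closedBall_le (hlam : 0 ≤ lam) (hη : η ≤ 1 / 2) (hε : 0 < ε)
    (hk : n * unitBallVol D * ε ^ D * (lam - lam * η) = k) {x : Euc D}
    (hf : ∀ y, dist y x ≤ ε → f y ≤ lam * (1 - 2 * η)) :
    n * (densityLaw f).real (Metric.closedBall x ε) ≤ k * (1 - η) := by
  have hV : 0 ≤ unitBallVol D * ε ^ D := mul_nonneg (unitBallVol_pos D).le (by positivity)
  have hmass := densityLaw_real_le (t := lam * (1 - 2 * η)) Metric.isClosed_closedBall.measurableSet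
    (mul_nonneg hlam (by linarith)) hV (volume_closedBall_eq x hε) (fun y hy => hf y hy)
  calc n * (densityLaw f).real (Metric.closedBall x ε)
      ≤ n * (lam * (1 - 2 * η) * (unitBallVol D * ε ^ D)) := by gcongr
    _ ≤ n * (lam * (1 - 2 * η) * (unitBallVol D * ε ^ D)) +
        n * (unitBallVol D * ε ^ D) * lam * η ^ 2 := le_add_of_nonneg_right (by positivity)
    _ = k * (1 - η) := by rw [← hk]; ring

lemma goodSample_of_counts [IsFiniteMeasure (densityLaw f)] (hlam : 0 ≤ lam) (hη : η ≤ 1 / 2)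
    (hε : 0 < ε) (hk : n * unitBallVol D * ε ^ D * (lam - lam * η) = k) {X : Fin n → Euc D}
    (hfew : ¬ ∃ i, k * (1 + η / 2) ≤ n * (densityLaw f).real (Metric.closedBall (X i) ε) ∧
      ({j | dist (X j) (X i) ≤ ε}.ncard : ℝ) ≤ k)
    (hmany : ¬ ∃ i, n * (densityLaw f).real (Metric.closedBall (X i) ε) ≤ k * (1 - η) ∧
      (k : ℝ) ≤ ({j | dist (X j) (X i) ≤ ε}.ncard : ℝ))
    (hcover : ¬ ∃ x ∈ Metric.cthickening ρ (levelSet f lam), ∀ i, 4 * (ε / 12) < dist (X i) x) :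
    GoodSample f lam X k ε η ρ where
  mem_corePoints i hi := by
    refine ⟨⟨i, rfl⟩, le_of_not_ge fun hle => hfew ⟨i, ?_, by exact_mod_cast hle⟩⟩
    exact le_mul_densityLaw_closedBall hlam (by linarith) hε hk hi
  exists_le := by
    rintro _ ⟨⟨i, rfl⟩, hi⟩
    by_contra! hlow
    exact hmany ⟨i, mul_densityLaw_closedBall_le hlam hη hε hk fun y hy => (hlow y hy).le,
      by exact_mod_cast hi⟩
  cover x hx := by
    by_contra! hfar
    exact hcover ⟨x, hx, fun i => by linarith [hfar i]⟩

lemma exists_component_mem_cthickening (hf : Continuous f) (hρ : 0 ≤ ρ) {x : Euc D}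
    (hx : x ∈ Metric.cthickening ρ (levelSet f lam)) :
    ∃ C ∈ levelComponents f lam, x ∈ Metric.cthickening ρ C := by
  rw [(isClosed_levelSet hf lam).cthickening_eq_biUnion_closedBall hρ] at hx
  obtain ⟨c, hc, hxc⟩ := Set.mem_iUnion₂.mp hx
  obtain ⟨C, hC, hcC⟩ := exists_mem_levelComponents hc
  exact ⟨C, hC, Metric.mem_cthickening_of_dist_le x c ρ C hcC hxc⟩

lemma LevelRegular.le_densityLaw_ball (h : LevelRegular P lam f)
    (S : lam ≤ P.fmax → FineScale P lam ε η ρ) (hη : η ≤ 1) (hε : 0 < ε) (hρ : 0 ≤ ρ) {x : Euc D}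
    (hx : x ∈ Metric.cthickening ρ (levelSet f lam)) :
    lam / 2 * (unitBallVol D * (ε / 12) ^ D) ≤
      (densityLaw f).real (Metric.ball x (ε / 12)) := by
  have := isProbabilityMeasure_densityLaw h.lintegral_eq_one
  have hlam := h.lam_pos
  obtain ⟨C, hC, hxC⟩ := exists_component_mem_cthickening h.continuous hρ hx
  have hS := S (h.lam_le_fmax hC)
  refine le_densityLaw_real Metric.isOpen_ball.measurableSet (by positivity)
    (volume_ball_eq x (by positivity)) fun y hy => ?_
  have hyC : y ∈ Metric.cthickening (ρ + ε / 12) C :=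
    mem_cthickening_add_of_dist_le hρ hxC (Metric.mem_ball.mp hy).le
  have hfy := h.sub_le_of_mem_cthickening hC (by positivity) hS.collar_le
    (Metric.cthickening_mono (by linarith) C hyC)
  nlinarith [hS.height]

lemma LevelRegular.measure_exists_uncovered_le (h : LevelRegular P lam f)
    (S : lam ≤ P.fmax → FineScale P lam ε η ρ) (hη : 0 ≤ η) (hη1 : η ≤ 1) (hε : 0 < ε)
    (hρ : 0 ≤ ρ) (hk : n * unitBallVol D * ε ^ D * (lam - lam * η) = k)
    (hkD : 2 * 12 ^ D ≤ (k : ℝ)) :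
    sampleLaw f n
      {X | ∃ x ∈ Metric.cthickening ρ (levelSet f lam), ∀ i, 4 * (ε / 12) < dist (X i) x} ≤
      ENNReal.ofReal (n * Real.exp (-(k / (2 * 12 ^ D)))) := by
  have := isProbabilityMeasure_densityLaw h.lintegral_eq_one
  have hlam := h.lam_pos
  have hv := unitBallVol_pos D
  set q := lam / 2 * (unitBallVol D * (ε / 12) ^ D) with hq
  have hq0 : 0 < q := by positivity
  have hnq : k / (2 * 12 ^ D) ≤ n * q := by
    rw [div_le_iff₀ (by positivity)]
    calc (k : ℝ) = n * unitBallVol D * ε ^ D * lam * (1 - η) := by rw [← hk]; ring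
      _ ≤ n * unitBallVol D * ε ^ D * lam * 1 := by gcongr; linarith
      _ = n * q * (2 * 12 ^ D) := by rw [hq, div_pow]; field_simp
  have hqinv : q⁻¹ ≤ n := by
    rw [inv_le_iff_one_le_mul₀ hq0]
    refine le_trans ?_ hnq
    rwa [le_div_iff₀ (by positivity), one_mul]
  refine (LevelSetDBSCAN.measure_exists_uncovered_le (densityLaw f) n _ (by positivity) hq0
    fun x hx => h.le_densityLaw_ball S hη1 hε hρ hx).trans ?_
  gcongr

theorem LevelRegular.measure_not_goodSample_le (h : LevelRegular P lam f)
    (S : lam ≤ P.fmax → FineScale P lam ε η ρ) (hη : 0 ≤ η) (hη4 : η ≤ 1 / 4) (hε : 0 < ε)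
    (hρ : 0 ≤ ρ) (hk : n * unitBallVol D * ε ^ D * (lam - lam * η) = k)
    (hkD : 2 * 12 ^ D ≤ (k : ℝ)) (hconc : n * Real.exp (1 - k * η ^ 2 / 32) ≤ δ₀)
    (hcov : n * Real.exp (-(k / (2 * 12 ^ D))) ≤ δ₀) :
    sampleLaw f n {X | ¬ GoodSample f lam X k ε η ρ} ≤ ENNReal.ofReal (3 * δ₀) := by
  have := isProbabilityMeasure_densityLaw h.lintegral_eq_one
  have hδ₀ : 0 ≤ δ₀ := le_trans (by positivity) hcov
  have hfew := (measure_few_neighbours_le (densityLaw f) (n := n) hε.le k hη hη4).trans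
    (ENNReal.ofReal_le_ofReal hconc)
  have hmany := (measure_many_neighbours_le (densityLaw f) (n := n) hε.le k hη hη4).trans
    (ENNReal.ofReal_le_ofReal hconc)
  have hcover := (h.measure_exists_uncovered_le S hη (by linarith) hε hρ hk hkD).trans
    (ENNReal.ofReal_le_ofReal hcov)
  rw [show 3 * δ₀ = δ₀ + δ₀ + δ₀ by ring, ENNReal.ofReal_add (by positivity) hδ₀,
    ENNReal.ofReal_add hδ₀ hδ₀]
  refine le_trans (measure_mono fun X hX => ?_) ((measure_union_le _ _).trans
    (add_le_add ((measure_union_le _ _).trans (add_le_add hfew hmany)) hcover))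
  by_contra hcon
  simp only [Set.mem_union, not_or] at hcon
  exact hX (goodSample_of_counts h.lam_pos.le (by linarith) hε hk hcon.1.1 hcon.1.2 hcon.2)

end GoodSampleProbability

section Radius

/-- The radius `(k / (n v_D (lam - lam η)))^(1/D)` of DBSCAN for a relative slack `η` in the level:
a ball of this radius on which a density equals `lam (1 - η)` has mass `k / n`. -/
noncomputable def radius (lam : ℝ) (D n k : ℕ) (η : ℝ) : ℝ :=
  ((k : ℝ) / (n * unitBallVol D * (lam - lam * η))) ^ (1 / (D : ℝ))

variable {D n k : ℕ} {lam lam0 η η' β Ku : ℝ}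

lemma mul_unitBallVol_mul_sub_pos (hlam : 0 < lam) (hη : η ≤ 1 / 2) (hn : 0 < n) :
    0 < n * unitBallVol D * (lam - lam * η) := by
  have hv := unitBallVol_pos D
  have hsub : 0 < lam - lam * η := by nlinarith
  positivity

lemma radius_pos (hlam : 0 < lam) (hη : η ≤ 1 / 2) (hn : 0 < n) (hk : 0 < k) :
    0 < radius lam D n k η :=
  Real.rpow_pos_of_pos (div_pos (by positivity) (mul_unitBallVol_mul_sub_pos hlam hη hn)) _

lemma mul_radius_pow (hD : D ≠ 0) (hlam : 0 < lam) (hη : η ≤ 1 / 2) (hn : 0 < n) :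
    n * unitBallVol D * radius lam D n k η ^ D * (lam - lam * η) = k := by
  have hden := mul_unitBallVol_mul_sub_pos (D := D) hlam hη hn
  rw [radius, one_div, Real.rpow_inv_natCast_pow (by positivity) hD, mul_right_comm,
    mul_div_cancel₀ _ hden.ne']

lemma radius_mono (hlam : 0 < lam) (hη : η ≤ η') (hη' : η' ≤ 1 / 2) (hn : 0 < n) :
    radius lam D n k η ≤ radius lam D n k η' := by
  have hden' := mul_unitBallVol_mul_sub_pos (D := D) hlam hη' hn
  have hden := mul_unitBallVol_mul_sub_pos (D := D) hlam (hη.trans hη') hn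
  have hv := unitBallVol_pos D
  unfold radius
  gcongr

lemma radius_rpow_le (hβ : 0 ≤ β) (hlam0 : 0 < lam0) (hlam : lam0 ≤ lam) (hη : η ≤ 1 / 2)
    (hn : 0 < n) :
    radius lam D n k η ^ β ≤ (2 / (unitBallVol D * lam0) * (k / n)) ^ (β / D) := by
  have hden := mul_unitBallVol_mul_sub_pos (D := D) (hlam0.trans_le hlam) hη hn
  have hv := unitBallVol_pos D
  have hsub : lam0 / 2 ≤ lam - lam * η := by nlinarith
  rw [radius, ← Real.rpow_mul (by positivity), one_div_mul_eq_div]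
  refine Real.rpow_le_rpow (by positivity) ?_ (by positivity)
  calc (k : ℝ) / (n * unitBallVol D * (lam - lam * η))
      ≤ k / (n * unitBallVol D * (lam0 / 2)) := by gcongr
    _ = 2 / (unitBallVol D * lam0) * (k / n) := by field_simp

lemma rpow_mul_sqrt_le (hD : 0 < D) (hβ : 0 < β) (hKu : 0 ≤ Ku)
    (hk : (k : ℝ) ≤ Ku * Real.log n ^ (2 * D / (2 * β + D)) * (n : ℝ) ^ (2 * β / (2 * β + D))) :
    (k : ℝ) ^ (β / D) * Real.sqrt k ≤
      Ku ^ ((2 * β + D) / (2 * D)) * Real.log n * (n : ℝ) ^ (β / D) := by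
  have hl := Real.log_natCast_nonneg n
  rw [Real.sqrt_eq_rpow, ← Real.rpow_add_of_nonneg (by positivity) (by positivity) (by norm_num),
    show β / D + 1 / 2 = (2 * β + D) / (2 * D) by field_simp]
  refine (Real.rpow_le_rpow (by positivity) hk (by positivity)).trans_eq ?_
  rw [Real.mul_rpow (by positivity) (by positivity), Real.mul_rpow hKu (by positivity),
    ← Real.rpow_mul hl, ← Real.rpow_mul (by positivity)]
  have hexp_log : 2 * D / (2 * β + D) * ((2 * β + D) / (2 * D)) = 1 := by field_simp
  have hexp_n : 2 * β / (2 * β + D) * ((2 * β + D) / (2 * D)) = β / D := by field_simp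
  rw [hexp_log, hexp_n, Real.rpow_one]

lemma exists_radius_rpow_le (hD : 0 < D) {m : ℝ} (hβ : 0 < β) (hlam0 : 0 < lam0) (hm : 0 < m) :
    ∃ Ku : ℝ, 0 < Ku ∧ ∀ (lam η : ℝ) (n k : ℕ), lam0 ≤ lam → η ≤ 1 / 2 → 0 < n → 0 < k →
      (k : ℝ) ≤ Ku * Real.log n ^ (2 * D / (2 * β + D)) * (n : ℝ) ^ (2 * β / (2 * β + D)) →
      radius lam D n k η ^ β ≤ m * (Real.log n / Real.sqrt k) := by
  have hv := unitBallVol_pos D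
  set B := 2 / (unitBallVol D * lam0)
  have hB0 : 0 < B := by positivity
  set p := (2 * β + D) / (2 * D)
  have hp0 : p ≠ 0 := by positivity
  refine ⟨(m / B ^ (β / D)) ^ p⁻¹, by positivity, fun lam η n k hlam hη hn hk hku => ?_⟩
  have hpow := rpow_mul_sqrt_le hD hβ (by positivity) hku
  rw [Real.rpow_inv_rpow (by positivity) hp0] at hpow
  have hs : 0 < Real.sqrt k := Real.sqrt_pos.mpr (by positivity)
  refine (radius_rpow_le hβ.le hlam0 hlam hη hn).trans ?_
  rw [← mul_div_assoc m, le_div_iff₀ hs, Real.mul_rpow hB0.le (by positivity),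
    Real.div_rpow (Nat.cast_nonneg k) (Nat.cast_nonneg n)]
  calc B ^ (β / D) * ((k : ℝ) ^ (β / D) / (n : ℝ) ^ (β / D)) * Real.sqrt k
      = B ^ (β / D) * ((k : ℝ) ^ (β / D) * Real.sqrt k) / (n : ℝ) ^ (β / D) := by ring
    _ ≤ B ^ (β / D) * (m / B ^ (β / D) * Real.log n * (n : ℝ) ^ (β / D)) / (n : ℝ) ^ (β / D) := by
        gcongr
    _ = m * Real.log n := by field_simp

end Radius

section Confidence

/-- The relative slack `C_{δ,n}² / √k` in the density level, for `C₀ = 10`. -/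
noncomputable def slack (δ : ℝ) (D n k : ℕ) : ℝ := confConst 10 δ D n ^ 2 / Real.sqrt k

/-- The relative slack `C_{δ,n}² / k^{1/3}` of the pruning step, for `C₀ = 10`. -/
noncomputable def slackPruned (δ : ℝ) (D n k : ℕ) : ℝ :=
  confConst 10 δ D n ^ 2 / (k : ℝ) ^ (1 / 3 : ℝ)

variable {δ lam : ℝ} {D n k : ℕ}

lemma confConst_sq (C₀ δ : ℝ) (D n : ℕ) :
    confConst C₀ δ D n ^ 2 = C₀ ^ 2 * Real.log (2 / δ) ^ 2 * D * Real.log n := by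
  have : 0 ≤ Real.log n := Real.log_natCast_nonneg n
  rw [confConst, mul_pow, mul_pow, Real.sq_sqrt (by positivity)]
  ring

lemma half_le_log_of_two_le {x : ℝ} (hx : 2 ≤ x) : 1 / 2 ≤ Real.log x := by
  linarith [Real.log_two_gt_d9, Real.log_le_log two_pos hx]

lemma half_le_log_natCast (hn : 2 ≤ n) : 1 / 2 ≤ Real.log n :=
  half_le_log_of_two_le (by exact_mod_cast hn)

lemma half_le_log_two_div (hδ : 0 < δ) (hδ1 : δ < 1) : 1 / 2 ≤ Real.log (2 / δ) :=
  half_le_log_of_two_le (by rw [le_div_iff₀ hδ]; linarith)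

lemma confConst_nonneg {C₀ : ℝ} (hC₀ : 0 ≤ C₀) (hδ : 0 < δ) (hδ1 : δ < 1) (D n : ℕ) :
    0 ≤ confConst C₀ δ D n := by
  have hL := half_le_log_two_div hδ hδ1
  unfold confConst
  positivity

lemma slack_nonneg (δ : ℝ) (D n k : ℕ) : 0 ≤ slack δ D n k := by unfold slack; positivity

lemma slackPruned_nonneg (δ : ℝ) (D n k : ℕ) : 0 ≤ slackPruned δ D n k := by
  unfold slackPruned; positivity

lemma mul_slack_sq (δ : ℝ) (D n : ℕ) (hk : 0 < k) :
    k * slack δ D n k ^ 2 = (confConst 10 δ D n ^ 2) ^ 2 := by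
  rw [slack, div_pow, Real.sq_sqrt (by positivity)]
  field_simp

lemma estClusters_eq (δ lam : ℝ) (k : ℕ) (X : Fin n → Euc D) :
    estClusters 10 δ lam k X = dbscan X k (radius lam D n k (slack δ D n k)) := by
  rw [estClusters, eps, radius, slack, mul_div_assoc]

lemma prunedClusters_eq (δ lam : ℝ) (k : ℕ) (X : Fin n → Euc D) :
    prunedClusters 10 δ lam k X = mergeClusters (dbscan X k (radius lam D n k (slack δ D n k)))
      (dbscan X k (radius lam D n k (slackPruned δ D n k))) := by
  rw [prunedClusters, eps, epsTilde, radius, radius, slack, slackPruned, mul_div_assoc,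
    mul_div_assoc]

lemma errBound_eq (hδ : 0 < δ) (hδ1 : δ < 1) (hlam : 0 < lam) (P : Params) (D n k : ℕ) :
    errBound 10 δ lam P D n k = 2 * P.falloffRadius lam (2 * slack δ D n k) := by
  have hconf := confConst_nonneg (by norm_num : (0 : ℝ) ≤ 10) hδ hδ1 D n
  have hc := P.cLow_pos
  have hconf_rpow :
      confConst 10 δ D n ^ (2 / P.beta) = (confConst 10 δ D n ^ 2) ^ (1 / P.beta) := by
    rw [← Real.rpow_natCast, ← Real.rpow_mul hconf, Nat.cast_two, mul_one_div]
  have hk_rpow : (k : ℝ) ^ (-(1 / (2 * P.beta))) = (Real.sqrt k)⁻¹ ^ (1 / P.beta) := by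
    rw [Real.inv_rpow (Real.sqrt_nonneg _), Real.sqrt_eq_rpow, ← Real.rpow_mul (Nat.cast_nonneg k),
      ← Real.rpow_neg (Nat.cast_nonneg k), one_div_mul_one_div]
  rw [errBound, hconf_rpow, hk_rpow, mul_assoc, mul_assoc,
    ← Real.mul_rpow (by positivity) (by positivity),
    ← Real.mul_rpow (by positivity) (by positivity), Params.falloffRadius, slack]
  congr 2
  ring

lemma mul_exp_neg_le (hδ : 0 < δ) (hn : 0 < n) {Q : ℝ}
    (hQ : Real.log n + Real.log (2 / δ) + 2 ≤ Q) : n * Real.exp (-Q) ≤ δ / 6 := by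
  have hexp2 : Real.exp (-2) ≤ 1 / 3 := by
    rw [Real.exp_neg, inv_le_comm₀ (Real.exp_pos _) (by norm_num)]
    linarith [Real.add_one_le_exp (2 : ℝ)]
  calc n * Real.exp (-Q) ≤ n * Real.exp (-(Real.log n + Real.log (2 / δ) + 2)) := by gcongr
    _ = δ / 2 * Real.exp (-2) := by
        rw [neg_add, neg_add, Real.exp_add, Real.exp_add, Real.exp_neg,
          Real.exp_neg (Real.log (2 / δ)), Real.exp_log (by positivity),
          Real.exp_log (by positivity), inv_div]
        field_simp
    _ ≤ δ / 2 * (1 / 3) := by gcongr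
    _ = δ / 6 := by ring

/-- The value `C₀ = 10` enters only here: it makes the deviation probabilities small enough for a
union bound over the sample points. -/
lemma mul_exp_one_sub_le (hδ : 0 < δ) (hδ1 : δ < 1) (hD : 1 ≤ D) (hn : 2 ≤ n) {Q : ℝ}
    (hQ : (confConst 10 δ D n ^ 2) ^ 2 ≤ Q) : n * Real.exp (1 - Q / 32) ≤ δ / 6 := by
  rw [show 1 - Q / 32 = -(Q / 32 - 1) by ring]
  refine mul_exp_neg_le hδ (by omega) ?_
  rw [confConst_sq] at hQ
  have hl := half_le_log_natCast hn
  have hL := half_le_log_two_div hδ hδ1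
  set l := Real.log n
  set L := Real.log (2 / δ)
  have hD1 : (1 : ℝ) ≤ D := by exact_mod_cast hD
  have hL4 : 1 / 8 * L ≤ L ^ 4 := by
    have hcube : (1 / 2 : ℝ) ^ 3 ≤ L ^ 3 := pow_le_pow_left₀ (by norm_num) hL 3
    nlinarith
  have hl2 : 1 / 2 * l ≤ l ^ 2 := by nlinarith
  have hprod : 625 * (L * l) ≤ Q := by
    calc 625 * (L * l) = 10000 * ((1 / 8 * L) * (1 / 2 * l)) := by ring
      _ ≤ 10000 * (L ^ 4 * l ^ 2) := by gcongr
      _ = (10 ^ 2 * L ^ 2 * 1 * l) ^ 2 := by ring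
      _ ≤ (10 ^ 2 * L ^ 2 * D * l) ^ 2 := by gcongr
      _ ≤ Q := hQ
  have hLl : 1 / 2 * L ≤ L * l := by nlinarith
  have hlL : 1 / 2 * l ≤ L * l := by nlinarith
  linarith

lemma exists_slack_le (hD : 1 ≤ D) (hδ : 0 < δ) (hδ1 : δ < 1) {η₀ : ℝ} (hη₀ : 0 < η₀) :
    ∃ Kl : ℝ, 0 < Kl ∧ ∀ n k : ℕ, 2 ≤ n → Kl * Real.log n ^ 2 ≤ k →
      slack δ D n k ≤ η₀ ∧ 2 * 12 ^ D * (Real.log n + Real.log (2 / δ) + 2) ≤ (k : ℝ) := by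
  have hL := half_le_log_two_div hδ hδ1
  set A : ℝ := 10 ^ 2 * Real.log (2 / δ) ^ 2 * D with hA
  set M : ℝ := 2 * 12 ^ D * (10 + 4 * Real.log (2 / δ)) with hM
  refine ⟨(A / η₀) ^ 2 + M, by positivity, fun n k hn hk => ?_⟩
  have hl := half_le_log_natCast hn
  have hM0 : 0 ≤ M * Real.log n ^ 2 := by positivity
  have hA0 : 0 ≤ (A / η₀) ^ 2 * Real.log n ^ 2 := by positivity
  constructor
  · have hsqrt : A / η₀ * Real.log n ≤ Real.sqrt k := by
      refine Real.le_sqrt_of_sq_le ?_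
      rw [mul_pow]
      linarith
    have hsqrt0 : 0 ≤ Real.sqrt k := Real.sqrt_nonneg k
    rw [slack, confConst_sq, ← hA]
    refine div_le_of_le_mul₀ hsqrt0 hη₀.le ?_
    calc A * Real.log n = η₀ * (A / η₀ * Real.log n) := by field_simp
      _ ≤ η₀ * Real.sqrt k := by gcongr
  · have hquad : Real.log n + Real.log (2 / δ) + 2 ≤
        (10 + 4 * Real.log (2 / δ)) * Real.log n ^ 2 := by
      have hsq : 1 / 4 ≤ Real.log n ^ 2 := by nlinarith
      nlinarith
    calc 2 * 12 ^ D * (Real.log n + Real.log (2 / δ) + 2)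
        ≤ 2 * 12 ^ D * ((10 + 4 * Real.log (2 / δ)) * Real.log n ^ 2) := by gcongr
      _ = M * Real.log n ^ 2 := by rw [hM]; ring
      _ ≤ k := by linarith

lemma div_sqrt_le_of_le_rpow {a η₀ : ℝ} (ha : 0 ≤ a) (hη₀ : 0 < η₀) (hk : 0 < k)
    (h : η₀⁻¹ ^ 6 ≤ k) : a / Real.sqrt k ≤ η₀ * (a / (k : ℝ) ^ (1 / 3 : ℝ)) := by
  have hroot : η₀⁻¹ ≤ (k : ℝ) ^ (1 / 6 : ℝ) := by
    rw [one_div, Real.le_rpow_inv_iff_of_pos (by positivity) (by positivity) (by norm_num)]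
    exact_mod_cast h
  have hone : 1 ≤ η₀ * (k : ℝ) ^ (1 / 6 : ℝ) := by
    rwa [inv_le_iff_one_le_mul₀' hη₀] at hroot
  have hsqrt : Real.sqrt k = (k : ℝ) ^ (1 / 3 : ℝ) * (k : ℝ) ^ (1 / 6 : ℝ) := by
    rw [Real.sqrt_eq_rpow, ← Real.rpow_add (by positivity)]; norm_num
  rw [hsqrt, ← div_div, div_le_iff₀ (by positivity)]
  calc a / (k : ℝ) ^ (1 / 3 : ℝ)
      ≤ a / (k : ℝ) ^ (1 / 3 : ℝ) * (η₀ * (k : ℝ) ^ (1 / 6 : ℝ)) :=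
        le_mul_of_one_le_right (by positivity) hone
    _ = _ := by ring

lemma exists_slackPruned_le (hδ : 0 < δ) (hδ1 : δ < 1) {η₀ : ℝ} (hη₀ : 0 < η₀) (D : ℕ) :
    ∃ Kl : ℝ, 0 < Kl ∧ ∀ n k : ℕ, 2 ≤ n → Kl * Real.log n ^ 3 ≤ k →
      slackPruned δ D n k ≤ η₀ ∧ slack δ D n k ≤ η₀ * slackPruned δ D n k := by
  have hL := half_le_log_two_div hδ hδ1
  set A : ℝ := 10 ^ 2 * Real.log (2 / δ) ^ 2 * D with hA
  refine ⟨(A / η₀) ^ 3 + 8 * η₀⁻¹ ^ 6, by positivity, fun n k hn hk => ?_⟩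
  have hl := half_le_log_natCast hn
  have hl3 : (1 / 2) ^ 3 ≤ Real.log n ^ 3 := pow_le_pow_left₀ (by norm_num) hl 3
  have hA0 : 0 ≤ (A / η₀) ^ 3 * Real.log n ^ 3 := by positivity
  have hη₀6 : η₀⁻¹ ^ 6 ≤ 8 * η₀⁻¹ ^ 6 * Real.log n ^ 3 := by
    calc η₀⁻¹ ^ 6 = 8 * η₀⁻¹ ^ 6 * (1 / 2) ^ 3 := by ring
      _ ≤ _ := by gcongr
  have hk6 : η₀⁻¹ ^ 6 ≤ k := by linarith
  have hk3 : (A / η₀ * Real.log n) ^ 3 ≤ k := by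
    rw [mul_pow]
    linarith [show 0 ≤ η₀⁻¹ ^ 6 by positivity]
  have hk0 : 0 < k := by
    have : (0 : ℝ) < k := lt_of_lt_of_le (by positivity) hk6
    exact_mod_cast this
  refine ⟨?_, div_sqrt_le_of_le_rpow (by positivity) hη₀ hk0 hk6⟩
  have hroot : A / η₀ * Real.log n ≤ (k : ℝ) ^ (1 / 3 : ℝ) := by
    rw [one_div, Real.le_rpow_inv_iff_of_pos (by positivity) (by positivity) (by norm_num)]
    exact_mod_cast hk3
  rw [slackPruned, confConst_sq, ← hA, div_le_iff₀ (by positivity)]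
  calc A * Real.log n = η₀ * (A / η₀ * Real.log n) := by field_simp
    _ ≤ _ := by gcongr

end Confidence

section Scales

namespace Params

variable {P : Params} {lam η η' r ε : ℝ}

lemma falloffRadius_rpow (hlam : 0 ≤ lam) (hη : 0 ≤ η) :
    P.falloffRadius lam η ^ P.beta = 2 * lam * η / P.cLow := by
  have hc := P.cLow_pos
  rw [falloffRadius, one_div, Real.rpow_inv_rpow (by positivity) P.beta_pos.ne']

lemma le_falloffRadius_iff (hlam : 0 ≤ lam) (hη : 0 ≤ η) (hr : 0 ≤ r) :
    r ≤ P.falloffRadius lam η ↔ r ^ P.beta ≤ 2 * lam * η / P.cLow := by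
  have hc := P.cLow_pos
  rw [falloffRadius, one_div, Real.le_rpow_inv_iff_of_pos hr (by positivity) P.beta_pos]

lemma falloffRadius_le_iff (hlam : 0 ≤ lam) (hη : 0 ≤ η) (hr : 0 ≤ r) :
    P.falloffRadius lam η ≤ r ↔ 2 * lam * η / P.cLow ≤ r ^ P.beta := by
  have hc := P.cLow_pos
  rw [falloffRadius, one_div, Real.rpow_inv_le_iff_of_pos (by positivity) hr P.beta_pos]

lemma falloffRadius_mono (hlam : 0 ≤ lam) (hη : 0 ≤ η) (h : η ≤ η') :
    P.falloffRadius lam η ≤ P.falloffRadius lam η' := by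
  have hc := P.cLow_pos
  have hβ := P.beta_pos
  unfold falloffRadius
  gcongr

/-- If `ε^β ≤ ratioBound P * η` then `2ε` is at most the fall-off radius of `η`, and `f` drops by at
most `lam η / 2` within distance `3ε` of a component. -/
noncomputable def ratioBound (P : Params) : ℝ :=
  min (2 * P.lam0 / (P.cLow * 2 ^ P.beta)) (P.lam0 / (2 * 3 ^ P.beta * P.cUp))

lemma ratioBound_pos (P : Params) : 0 < P.ratioBound := by
  have hlam0 := P.lam0_pos
  have hcLow := P.cLow_pos
  have hcUp := P.cUp_pos
  exact lt_min (by positivity) (by positivity)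

lemma two_mul_le_falloffRadius (hlam : P.lam0 ≤ lam) (hη : 0 ≤ η) (hε : 0 ≤ ε)
    (h : ε ^ P.beta ≤ P.ratioBound * η) : 2 * ε ≤ P.falloffRadius lam η := by
  have hc := P.cLow_pos
  rw [le_falloffRadius_iff (P.lam0_pos.le.trans hlam) hη (by positivity),
    Real.mul_rpow zero_le_two hε]
  calc (2 : ℝ) ^ P.beta * ε ^ P.beta
      ≤ 2 ^ P.beta * (2 * P.lam0 / (P.cLow * 2 ^ P.beta) * η) := by
        gcongr
        exact h.trans (mul_le_mul_of_nonneg_right (min_le_left _ _) hη)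
    _ = 2 * P.lam0 * η / P.cLow := by field_simp
    _ ≤ _ := by gcongr

lemma cUp_mul_three_mul_rpow_le (hlam : P.lam0 ≤ lam) (hη : 0 ≤ η) (hε : 0 ≤ ε)
    (h : ε ^ P.beta ≤ P.ratioBound * η) : P.cUp * (3 * ε) ^ P.beta ≤ lam * η / 2 := by
  have hc := P.cUp_pos
  rw [Real.mul_rpow zero_le_three hε]
  calc P.cUp * ((3 : ℝ) ^ P.beta * ε ^ P.beta)
      ≤ P.cUp * (3 ^ P.beta * (P.lam0 / (2 * 3 ^ P.beta * P.cUp) * η)) := by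
        gcongr
        exact h.trans (mul_le_mul_of_nonneg_right (min_le_right _ _) hη)
    _ = P.lam0 * η / 2 := by field_simp
    _ ≤ _ := by gcongr

/-- A bound on the slack under which the fall-off radius is at most `rc / 10`. -/
noncomputable def slackBound (P : Params) : ℝ :=
  P.cLow * (P.rc / 10) ^ P.beta / (2 * P.fmax)

lemma slackBound_pos (P : Params) : 0 < P.slackBound := by
  have hc := P.cLow_pos
  have hrc := P.rc_pos
  have hF := P.fmax_pos
  unfold slackBound
  positivity

lemma falloffRadius_le_rc_div_ten (hlam : 0 ≤ lam) (hF : lam ≤ P.fmax) (hη : 0 ≤ η)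
    (h : η ≤ P.slackBound) : P.falloffRadius lam η ≤ P.rc / 10 := by
  have hF0 := P.fmax_pos
  have hrc := P.rc_pos
  rw [falloffRadius_le_iff hlam hη (by positivity), div_le_iff₀' P.cLow_pos]
  rw [slackBound, le_div_iff₀ (by positivity)] at h
  nlinarith

end Params

variable {P : Params} {lam η η' ε ε' : ℝ}

lemma FineScale.of_rpow_le (hlam : P.lam0 ≤ lam) (hF : lam ≤ P.fmax) (hη : 0 ≤ η)
    (hηP : η ≤ P.slackBound) (hε : 0 < ε) (h : ε ^ P.beta ≤ P.ratioBound * η) :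
    FineScale P lam ε η ε := by
  have hfall := Params.falloffRadius_le_rc_div_ten (P.lam0_pos.le.trans hlam) hF hη hηP
  have h2ε := Params.two_mul_le_falloffRadius hlam hη hε.le h
  refine ⟨hε, hη, hε.le, ?_, by linarith, by linarith⟩
  rw [show ε + 2 * ε = 3 * ε by ring]
  exact Params.cUp_mul_three_mul_rpow_le hlam hη hε.le h

/-- A slack `η'` much larger than `η` leaves room for a collar as wide as the error at slack `η`. -/
lemma FineScale.of_le_mul (hlam : 0 < lam) (hF : lam ≤ P.fmax) (hη : 0 ≤ η)
    (hη' : 0 ≤ η') (hηP : η ≤ P.slackBound) (hηP' : η' ≤ P.slackBound)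
    (hηη' : η ≤ P.cLow / (4 * 3 ^ P.beta * P.cUp) * η') (hε : 0 ≤ ε) (hε' : 0 < ε')
    (h2ε : 2 * ε ≤ P.falloffRadius lam η) (h2ε' : 2 * ε' ≤ P.falloffRadius lam η) :
    FineScale P lam ε' η' (P.falloffRadius lam η + 2 * ε) := by
  have hcLow := P.cLow_pos
  have hcUp := P.cUp_pos
  have hβ := P.beta_pos
  have hfall := Params.falloffRadius_le_rc_div_ten hlam.le hF hη hηP
  have hfall' := Params.falloffRadius_le_rc_div_ten hlam.le hF hη' hηP'
  refine ⟨hε', hη', by linarith, ?_, by linarith, by linarith⟩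
  calc P.cUp * (P.falloffRadius lam η + 2 * ε + 2 * ε') ^ P.beta
      ≤ P.cUp * (3 * P.falloffRadius lam η) ^ P.beta := by gcongr <;> linarith
    _ = P.cUp * (3 ^ P.beta * (2 * lam * η / P.cLow)) := by
        rw [Real.mul_rpow zero_le_three (P.falloffRadius_nonneg hlam.le hη),
          Params.falloffRadius_rpow hlam.le hη]
    _ ≤ P.cUp * (3 ^ P.beta *
          (2 * lam * (P.cLow / (4 * 3 ^ P.beta * P.cUp) * η') / P.cLow)) := by gcongr
    _ = lam * η' / 2 := by field_simp; ring

end Scales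

section UpperBounds

variable {D n k : ℕ} {δ lam η ρ γ : ℝ} {P : Params} {f : Euc D → ℝ}

lemma LevelRegular.measure_not_goodSample_radius_le (h : LevelRegular P lam f) (hD : 1 ≤ D)
    (hδ : 0 < δ) (hδ1 : δ < 1) (hn : 2 ≤ n) (hk : 0 < k) (hη : slack δ D n k ≤ η) (hη4 : η ≤ 1 / 4)
    (hρ : 0 ≤ ρ) (S : lam ≤ P.fmax → FineScale P lam (radius lam D n k η) η ρ)
    (hkD : 2 * 12 ^ D * (Real.log n + Real.log (2 / δ) + 2) ≤ (k : ℝ)) :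
    sampleLaw f n {X | ¬ GoodSample f lam X k (radius lam D n k η) η ρ} ≤
      ENNReal.ofReal (δ / 2) := by
  have hη0 := slack_nonneg δ D n k
  have hl := half_le_log_natCast hn
  have hL := half_le_log_two_div hδ hδ1
  have hconc : n * Real.exp (1 - k * η ^ 2 / 32) ≤ δ / 6 := by
    refine mul_exp_one_sub_le hδ hδ1 hD hn ?_
    rw [← mul_slack_sq δ D n hk]
    gcongr
  have hcov : n * Real.exp (-(k / (2 * 12 ^ D))) ≤ δ / 6 :=
    mul_exp_neg_le hδ (by omega) (by rwa [le_div_iff₀' (by positivity)])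
  have hk12 : 2 * 12 ^ D ≤ (k : ℝ) :=
    (le_mul_of_one_le_right (by positivity) (by linarith)).trans hkD
  exact (h.measure_not_goodSample_le S (hη0.trans hη) hη4
    (radius_pos h.lam_pos (by linarith) (by omega) hk) hρ
    (mul_radius_pow (by omega) h.lam_pos (by linarith) (by omega)) hk12 hconc hcov).trans
    (ENNReal.ofReal_le_ofReal (by linarith))

/-- What the range of `k` is used for: the slack is at most `η₀`, the radii are small compared to
the slack, and `k` dominates `log n`. -/
structure RangeBounds (P : Params) (δ η₀ lam : ℝ) (D n k : ℕ) : Prop where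
  slack_le : slack δ D n k ≤ η₀
  le_k : 2 * 12 ^ D * (Real.log n + Real.log (2 / δ) + 2) ≤ (k : ℝ)
  radius_rpow_le : ∀ η ≤ 1 / 2, radius lam D n k η ^ P.beta ≤ P.ratioBound * slack δ D n k

lemma RangeBounds.k_pos {η₀ : ℝ} (B : RangeBounds P δ η₀ lam D n k) (hδ : 0 < δ) (hδ1 : δ < 1) :
    0 < k := by
  have := Real.log_natCast_nonneg n
  have hL := half_le_log_two_div hδ hδ1
  have hk : (0 : ℝ) < k := lt_of_lt_of_le (by positivity) B.le_k
  exact_mod_cast hk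

lemma RangeBounds.two_mul_radius_le {η₀ : ℝ} (B : RangeBounds P δ η₀ lam D n k)
    (hlam : P.lam0 ≤ lam) (hn : 0 < n) (hk : 0 < k) (hη : η ≤ 1 / 2) :
    2 * radius lam D n k η ≤ P.falloffRadius lam (slack δ D n k) :=
  Params.two_mul_le_falloffRadius hlam (slack_nonneg δ D n k)
    (radius_pos (P.lam0_pos.trans_le hlam) hη hn hk).le (B.radius_rpow_le η hη)

lemma RangeBounds.fineScale {η₀ : ℝ} (B : RangeBounds P δ η₀ lam D n k)
    (hη₀ : η₀ ≤ min (1 / 4) P.slackBound) (hlam : P.lam0 ≤ lam) (hn : 0 < n) (hk : 0 < k)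
    (hF : lam ≤ P.fmax) :
    FineScale P lam (radius lam D n k (slack δ D n k)) (slack δ D n k)
      (radius lam D n k (slack δ D n k)) := by
  have hη := B.slack_le.trans hη₀
  have hη2 : slack δ D n k ≤ 1 / 2 := by linarith [hη.trans (min_le_left _ _)]
  exact FineScale.of_rpow_le hlam hF (slack_nonneg δ D n k) (hη.trans (min_le_right _ _))
    (radius_pos (P.lam0_pos.trans_le hlam) hη2 hn hk) (B.radius_rpow_le _ hη2)

lemma exists_rangeBounds (hD : 1 ≤ D) (hδ : 0 < δ) (hδ1 : δ < 1) (P : Params) {η₀ : ℝ}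
    (hη₀ : 0 < η₀) :
    ∃ Kl Ku : ℝ, 0 < Kl ∧ 0 < Ku ∧ ∀ (lam : ℝ) (n k : ℕ), P.lam0 ≤ lam → 2 ≤ n →
      InRange Kl Ku P.beta 2 D n k → RangeBounds P δ η₀ lam D n k := by
  have hL := half_le_log_two_div hδ hδ1
  set A : ℝ := 10 ^ 2 * Real.log (2 / δ) ^ 2 * D with hA
  have hm : 0 < P.ratioBound * A := mul_pos P.ratioBound_pos (by positivity)
  obtain ⟨Kl, hKl, hslack⟩ := exists_slack_le hD hδ hδ1 hη₀
  obtain ⟨Ku, hKu, hradius⟩ := exists_radius_rpow_le hD P.beta_pos P.lam0_pos hm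
  refine ⟨Kl, Ku, hKl, hKu, fun lam n k hlam hn hk => ?_⟩
  obtain ⟨hη, hkD⟩ := hslack n k hn hk.1
  refine ⟨hη, hkD, fun η hη2 => ?_⟩
  have hl := half_le_log_natCast hn
  have hk0 : (0 : ℝ) < k := lt_of_lt_of_le (by positivity) hkD
  refine (hradius lam η n k hlam hη2 (by omega) (by exact_mod_cast hk0) hk.2).trans_eq ?_
  rw [slack, confConst_sq, ← hA]
  ring

lemma falloffRadius_add_two_mul_le_errBound (hδ : 0 < δ) (hδ1 : δ < 1) (hlam : 0 < lam) {ε : ℝ}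
    (h : 2 * ε ≤ P.falloffRadius lam (slack δ D n k)) :
    P.falloffRadius lam (slack δ D n k) + 2 * ε ≤ errBound 10 δ lam P D n k := by
  have hη := slack_nonneg δ D n k
  rw [errBound_eq hδ hδ1 hlam]
  linarith [P.falloffRadius_mono hlam.le hη (by linarith : slack δ D n k ≤ 2 * slack δ D n k)]

theorem exists_allRecovered (hD : 1 ≤ D) (hδ : 0 < δ) (hδ1 : δ < 1) (P : Params) :
    ∃ Kl Ku : ℝ, 0 < Kl ∧ 0 < Ku ∧
      ∀ (lam : ℝ) (f : Euc D → ℝ), LevelRegular P lam f →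
      ∀ n k : ℕ, 2 ≤ n → InRange Kl Ku P.beta 2 D n k →
        sampleLaw f n {X | ¬ AllRecovered (levelComponents f lam) (estClusters 10 δ lam k X)
          (errBound 10 δ lam P D n k)} ≤ ENNReal.ofReal δ := by
  obtain ⟨Kl, Ku, hKl, hKu, hrange⟩ := exists_rangeBounds hD hδ hδ1 P
    (lt_min (by norm_num) P.slackBound_pos : 0 < min (1 / 4) P.slackBound)
  refine ⟨Kl, Ku, hKl, hKu, fun lam f h n k hn hk => ?_⟩
  have B := hrange lam n k h.lam0_lt.le hn hk
  have hk0 := B.k_pos hδ hδ1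
  have hη4 := B.slack_le.trans (min_le_left _ _)
  have hη2 : slack δ D n k ≤ 1 / 2 := by linarith
  have S := B.fineScale le_rfl h.lam0_lt.le (by omega) hk0
  have hfail := h.measure_not_goodSample_radius_le hD hδ hδ1 hn hk0 le_rfl hη4
    (radius_pos h.lam_pos hη2 (by omega) hk0).le S B.le_k
  refine le_trans (measure_mono ?_) (hfail.trans (ENNReal.ofReal_le_ofReal (by linarith)))
  intro X hX G
  rw [Set.mem_ofPred_eq, estClusters_eq] at hX
  exact hX (G.allRecovered h S (falloffRadius_add_two_mul_le_errBound hδ hδ1 h.lam_pos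
    (B.two_mul_radius_le h.lam0_lt.le (by omega) hk0 hη2)))

/-- A bound on both slacks, and on their ratio, under which pruning removes the false clusters of
densities with gap at least `γ`. -/
noncomputable def Params.pruningBound (P : Params) (γ : ℝ) : ℝ :=
  min (min (1 / 4) P.slackBound) (min (γ / (8 * P.fmax)) (P.cLow / (4 * 3 ^ P.beta * P.cUp)))

lemma Params.pruningBound_pos (P : Params) (hγ : 0 < γ) : 0 < P.pruningBound γ := by
  have hcLow := P.cLow_pos
  have hcUp := P.cUp_pos
  have hF := P.fmax_pos
  exact lt_min (lt_min (by norm_num) P.slackBound_pos) (lt_min (by positivity) (by positivity))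

lemma Params.four_mul_fmax_mul_lt (P : Params) (hγ : 0 < γ) (hη : η ≤ P.pruningBound γ) :
    4 * P.fmax * η < γ := by
  have hF := P.fmax_pos
  have hηγ := hη.trans ((min_le_right _ _).trans (min_le_left _ _))
  rw [le_div_iff₀ (by positivity)] at hηγ
  linarith

lemma Params.pruningBound_le_min (P : Params) (γ : ℝ) :
    P.pruningBound γ ≤ min (1 / 4) P.slackBound :=
  min_le_left _ _

lemma RangeBounds.fineScale_pruned (B : RangeBounds P δ (P.pruningBound γ) lam D n k)
    (hη' : slackPruned δ D n k ≤ P.pruningBound γ)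
    (hηη' : slack δ D n k ≤ P.pruningBound γ * slackPruned δ D n k) (hlam : P.lam0 ≤ lam)
    (hn : 0 < n) (hk : 0 < k) (hF : lam ≤ P.fmax) :
    FineScale P lam (radius lam D n k (slackPruned δ D n k)) (slackPruned δ D n k)
      (P.falloffRadius lam (slack δ D n k) + 2 * radius lam D n k (slack δ D n k)) := by
  have hlam0 := P.lam0_pos.trans_le hlam
  have hη'0 := slackPruned_nonneg δ D n k
  have hbound := P.pruningBound_le_min γ
  have h4 := hbound.trans (min_le_left _ _)
  have hP := hbound.trans (min_le_right _ _)
  have hratio : P.pruningBound γ ≤ P.cLow / (4 * 3 ^ P.beta * P.cUp) :=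
    (min_le_right _ _).trans (min_le_right _ _)
  have hη2 : slack δ D n k ≤ 1 / 2 := by linarith [B.slack_le]
  have hη2' : slackPruned δ D n k ≤ 1 / 2 := by linarith
  exact FineScale.of_le_mul hlam0 hF (slack_nonneg δ D n k) hη'0 (B.slack_le.trans hP)
    (hη'.trans hP) (hηη'.trans (mul_le_mul_of_nonneg_right hratio hη'0))
    (radius_pos hlam0 hη2 hn hk).le (radius_pos hlam0 hη2' hn hk)
    (B.two_mul_radius_le hlam hn hk hη2) (B.two_mul_radius_le hlam hn hk hη2')

lemma exists_pruned_rangeBounds (hD : 1 ≤ D) (hδ : 0 < δ) (hδ1 : δ < 1) (P : Params) {η₀ : ℝ}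
    (hη₀ : 0 < η₀) :
    ∃ Kl Ku : ℝ, 0 < Kl ∧ 0 < Ku ∧ ∀ (lam : ℝ) (n k : ℕ), P.lam0 ≤ lam → 2 ≤ n →
      InRange Kl Ku P.beta 3 D n k → RangeBounds P δ η₀ lam D n k ∧
        slackPruned δ D n k ≤ η₀ ∧ slack δ D n k ≤ η₀ * slackPruned δ D n k := by
  obtain ⟨Kl, Ku, hKl, hKu, hrange⟩ := exists_rangeBounds hD hδ hδ1 P hη₀
  obtain ⟨Kl', hKl', hpruned⟩ := exists_slackPruned_le hδ hδ1 hη₀ D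
  refine ⟨2 * Kl + Kl', Ku, by positivity, hKu, fun lam n k hlam hn hk => ?_⟩
  have hl := half_le_log_natCast hn
  have hKl3 : 0 ≤ Kl * Real.log n ^ 3 := by positivity
  have hKl3' : 0 ≤ Kl' * Real.log n ^ 3 := by positivity
  have hlow := hk.1
  have hsq : Kl * Real.log n ^ 2 * (1 / 2) ≤ Kl * Real.log n ^ 2 * Real.log n := by gcongr
  exact ⟨hrange lam n k hlam hn ⟨by linarith, hk.2⟩, hpruned n k hn (by linarith)⟩

theorem exists_noFalseCluster (hD : 1 ≤ D) (hδ : 0 < δ) (hδ1 : δ < 1) (P : Params) (hγ : 0 < γ) :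
    ∃ Kl Ku : ℝ, 0 < Kl ∧ 0 < Ku ∧
      ∀ (lam : ℝ) (f : Euc D → ℝ), LevelRegular P lam f → γ ≤ gap f lam P.rc →
      ∀ n k : ℕ, 2 ≤ n → InRange Kl Ku P.beta 3 D n k →
        sampleLaw f n {X | ¬ NoFalseCluster (levelComponents f lam) (prunedClusters 10 δ lam k X)
          (errBound 10 δ lam P D n k)} ≤ ENNReal.ofReal δ := by
  obtain ⟨Kl, Ku, hKl, hKu, hrange⟩ :=
    exists_pruned_rangeBounds hD hδ hδ1 P (P.pruningBound_pos hγ)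
  refine ⟨Kl, Ku, hKl, hKu, fun lam f h hgap n k hn hk => ?_⟩
  obtain ⟨B, hη', hηη'⟩ := hrange lam n k h.lam0_lt.le hn hk
  have hlam := h.lam_pos
  have hk0 := B.k_pos hδ hδ1
  have h4 := (P.pruningBound_le_min γ).trans (min_le_left _ _)
  have hη4 := B.slack_le.trans h4
  have hη'4 := hη'.trans h4
  have hle : slack δ D n k ≤ slackPruned δ D n k :=
    hηη'.trans (mul_le_of_le_one_left (slackPruned_nonneg δ D n k) (by linarith))
  have hε := radius_pos (D := D) hlam (hη4.trans (by norm_num)) (by omega : 0 < n) hk0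
  have S := B.fineScale (P.pruningBound_le_min γ) h.lam0_lt.le (by omega) hk0
  have S' := B.fineScale_pruned hη' hηη' h.lam0_lt.le (by omega) hk0
  have hcollar := P.falloffRadius_nonneg hlam.le (slack_nonneg δ D n k)
  have hfail := h.measure_not_goodSample_radius_le hD hδ hδ1 hn hk0 le_rfl hη4 hε.le S B.le_k
  have hfail' := h.measure_not_goodSample_radius_le hD hδ hδ1 hn hk0 hle hη'4
    (by linarith) S' B.le_k
  rw [← add_halves δ, ENNReal.ofReal_add (by positivity) (by positivity), add_halves δ]
  refine le_trans (measure_mono fun X hX => ?_)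
    ((measure_union_le _ _).trans (add_le_add hfail hfail'))
  by_contra hgood
  simp only [Set.mem_union, Set.mem_ofPred_eq, not_or, not_not] at hgood
  rw [Set.mem_ofPred_eq, prunedClusters_eq] at hX
  exact hX (hgood.1.noFalseCluster hgood.2 h hgap (slack_nonneg δ D n k) hη4
    (P.four_mul_fmax_mul_lt hγ B.slack_le) (radius_mono hlam hle (by linarith) (by omega)) S S'
    (falloffRadius_add_two_mul_le_errBound hδ hδ1 hlam
      (B.two_mul_radius_le h.lam0_lt.le (by omega) hk0 (by linarith))))

end UpperBounds

section Rates

variable {D : ℕ} {δ : ℝ}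

lemma exists_inRange {β Kl Ku a₁ : ℝ} (a₂ : ℝ) (a : ℕ) (hD : 1 ≤ D) (hβ : 0 < β) (hKl : 0 < Kl)
    (hKu : 0 < Ku) (ha₁ : 0 < a₁) :
    ∃ N : ℕ, 2 ≤ N ∧ ∀ n k : ℕ, N ≤ n → a₁ * (n : ℝ) ^ (2 * β / (2 * β + D)) ≤ k →
      (k : ℝ) ≤ a₂ * (n : ℝ) ^ (2 * β / (2 * β + D)) → InRange Kl Ku β a D n k := by
  have hlow : ∀ᶠ n : ℕ in atTop,
      Kl * Real.log n ^ a ≤ a₁ * (n : ℝ) ^ (2 * β / (2 * β + D)) := by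
    have hlittle := (isLittleO_log_rpow_rpow_atTop (a : ℝ)
      (by positivity : 0 < 2 * β / (2 * β + D))).bound (by positivity : 0 < a₁ / Kl)
    filter_upwards [tendsto_natCast_atTop_atTop.eventually hlittle] with n hn
    have hl := Real.log_natCast_nonneg n
    rw [Real.norm_of_nonneg (by positivity), Real.norm_of_nonneg (by positivity),
      Real.rpow_natCast] at hn
    calc Kl * Real.log n ^ a ≤ Kl * (a₁ / Kl * (n : ℝ) ^ (2 * β / (2 * β + D))) := by gcongr
      _ = _ := by field_simp
  have hupp : ∀ᶠ n : ℕ in atTop, a₂ / Ku ≤ Real.log n ^ (2 * D / (2 * β + D)) :=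
    ((tendsto_rpow_atTop (by positivity : 0 < 2 * D / (2 * β + D))).comp
      (Real.tendsto_log_atTop.comp tendsto_natCast_atTop_atTop)).eventually_ge_atTop _
  obtain ⟨N, hN⟩ := eventually_atTop.mp (hlow.and (hupp.and (eventually_ge_atTop 2)))
  refine ⟨N, (hN N le_rfl).2.2, fun n k hn hk₁ hk₂ => ?_⟩
  obtain ⟨hl, hu, -⟩ := hN n hn
  refine ⟨hl.trans hk₁, hk₂.trans ?_⟩
  rw [div_le_iff₀' hKu] at hu
  gcongr

lemma confConst_rpow_two_div {C₀ β : ℝ} (hC₀ : 0 ≤ C₀) (hδ : 0 < δ) (hδ1 : δ < 1) (D n : ℕ) :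
    confConst C₀ δ D n ^ (2 / β) =
      (C₀ * Real.log (2 / δ) * Real.sqrt D) ^ (2 / β) * Real.log n ^ (1 / β) := by
  have hL := half_le_log_two_div hδ hδ1
  have hl := Real.log_natCast_nonneg n
  rw [confConst, Real.sqrt_mul (Nat.cast_nonneg D), ← mul_assoc,
    Real.mul_rpow (by positivity) (Real.sqrt_nonneg _), Real.sqrt_eq_rpow (Real.log n),
    ← Real.rpow_mul hl]
  congr 2
  ring

lemma exists_errBound_le (hD : 1 ≤ D) (hδ : 0 < δ) (hδ1 : δ < 1) (P : Params) {a₁ : ℝ}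
    (ha₁ : 0 < a₁) : ∃ R : ℝ, 0 < R ∧ ∀ (lam : ℝ) (n k : ℕ), 0 ≤ lam → lam ≤ P.fmax → 0 < n →
      a₁ * (n : ℝ) ^ (2 * P.beta / (2 * P.beta + D)) ≤ k →
      errBound 10 δ lam P D n k ≤
        R * Real.log n ^ (1 / P.beta) * (n : ℝ) ^ (-(1 / (2 * P.beta + D))) := by
  have hc := P.cLow_pos
  have hβ := P.beta_pos
  have hF := P.fmax_pos
  have hL := half_le_log_two_div hδ hδ1
  set B := (10 * Real.log (2 / δ) * Real.sqrt D) ^ (2 / P.beta)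
  refine ⟨2 * (4 * P.fmax / P.cLow) ^ (1 / P.beta) * B * a₁ ^ (-(1 / (2 * P.beta))),
    by positivity, fun lam n k hlam hlamF hn hk => ?_⟩
  have := Real.log_natCast_nonneg n
  have hk_rpow : (k : ℝ) ^ (-(1 / (2 * P.beta))) ≤
      a₁ ^ (-(1 / (2 * P.beta))) * (n : ℝ) ^ (-(1 / (2 * P.beta + D))) := by
    refine (Real.rpow_le_rpow_of_nonpos (by positivity) hk
      (neg_nonpos.mpr (by positivity))).trans_eq ?_
    rw [Real.mul_rpow ha₁.le (by positivity), ← Real.rpow_mul (by positivity)]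
    congr 2
    field_simp
  rw [errBound, confConst_rpow_two_div (by norm_num) hδ hδ1]
  calc 2 * (4 * lam / P.cLow) ^ (1 / P.beta) * (B * Real.log n ^ (1 / P.beta)) *
        (k : ℝ) ^ (-(1 / (2 * P.beta)))
      ≤ 2 * (4 * P.fmax / P.cLow) ^ (1 / P.beta) * (B * Real.log n ^ (1 / P.beta)) *
        (a₁ ^ (-(1 / (2 * P.beta))) * (n : ℝ) ^ (-(1 / (2 * P.beta + D)))) := by gcongr
    _ = _ := by ring

theorem exists_allRecovered_rate (hD : 1 ≤ D) (hδ : 0 < δ) (hδ1 : δ < 1) (P : Params) {a₁ : ℝ}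
    (ha₁ : 0 < a₁) (a₂ : ℝ) : ∃ (N : ℕ) (R : ℝ), 0 < R ∧
      ∀ (lam : ℝ) (f : Euc D → ℝ), LevelRegular P lam f →
      ∀ n k : ℕ, N ≤ n → a₁ * (n : ℝ) ^ (2 * P.beta / (2 * P.beta + D)) ≤ k →
        (k : ℝ) ≤ a₂ * (n : ℝ) ^ (2 * P.beta / (2 * P.beta + D)) →
        sampleLaw f n {X | ¬ AllRecovered (levelComponents f lam) (estClusters 10 δ lam k X)
          (R * Real.log n ^ (1 / P.beta) * (n : ℝ) ^ (-(1 / (2 * P.beta + D))))} ≤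
            ENNReal.ofReal δ := by
  obtain ⟨Kl, Ku, hKl, hKu, hrec⟩ := exists_allRecovered hD hδ hδ1 P
  obtain ⟨N, hN2, hrange⟩ := exists_inRange a₂ 2 hD P.beta_pos hKl hKu ha₁
  obtain ⟨R, hR, hbound⟩ := exists_errBound_le hD hδ hδ1 P ha₁
  refine ⟨N, R, hR, fun lam f h n k hn hk₁ hk₂ => ?_⟩
  refine le_trans (measure_mono ?_)
    (hrec lam f h n k (hN2.trans hn) (hrange n k hn hk₁ hk₂))
  refine fun X hX hA => hX fun C hC => ?_
  obtain ⟨K, hK, hCK⟩ := hA C hC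
  exact ⟨K, hK, hCK.trans (ENNReal.ofReal_le_ofReal
    (hbound lam n k h.lam_pos.le (h.lam_le_fmax hC) (by omega) hk₁))⟩

theorem exists_noFalseCluster_rate (hD : 1 ≤ D) (hδ : 0 < δ) (hδ1 : δ < 1) (P : Params)
    {γ a₁ : ℝ} (hγ : 0 < γ) (ha₁ : 0 < a₁) (a₂ : ℝ) : ∃ (N : ℕ) (R : ℝ), 0 < R ∧
      ∀ (lam : ℝ) (f : Euc D → ℝ), LevelRegular P lam f → γ ≤ gap f lam P.rc →
      ∀ n k : ℕ, N ≤ n → a₁ * (n : ℝ) ^ (2 * P.beta / (2 * P.beta + D)) ≤ k →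
        (k : ℝ) ≤ a₂ * (n : ℝ) ^ (2 * P.beta / (2 * P.beta + D)) →
        sampleLaw f n {X | ¬ NoFalseCluster (levelComponents f lam) (prunedClusters 10 δ lam k X)
          (R * Real.log n ^ (1 / P.beta) * (n : ℝ) ^ (-(1 / (2 * P.beta + D))))} ≤
            ENNReal.ofReal δ := by
  obtain ⟨Kl, Ku, hKl, hKu, hprune⟩ := exists_noFalseCluster hD hδ hδ1 P hγ
  obtain ⟨N, hN2, hrange⟩ := exists_inRange a₂ 3 hD P.beta_pos hKl hKu ha₁
  obtain ⟨R, hR, hbound⟩ := exists_errBound_le hD hδ hδ1 P ha₁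
  refine ⟨N, R, hR, fun lam f h hgap n k hn hk₁ hk₂ => ?_⟩
  refine le_trans (measure_mono ?_)
    (hprune lam f h hgap n k (hN2.trans hn) (hrange n k hn hk₁ hk₂))
  refine fun X hX hA => hX fun K hK => ?_
  obtain ⟨C, hC, hCK⟩ := hA K hK
  exact ⟨C, hC, hCK.trans (ENNReal.ofReal_le_ofReal
    (hbound lam n k h.lam_pos.le (h.lam_le_fmax hC) (by omega) hk₁))⟩

end Rates

section Gap

variable {D : ℕ} {lam r : ℝ} {f : Euc D → ℝ}

lemma lt_of_mem_closure_compl_iUnion_cthickening (hr : 0 < r) {x : Euc D}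
    (hx : x ∈ closure (⋃ C ∈ levelComponents f lam, Metric.cthickening r C)ᶜ) : f x < lam := by
  by_contra! hfx
  obtain ⟨C, hC, hxC⟩ := exists_mem_levelComponents hfx
  obtain ⟨y, hy, hxy⟩ := Metric.mem_closure_iff.mp hx r hr
  refine hy (Set.mem_iUnion₂.mpr ⟨C, hC, ?_⟩)
  exact Metric.mem_cthickening_of_dist_le y x r C hxC (by rw [dist_comm]; exact hxy.le)

lemma exists_lt_forall_le_of_tendsto_zero {X : Type*} [TopologicalSpace X] {g : X → ℝ} {t : ℝ}
    {U : Set X} (hg : Continuous g) (h0 : Tendsto g (cocompact X) (𝓝 0)) (ht : 0 < t)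
    (hU : ∀ x ∈ closure U, g x < t) : ∃ b, 0 ≤ b ∧ b < t ∧ ∀ x ∈ U, g x ≤ b := by
  obtain ⟨K, hK, hKsub⟩ := mem_cocompact.mp (h0.eventually_lt_const (half_pos ht))
  rcases (K ∩ closure U).eq_empty_or_nonempty with hempty | hne
  · refine ⟨t / 2, by linarith, by linarith, fun x hx => le_of_lt (hKsub fun hxK => ?_)⟩
    exact Set.notMem_empty x (hempty ▸ ⟨hxK, subset_closure hx⟩)
  · obtain ⟨z, hz, hmax⟩ :=
      (hK.inter_right isClosed_closure).exists_isMaxOn hne hg.continuousOn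
    refine ⟨max (g z) (t / 2), le_max_of_le_right (by linarith),
      max_lt (hU z hz.2) (by linarith), fun x hx => ?_⟩
    by_cases hxK : x ∈ K
    · exact le_max_of_le_left (hmax ⟨hxK, subset_closure hx⟩)
    · exact le_max_of_le_right (le_of_lt (hKsub hxK))

theorem gap_pos (hf : Continuous f) (h0 : Tendsto f (cocompact (Euc D)) (𝓝 0)) (hlam : 0 < lam)
    (hr : 0 < r) : 0 < gap f lam r := by
  obtain ⟨b, hb0, hb, hle⟩ := exists_lt_forall_le_of_tendsto_zero hf h0 hlam fun _ =>
    lt_of_mem_closure_compl_iUnion_cthickening hr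
  exact sub_pos.mpr ((Real.sSup_le (Set.forall_mem_image.mpr hle) hb0).trans_lt hb)

end Gap

section TwoPointMethod

lemma lintegral_pi_prod {ι : Type*} [Fintype ι] {E : ι → Type*} [∀ i, MeasurableSpace (E i)]
    (μ : ∀ i, Measure (E i)) [∀ i, IsProbabilityMeasure (μ i)] {h : ∀ i, E i → ℝ≥0∞}
    (hh : ∀ i, Measurable (h i)) :
    ∫⁻ Y, ∏ i, h i (Y i) ∂(Measure.pi μ) = ∏ i, ∫⁻ x, h i x ∂(μ i) := by
  have hindep := ProbabilityTheory.iIndepFun_pi (μ := μ) (X := h) fun i => (hh i).aemeasurable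
  rw [ProbabilityTheory.lintegral_prod_eq_prod_lintegral_of_indepFun _ _ hindep
    fun i => (hh i).comp (measurable_pi_apply i)]
  exact Finset.prod_congr rfl fun i _ => (measurePreserving_eval μ i).lintegral_comp (hh i)

lemma indicator_univ_pi_prod {ι : Type*} [Fintype ι] {E : ι → Type*} (s : ∀ i, Set (E i))
    (g : ∀ i, E i → ℝ≥0∞) (X : ∀ i, E i) :
    (Set.univ.pi s).indicator (fun X => ∏ i, g i (X i)) X = ∏ i, (s i).indicator (g i) (X i) := by
  by_cases hX : X ∈ Set.univ.pi s
  · rw [Set.indicator_of_mem hX]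
    exact Finset.prod_congr rfl fun i _ => (Set.indicator_of_mem (hX i trivial) (g i)).symm
  · rw [Set.indicator_of_notMem hX]
    obtain ⟨i, hi⟩ : ∃ i, X i ∉ s i := by simpa [Set.mem_pi] using hX
    exact (Finset.prod_eq_zero (Finset.mem_univ i) (Set.indicator_of_notMem hi (g i))).symm

lemma pi_withDensity {ι : Type*} [Fintype ι] {E : ι → Type*} [∀ i, MeasurableSpace (E i)]
    (μ : ∀ i, Measure (E i)) [∀ i, IsProbabilityMeasure (μ i)] {g : ∀ i, E i → ℝ≥0∞}
    (hg : ∀ i, Measurable (g i)) [∀ i, SigmaFinite ((μ i).withDensity (g i))] :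
    (Measure.pi fun i => (μ i).withDensity (g i)) =
      (Measure.pi μ).withDensity fun X => ∏ i, g i (X i) := by
  refine Measure.pi_eq fun s hs => ?_
  rw [withDensity_apply _ (MeasurableSet.univ_pi hs),
    ← lintegral_indicator (MeasurableSet.univ_pi hs)]
  simp_rw [indicator_univ_pi_prod]
  rw [lintegral_pi_prod μ fun i => (hg i).indicator (hs i)]
  exact Finset.prod_congr rfl fun i _ => by
    rw [lintegral_indicator (hs i), withDensity_apply _ (hs i)]

lemma le_min_one_add_sq_div_four (y : ℝ≥0∞) : y ≤ min 1 y + y ^ 2 / 4 := by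
  rcases le_total y 1 with hy | hy
  · rw [min_eq_right hy]
    exact le_self_add
  rw [min_eq_left hy]
  induction y using ENNReal.recTopCoe with
  | top => simp [ENNReal.top_div]
  | coe y =>
    have hsq : y ≤ 1 + y ^ 2 / 4 := by
      rw [← NNReal.coe_le_coe]
      push_cast
      nlinarith [sq_nonneg ((y : ℝ) / 2 - 1)]
    calc (y : ℝ≥0∞) ≤ ((1 + y ^ 2 / 4 : NNReal) : ℝ≥0∞) := by exact_mod_cast hsq
      _ = 1 + (y : ℝ≥0∞) ^ 2 / 4 := by
        rw [ENNReal.coe_add, ENNReal.coe_div (by norm_num)]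
        norm_num

/-- Le Cam's two-point method. The part `min 1 G` of the second measure common to both has mass at
least `1 - ∫ G² / 4`; the two events need not be measurable. -/
theorem one_half_le_add_withDensity {Ω : Type*} [MeasurableSpace Ω] (Q : Measure Ω)
    {G : Ω → ℝ≥0∞} (hG : Measurable G) (hmass : ∫⁻ X, G X ∂Q = 1) (hsq : ∫⁻ X, G X ^ 2 ∂Q ≤ 2)
    {E₀ E₁ : Set Ω} (hE : E₀ ∪ E₁ = Set.univ) :
    1 / 2 ≤ Q E₀ + Q.withDensity G E₁ := by
  set ν := Q.withDensity fun X => min 1 (G X) with hν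
  have hνQ : ν ≤ Q := by
    have : ν ≤ Q.withDensity 1 := withDensity_mono (ae_of_all _ fun X => min_le_left _ _)
    rwa [withDensity_one] at this
  have hνG : ν ≤ Q.withDensity G := withDensity_mono (ae_of_all _ fun X => min_le_right _ _)
  have hquarter : 2 * (4 : ℝ≥0∞)⁻¹ = 1 / 2 := by
    rw [← ENNReal.toReal_eq_toReal_iff' (by finiteness) (by finiteness)]
    norm_num
  have hcommon : 1 ≤ ν Set.univ + 1 / 2 := by
    calc (1 : ℝ≥0∞) = ∫⁻ X, G X ∂Q := hmass.symm
      _ ≤ ∫⁻ X, (min 1 (G X) + G X ^ 2 * 4⁻¹) ∂Q :=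
        lintegral_mono fun X => le_min_one_add_sq_div_four _
      _ = ν Set.univ + (∫⁻ X, G X ^ 2 ∂Q) * 4⁻¹ := by
        rw [lintegral_add_left (measurable_const.min hG), lintegral_mul_const _ (hG.pow_const 2),
          hν, withDensity_apply _ MeasurableSet.univ, setLIntegral_univ]
      _ ≤ ν Set.univ + 2 * 4⁻¹ := by gcongr
      _ = ν Set.univ + 1 / 2 := by rw [hquarter]
  calc (1 / 2 : ℝ≥0∞) ≤ ν Set.univ := by
        refine ENNReal.le_of_add_le_add_right (a := 1 / 2) (by norm_num) ?_
        rwa [ENNReal.add_halves]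
    _ ≤ ν E₀ + ν E₁ := by rw [← hE]; exact measure_union_le _ _
    _ ≤ Q E₀ + Q.withDensity G E₁ := add_le_add (hνQ E₀) (hνG E₁)

theorem one_half_le_add_pi_withDensity {E : Type*} [MeasurableSpace E] (μ : Measure E)
    [IsProbabilityMeasure μ] {g : E → ℝ≥0∞} (hg : Measurable g)
    [IsProbabilityMeasure (μ.withDensity g)] {n : ℕ} (hsq : (∫⁻ x, g x ^ 2 ∂μ) ^ n ≤ 2)
    {E₀ E₁ : Set (Fin n → E)} (hE : E₀ ∪ E₁ = Set.univ) :
    1 / 2 ≤ (Measure.pi fun _ => μ) E₀ + (Measure.pi fun _ => μ.withDensity g) E₁ := by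
  have hprod := pi_withDensity (fun _ : Fin n => μ) (g := fun _ => g) fun _ => hg
  have hG : Measurable fun X : Fin n → E => ∏ j, g (X j) :=
    Finset.measurable_prod _ fun j _ => hg.comp (measurable_pi_apply j)
  rw [hprod]
  refine one_half_le_add_withDensity _ hG ?_ ?_ hE
  · have := measure_univ (μ := Measure.pi fun _ : Fin n => μ.withDensity g)
    rwa [hprod, withDensity_apply _ MeasurableSet.univ, setLIntegral_univ] at this
  · simp_rw [← Finset.prod_pow]
    rw [lintegral_pi_prod (fun _ : Fin n => μ) fun _ => hg.pow_const 2]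
    simpa using hsq

end TwoPointMethod

section ChiSquare

variable {D : ℕ} {f f' w : Euc D → ℝ}

lemma densityLaw_eq_withDensity (hf : Measurable f) (hf' : Measurable f') (hf0 : ∀ x, 0 ≤ f x)
    (hzero : ∀ x, f x = 0 → f' x = 0) :
    densityLaw f' = (densityLaw f).withDensity fun x => ENNReal.ofReal (f' x / f x) := by
  have hratio : Measurable fun x => ENNReal.ofReal (f' x / f x) := (hf'.div hf).ennreal_ofReal
  rw [densityLaw, densityLaw, ← withDensity_mul _ hf.ennreal_ofReal hratio]
  congr 1 with x
  rw [Pi.mul_apply, ← ENNReal.ofReal_mul (hf0 x), mul_div_cancel_of_imp' (hzero x)]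

lemma mul_div_sq_add_le {a b w : ℝ} (ha : 0 ≤ a) (hb : 0 ≤ b) (hw : 0 ≤ w)
    (h : (b - a) ^ 2 ≤ w * a) : a * (b / a) ^ 2 + a ≤ 2 * b + w := by
  rcases ha.eq_or_lt with rfl | ha
  · simp only [zero_mul, zero_add]
    positivity
  · have hquot : a * (b / a) ^ 2 = b ^ 2 / a := by field_simp
    have : b ^ 2 / a ≤ 2 * b + w - a := by
      rw [div_le_iff₀ ha]
      linarith
    linarith

lemma lintegral_ratio_sq_le (hf : Measurable f) (hf' : Measurable f') (hf0 : ∀ x, 0 ≤ f x)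
    (hf'0 : ∀ x, 0 ≤ f' x) (hf1 : ∫⁻ x, ENNReal.ofReal (f x) = 1)
    (hf'1 : ∫⁻ x, ENNReal.ofReal (f' x) = 1) (hw0 : ∀ x, 0 ≤ w x)
    (hw : ∀ x, (f' x - f x) ^ 2 ≤ w x * f x) :
    ∫⁻ x, ENNReal.ofReal (f' x / f x) ^ 2 ∂(densityLaw f) ≤ 1 + ∫⁻ x, ENNReal.ofReal (w x) := by
  have hpoint : ∀ x, ENNReal.ofReal (f x) * ENNReal.ofReal (f' x / f x) ^ 2 +
      ENNReal.ofReal (f x) ≤ 2 * ENNReal.ofReal (f' x) + ENNReal.ofReal (w x) := fun x => by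
    have hf0 := hf0 x
    have hf'0 := hf'0 x
    rw [← ENNReal.ofReal_pow (by positivity), ← ENNReal.ofReal_mul hf0,
      ← ENNReal.ofReal_add (by positivity) hf0, ← ENNReal.ofReal_ofNat 2,
      ← ENNReal.ofReal_mul zero_le_two, ← ENNReal.ofReal_add (by positivity) (hw0 x)]
    exact ENNReal.ofReal_le_ofReal (mul_div_sq_add_le hf0 hf'0 (hw0 x) (hw x))
  have hratio : Measurable fun x => ENNReal.ofReal (f' x / f x) := (hf'.div hf).ennreal_ofReal
  rw [densityLaw, lintegral_withDensity_eq_lintegral_mul _ hf.ennreal_ofReal (hratio.pow_const 2)]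
  refine (ENNReal.add_le_add_iff_right ENNReal.one_ne_top).mp ?_
  calc _ = ∫⁻ x, (ENNReal.ofReal (f x) * ENNReal.ofReal (f' x / f x) ^ 2 +
          ENNReal.ofReal (f x)) := by
        rw [lintegral_add_right _ hf.ennreal_ofReal, hf1]
        rfl
    _ ≤ ∫⁻ x, (2 * ENNReal.ofReal (f' x) + ENNReal.ofReal (w x)) := lintegral_mono hpoint
    _ = 2 + ∫⁻ x, ENNReal.ofReal (w x) := by
        rw [lintegral_add_left (hf'.ennreal_ofReal.const_mul _),
          lintegral_const_mul _ hf'.ennreal_ofReal, hf'1, mul_one]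
    _ = (1 + ∫⁻ x, ENNReal.ofReal (w x)) + 1 := by rw [add_right_comm, one_add_one_eq_two]

lemma one_add_ofReal_pow_le_two {n : ℕ} {χ : ℝ} (hχ0 : 0 ≤ χ) (hχ : n * χ ≤ 1 / 2) :
    (1 + ENNReal.ofReal χ) ^ n ≤ 2 := by
  rw [← ENNReal.ofReal_one, ← ENNReal.ofReal_add zero_le_one hχ0,
    ← ENNReal.ofReal_pow (by positivity), ← ENNReal.ofReal_ofNat 2]
  refine ENNReal.ofReal_le_ofReal ?_
  calc (1 + χ) ^ n ≤ Real.exp χ ^ n :=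
        pow_le_pow_left₀ (by positivity) (by linarith [Real.add_one_le_exp χ]) n
    _ = Real.exp (n * χ) := (Real.exp_nat_mul χ n).symm
    _ ≤ Real.exp (1 / 2) := Real.exp_le_exp.mpr hχ
    _ ≤ 1 / (1 - 1 / 2) := Real.exp_bound_div_one_sub_of_interval (by norm_num) (by norm_num)
    _ = 2 := by norm_num

theorem one_quarter_le_sampleLaw_or (hf : Measurable f) (hf' : Measurable f')
    (hf0 : ∀ x, 0 ≤ f x) (hf'0 : ∀ x, 0 ≤ f' x) (hf1 : ∫⁻ x, ENNReal.ofReal (f x) = 1)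
    (hf'1 : ∫⁻ x, ENNReal.ofReal (f' x) = 1) (hw0 : ∀ x, 0 ≤ w x)
    (hw : ∀ x, (f' x - f x) ^ 2 ≤ w x * f x) {χ : ℝ} (hχ0 : 0 ≤ χ)
    (hwχ : ∫⁻ x, ENNReal.ofReal (w x) ≤ ENNReal.ofReal χ) {n : ℕ} (hnχ : n * χ ≤ 1 / 2)
    {E₀ E₁ : Set (Fin n → Euc D)} (hE : E₀ ∪ E₁ = Set.univ) :
    1 / 4 ≤ sampleLaw f n E₀ ∨ 1 / 4 ≤ sampleLaw f' n E₁ := by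
  have hzero : ∀ x, f x = 0 → f' x = 0 := fun x hx => by
    have := hw x
    rw [hx, sub_zero, mul_zero] at this
    exact pow_eq_zero_iff two_ne_zero |>.mp (le_antisymm this (sq_nonneg _))
  have hlaw := densityLaw_eq_withDensity hf hf' hf0 hzero
  have := isProbabilityMeasure_densityLaw hf1
  have : IsProbabilityMeasure ((densityLaw f).withDensity fun x => ENNReal.ofReal (f' x / f x)) :=
    hlaw ▸ isProbabilityMeasure_densityLaw hf'1
  have hsq : (∫⁻ x, ENNReal.ofReal (f' x / f x) ^ 2 ∂(densityLaw f)) ^ n ≤ 2 :=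
    calc _ ≤ (1 + ENNReal.ofReal χ) ^ n := by
          gcongr
          exact (lintegral_ratio_sq_le hf hf' hf0 hf'0 hf1 hf'1 hw0 hw).trans (by gcongr)
      _ ≤ 2 := one_add_ofReal_pow_le_two hχ0 hnχ
  have hsum : 1 / 2 ≤ sampleLaw f n E₀ + sampleLaw f' n E₁ := by
    have hratio : Measurable fun x => ENNReal.ofReal (f' x / f x) := (hf'.div hf).ennreal_ofReal
    have := one_half_le_add_pi_withDensity (densityLaw f) hratio hsq hE
    rwa [← hlaw] at this
  have hquarters : (1 / 4 : ℝ≥0∞) + 1 / 4 = 1 / 2 := by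
    rw [← ENNReal.toReal_eq_toReal_iff' (by finiteness) (by finiteness),
      ENNReal.toReal_add (by finiteness) (by finiteness)]
    norm_num
  by_contra! hlt
  exact (hsum.trans_lt (ENNReal.add_lt_add hlt.1 hlt.2)).ne hquarters.symm

end ChiSquare

section Construction

variable {D : ℕ}

lemma levelComponents_of_isPreconnected {f : Euc D → ℝ} {t : ℝ}
    (h : IsPreconnected (levelSet f t)) (hne : (levelSet f t).Nonempty) :
    levelComponents f t = {levelSet f t} := by
  ext C
  rw [Set.mem_singleton_iff]
  constructor
  · rintro ⟨x, hx, rfl⟩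
    exact h.connectedComponentIn hx
  · rintro rfl
    obtain ⟨x, hx⟩ := hne
    exact ⟨x, hx, (h.connectedComponentIn hx).symm⟩

lemma exists_norm_eq_of_one_le (hD : 1 ≤ D) {s : ℝ} (hs : 0 ≤ s) : ∃ z : Euc D, ‖z‖ = s := by
  have : Nonempty (Fin D) := ⟨⟨0, hD⟩⟩
  exact exists_norm_eq (Euc D) hs

lemma lintegral_ofReal_le_mul_volume {φ : Euc D → ℝ} {c ρ : ℝ} (hc : 0 ≤ c) (hρ : 0 < ρ)
    (hle : ∀ x, φ x ≤ c) (hzero : ∀ x, ρ < ‖x‖ → φ x ≤ 0) :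
    ∫⁻ x, ENNReal.ofReal (φ x) ≤ ENNReal.ofReal (c * (unitBallVol D * ρ ^ D)) := by
  rw [ENNReal.ofReal_mul hc, ← volume_closedBall_eq 0 hρ,
    ← lintegral_indicator_const Metric.isClosed_closedBall.measurableSet]
  refine lintegral_mono fun x => ?_
  by_cases hx : x ∈ Metric.closedBall 0 ρ
  · rw [Set.indicator_of_mem hx]
    exact ENNReal.ofReal_le_ofReal (hle x)
  · rw [Metric.mem_closedBall, dist_zero_right, not_le] at hx
    exact (ENNReal.ofReal_of_nonpos (hzero x hx)).trans_le zero_le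

lemma exists_low_density (hD : 1 ≤ D) {r t : ℝ} (hr : 0 ≤ r) (ht : 0 < t) :
    ∃ b : Euc D → ℝ, Continuous b ∧ (∀ x, 0 ≤ b x) ∧ (∀ x, b x ≤ t) ∧ (∀ x, ‖x‖ ≤ r → b x = 0) ∧
      ∫⁻ x, ENNReal.ofReal (b x) = 1 := by
  have hv := unitBallVol_pos D
  obtain ⟨R, hR1, hR⟩ : ∃ R, 1 ≤ R ∧ 1 / (t * unitBallVol D) ≤ R :=
    ⟨_, le_max_left 1 _, le_max_right 1 _⟩
  have hR0 : 0 < R := by linarith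
  obtain ⟨c, hc⟩ := exists_norm_eq_of_one_le hD (by positivity : 0 ≤ r + 2 * R)
  let φ : ContDiffBump c := ⟨R, 2 * R, hR0, by linarith⟩
  refine ⟨φ.normed volume, φ.continuous_normed, φ.nonneg_normed, fun x => ?_, fun x hx => ?_, ?_⟩
  · have hvol : volume.real (Metric.closedBall c R) = unitBallVol D * R ^ D := by
      rw [Measure.real, volume_closedBall_eq c hR0, ENNReal.toReal_ofReal (by positivity)]
    have hlarge : 1 / t ≤ unitBallVol D * R ^ D :=
      calc 1 / t = unitBallVol D * (1 / (t * unitBallVol D)) := by field_simp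
        _ ≤ unitBallVol D * R ^ D := by
          gcongr
          exact hR.trans (le_self_pow₀ hR1 (by omega))
    calc φ.normed volume x ≤ 1 / volume.real (Metric.closedBall c R) :=
          φ.normed_le_div_measure_closedBall_rIn volume x
      _ ≤ t := by
        rw [hvol]
        exact (one_div_le (by positivity) ht).mpr hlarge
  · refine Function.notMem_support.mp fun hmem => ?_
    rw [φ.support_normed_eq, Metric.mem_ball, dist_eq_norm] at hmem
    have hsub := norm_sub_norm_le c x
    rw [norm_sub_rev, hc] at hsub
    have : ‖x - c‖ < 2 * R := hmem
    linarith
  · rw [← ofReal_integral_eq_lintegral_ofReal φ.integrable_normed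
      (ae_of_all _ φ.nonneg_normed), φ.integral_normed, ENNReal.ofReal_one]

/-- The data shared by the two hypotheses of the lower bound: a peak of height `lam`, falloff
exponent `β` and radius `r`, carrying at most half of the mass, and a probability density `tail`
supported away from the peak that carries the remaining mass. -/
structure PeakData (D : ℕ) where
  (lam β r : ℝ)
  tail : Euc D → ℝ
  lam_pos : 0 < lam
  beta_pos : 0 < β
  r_pos : 0 < r
  mass_le : lam * (unitBallVol D * r ^ D) ≤ 1 / 2
  continuous_tail : Continuous tail
  tail_nonneg : ∀ x, 0 ≤ tail x
  tail_le : ∀ x, tail x ≤ lam / 4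
  tail_eq_zero : ∀ x, ‖x‖ ≤ r → tail x = 0
  lintegral_tail : ∫⁻ x, ENNReal.ofReal (tail x) = 1

lemma exists_peakData (hD : 1 ≤ D) {β lam : ℝ} (hβ : 0 < β) (hlam : 0 < lam) :
    ∃ W : PeakData D, W.β = β ∧ W.lam = lam := by
  have hv := unitBallVol_pos D
  obtain ⟨r, hr0, hr1, hr⟩ : ∃ r : ℝ, 0 < r ∧ r ≤ 1 ∧ r ≤ 1 / (2 * (lam * unitBallVol D)) :=
    ⟨_, lt_min one_pos (by positivity), min_le_left _ _, min_le_right _ _⟩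
  have hmass : lam * (unitBallVol D * r ^ D) ≤ 1 / 2 :=
    calc lam * (unitBallVol D * r ^ D) ≤
          lam * (unitBallVol D * (1 / (2 * (lam * unitBallVol D)))) := by
          gcongr
          exact (pow_le_of_le_one hr0.le hr1 (by omega)).trans hr
      _ = 1 / 2 := by field_simp
  obtain ⟨b, hcont, hnonneg, hle, hzero, hone⟩ :=
    exists_low_density hD hr0.le (by positivity : 0 < lam / 4)
  exact ⟨⟨lam, β, r, b, hlam, hβ, hr0, hmass, hcont, hnonneg, hle, hzero, hone⟩, rfl, rfl⟩

namespace PeakData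

variable (W : PeakData D) {a b : ℝ}

/-- The slope `κ = lam / r^β`, for which the peak `lam - κ ‖x‖^β` vanishes at `‖x‖ = r`. -/
noncomputable def slope : ℝ := W.lam / W.r ^ W.β

/-- The radius of the ball on which the peak is at least `lam / 2`. -/
noncomputable def halfRadius : ℝ := W.r * (1 / 2) ^ (1 / W.β)

/-- The peak `(lam - κ q^β)⁺`, where the profile `q` plays the role of the distance to the
maximum. -/
noncomputable def peak (q : Euc D → ℝ) (x : Euc D) : ℝ := max 0 (W.lam - W.slope * q x ^ W.β)

/-- The mass of the peak. -/
noncomputable def peakMass (q : Euc D → ℝ) : ℝ := (∫⁻ x, ENNReal.ofReal (W.peak q x)).toReal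

/-- The probability density made of the peak and a multiple of the tail. -/
noncomputable def density (q : Euc D → ℝ) (x : Euc D) : ℝ :=
  W.peak q x + (1 - W.peakMass q) * W.tail x

lemma slope_pos : 0 < W.slope := div_pos W.lam_pos (Real.rpow_pos_of_pos W.r_pos _)

lemma halfRadius_pos : 0 < W.halfRadius := mul_pos W.r_pos (by positivity)

lemma halfRadius_lt : W.halfRadius < W.r :=
  mul_lt_of_lt_one_right W.r_pos
    (Real.rpow_lt_one (by norm_num) (by norm_num) (one_div_pos.mpr W.beta_pos))

lemma slope_mul_r : W.slope * W.r ^ W.β = W.lam :=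
  div_mul_cancel₀ _ (Real.rpow_pos_of_pos W.r_pos _).ne'

lemma slope_mul_halfRadius : W.slope * W.halfRadius ^ W.β = W.lam / 2 := by
  rw [halfRadius, Real.mul_rpow W.r_pos.le (by positivity), ← Real.rpow_mul (by norm_num),
    one_div_mul_cancel W.beta_pos.ne', Real.rpow_one, ← mul_assoc, slope_mul_r]
  ring

lemma slope_mul_rpow_nonneg (ha : 0 ≤ a) : 0 ≤ W.slope * a ^ W.β :=
  mul_nonneg W.slope_pos.le (Real.rpow_nonneg ha _)

lemma slope_mul_rpow_mono (ha : 0 ≤ a) (hab : a ≤ b) : W.slope * a ^ W.β ≤ W.slope * b ^ W.β :=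
  mul_le_mul_of_nonneg_left (Real.rpow_le_rpow ha hab W.beta_pos.le) W.slope_pos.le

lemma slope_mul_rpow_strictMono (ha : 0 ≤ a) (hab : a < b) :
    W.slope * a ^ W.β < W.slope * b ^ W.β :=
  mul_lt_mul_of_pos_left (Real.rpow_lt_rpow ha hab W.beta_pos) W.slope_pos

lemma peak_nonneg (q : Euc D → ℝ) (x : Euc D) : 0 ≤ W.peak q x := le_max_left _ _

lemma peakMass_nonneg (q : Euc D → ℝ) : 0 ≤ W.peakMass q := ENNReal.toReal_nonneg

/-- The constants of the separation conditions met by the densities of the lower bound. -/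
noncomputable def params : Params where
  beta := W.β
  cLow := W.slope / 2 ^ W.β
  cUp := W.slope * 2 ^ W.β
  rs := 1
  rc := W.halfRadius / 4
  lam0 := W.lam / 2
  fmax := W.lam
  beta_pos := W.beta_pos
  cLow_pos := div_pos W.slope_pos (by positivity)
  cUp_pos := mul_pos W.slope_pos (by positivity)
  rs_pos := one_pos
  rc_pos := div_pos W.halfRadius_pos (by norm_num)
  lam0_pos := half_pos W.lam_pos
  fmax_pos := W.lam_pos

/-- `q` is comparable to the distance to `z`, and equal to the norm off the ball of radius `2 s`,
a small part of the peak. -/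
structure IsProfile (s : ℝ) (z : Euc D) (q : Euc D → ℝ) : Prop where
  continuous : Continuous q
  lower : ∀ x, ‖x - z‖ / 2 ≤ q x
  upper : ∀ x, q x ≤ 2 * ‖x - z‖
  far : ∀ x, 2 * s ≤ ‖x‖ → q x = ‖x‖
  near : ∀ x, ‖x‖ ≤ 2 * s → q x ≤ 2 * s
  norm_le : ‖z‖ ≤ s
  le_halfRadius : s ≤ W.halfRadius / 4

variable {W} {s t : ℝ} {z x : Euc D} {q : Euc D → ℝ}

lemma isProfile_norm (hs : 0 ≤ s) (hsW : s ≤ W.halfRadius / 4) :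
    W.IsProfile s 0 (fun x => ‖x‖) where
  continuous := continuous_norm
  lower x := by rw [sub_zero]; linarith [norm_nonneg x]
  upper x := by rw [sub_zero]; linarith [norm_nonneg x]
  far x _ := rfl
  near x h := h
  norm_le := by simpa using hs
  le_halfRadius := hsW

lemma isProfile_shifted (hz : ‖z‖ = s) (hsW : s ≤ W.halfRadius / 4) :
    W.IsProfile s z (fun x => max (‖x - z‖ / 2) (min ‖x‖ (2 * max 0 (‖x‖ - s)))) where
  continuous := by fun_prop
  lower x := le_max_left _ _
  upper x := by
    have hzero := norm_nonneg (x - z)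
    have hsub : max 0 (‖x‖ - s) ≤ ‖x - z‖ := max_le hzero (hz ▸ norm_sub_norm_le x z)
    refine max_le (by linarith) ((min_le_right _ _).trans ?_)
    linarith
  far x hx := by
    have hsub := norm_sub_le x z
    have hs := norm_nonneg z
    rw [max_eq_right (by linarith : (0 : ℝ) ≤ ‖x‖ - s), min_eq_left (by linarith),
      max_eq_right (by linarith)]
  near x hx := by
    have hsub := norm_sub_le x z
    have hs := norm_nonneg z
    exact max_le (by linarith) ((min_le_left _ _).trans hx)
  norm_le := hz.le
  le_halfRadius := hsW

namespace IsProfile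

lemma nonneg (hq : W.IsProfile s z q) (x : Euc D) : 0 ≤ q x :=
  le_trans (by positivity) (hq.lower x)

lemma le_of_norm_le (hq : W.IsProfile s z q) (ht : 2 * s ≤ t) (hx : ‖x‖ ≤ t) : q x ≤ t := by
  rcases le_total (2 * s) ‖x‖ with h | h
  · rwa [hq.far x h]
  · exact (hq.near x h).trans ht

lemma two_mul_le_halfRadius (hq : W.IsProfile s z q) : 2 * s ≤ W.halfRadius := by
  linarith [hq.le_halfRadius, W.halfRadius_pos]

lemma two_mul_lt (hq : W.IsProfile s z q) : 2 * s < W.r :=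
  hq.two_mul_le_halfRadius.trans_lt W.halfRadius_lt

lemma norm_lt (hq : W.IsProfile s z q) : ‖z‖ < W.r := by
  linarith [hq.norm_le, hq.two_mul_lt, norm_nonneg z]

lemma continuous_peak (hq : W.IsProfile s z q) : Continuous (W.peak q) :=
  continuous_const.max (continuous_const.sub (continuous_const.mul
    (hq.continuous.rpow_const fun _ => Or.inr W.beta_pos.le)))

lemma peak_le (hq : W.IsProfile s z q) (x : Euc D) : W.peak q x ≤ W.lam :=
  max_le W.lam_pos.le (sub_le_self _ (W.slope_mul_rpow_nonneg (hq.nonneg x)))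

lemma peak_eq_zero (hq : W.IsProfile s z q) (hx : W.r ≤ ‖x‖) : W.peak q x = 0 := by
  refine max_eq_left (sub_nonpos.mpr ?_)
  rw [hq.far x (hq.two_mul_lt.le.trans hx)]
  exact W.slope_mul_r.symm.trans_le (W.slope_mul_rpow_mono W.r_pos.le hx)

lemma peak_eq (hq : W.IsProfile s z q) (hx : ‖x‖ ≤ W.r) :
    W.peak q x = W.lam - W.slope * q x ^ W.β := by
  refine max_eq_right (sub_nonneg.mpr ?_)
  exact (W.slope_mul_rpow_mono (hq.nonneg x) (hq.le_of_norm_le hq.two_mul_lt.le hx)).trans_eq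
    W.slope_mul_r

lemma lintegral_peak_le (hq : W.IsProfile s z q) :
    ∫⁻ x, ENNReal.ofReal (W.peak q x) ≤ ENNReal.ofReal (1 / 2) :=
  (lintegral_ofReal_le_mul_volume W.lam_pos.le W.r_pos hq.peak_le
    fun _ hx => (hq.peak_eq_zero hx.le).le).trans (ENNReal.ofReal_le_ofReal W.mass_le)

lemma ofReal_peakMass (hq : W.IsProfile s z q) :
    ENNReal.ofReal (W.peakMass q) = ∫⁻ x, ENNReal.ofReal (W.peak q x) :=
  ENNReal.ofReal_toReal (hq.lintegral_peak_le.trans_lt ENNReal.ofReal_lt_top).ne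

lemma peakMass_le (hq : W.IsProfile s z q) : W.peakMass q ≤ 1 / 2 :=
  ENNReal.toReal_le_of_le_ofReal (by norm_num) hq.lintegral_peak_le

lemma continuous_density (hq : W.IsProfile s z q) : Continuous (W.density q) :=
  hq.continuous_peak.add (continuous_const.mul W.continuous_tail)

lemma tail_div_two_le_density (hq : W.IsProfile s z q) (x : Euc D) :
    W.tail x / 2 ≤ W.density q x := by
  have hmul : 1 / 2 * W.tail x ≤ (1 - W.peakMass q) * W.tail x :=
    mul_le_mul_of_nonneg_right (by linarith [hq.peakMass_le]) (W.tail_nonneg x)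
  rw [density]
  linarith [W.peak_nonneg q x]

lemma density_nonneg (hq : W.IsProfile s z q) (x : Euc D) : 0 ≤ W.density q x :=
  (div_nonneg (W.tail_nonneg x) zero_le_two).trans (hq.tail_div_two_le_density x)

lemma lintegral_density (hq : W.IsProfile s z q) :
    ∫⁻ x, ENNReal.ofReal (W.density q x) = 1 := by
  have hrest : 0 ≤ 1 - W.peakMass q := by linarith [hq.peakMass_le]
  simp_rw [density, ENNReal.ofReal_add (W.peak_nonneg q _) (mul_nonneg hrest (W.tail_nonneg _)),
    ENNReal.ofReal_mul hrest]
  rw [lintegral_add_left hq.continuous_peak.measurable.ennreal_ofReal,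
    lintegral_const_mul _ W.continuous_tail.measurable.ennreal_ofReal, W.lintegral_tail,
    ← hq.ofReal_peakMass, mul_one, ← ENNReal.ofReal_add (W.peakMass_nonneg q) hrest,
    add_sub_cancel, ENNReal.ofReal_one]

lemma density_eq (hq : W.IsProfile s z q) (hx : ‖x‖ ≤ W.r) :
    W.density q x = W.lam - W.slope * q x ^ W.β := by
  rw [density, hq.peak_eq hx, W.tail_eq_zero x hx, mul_zero, add_zero]

lemma density_le_quarter (hq : W.IsProfile s z q) (hx : W.r ≤ ‖x‖) :
    W.density q x ≤ W.lam / 4 := by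
  rw [density, hq.peak_eq_zero hx, zero_add]
  refine (mul_le_of_le_one_left (W.tail_nonneg x) ?_).trans (W.tail_le x)
  linarith [W.peakMass_nonneg q]

lemma density_le (hq : W.IsProfile s z q) (x : Euc D) : W.density q x ≤ W.lam := by
  rcases le_total ‖x‖ W.r with h | h
  · rw [hq.density_eq h]
    exact sub_le_self _ (W.slope_mul_rpow_nonneg (hq.nonneg x))
  · linarith [hq.density_le_quarter h, W.lam_pos]

lemma norm_le_of_lt_density (hq : W.IsProfile s z q) (hx : W.lam / 4 < W.density q x) :
    ‖x‖ ≤ W.r :=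
  le_of_not_ge fun h => hx.not_ge (hq.density_le_quarter h)

lemma levelSet_top (hq : W.IsProfile s z q) : levelSet (W.density q) W.lam = {z} := by
  ext x
  rw [Set.mem_singleton_iff]
  constructor
  · intro (hx : W.lam ≤ W.density q x)
    rw [hq.density_eq (hq.norm_le_of_lt_density (by linarith [W.lam_pos]))] at hx
    by_contra hne
    have hdist : 0 < ‖x - z‖ := norm_pos_iff.mpr (sub_ne_zero.mpr hne)
    have hqx : 0 < q x := lt_of_lt_of_le (by positivity) (hq.lower x)
    linarith [mul_pos W.slope_pos (Real.rpow_pos_of_pos hqx W.β)]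
  · rintro rfl
    have hzero : q x = 0 := le_antisymm (by simpa using hq.upper x) (hq.nonneg x)
    change W.lam ≤ W.density q x
    rw [hq.density_eq hq.norm_lt.le, hzero, Real.zero_rpow W.beta_pos.ne', mul_zero, sub_zero]

lemma levelSet_half (hq : W.IsProfile s z q) :
    levelSet (W.density q) (W.lam / 2) = Metric.closedBall 0 W.halfRadius := by
  ext x
  rw [Metric.mem_closedBall, dist_zero_right]
  constructor
  · intro (hx : W.lam / 2 ≤ W.density q x)
    rw [hq.density_eq (hq.norm_le_of_lt_density (by linarith [W.lam_pos]))] at hx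
    by_contra! hlt
    rw [hq.far x (hq.two_mul_le_halfRadius.trans hlt.le)] at hx
    linarith [W.slope_mul_rpow_strictMono W.halfRadius_pos.le hlt, W.slope_mul_halfRadius]
  · intro hx
    change W.lam / 2 ≤ W.density q x
    rw [hq.density_eq (hx.trans W.halfRadius_lt.le)]
    linarith [W.slope_mul_rpow_mono (hq.nonneg x) (hq.le_of_norm_le hq.two_mul_le_halfRadius hx),
      W.slope_mul_halfRadius]

lemma levelComponents_top (hq : W.IsProfile s z q) :
    levelComponents (W.density q) W.lam = {{z}} := by
  have h := hq.levelSet_top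
  rw [levelComponents_of_isPreconnected (h ▸ isPreconnected_singleton)
    (h ▸ Set.singleton_nonempty z), h]

lemma levelComponents_half (hq : W.IsProfile s z q) :
    levelComponents (W.density q) (W.lam / 2) = {Metric.closedBall 0 W.halfRadius} := by
  have h := hq.levelSet_half
  rw [levelComponents_of_isPreconnected (h ▸ (convex_closedBall _ _).isPreconnected)
    (h ▸ Metric.nonempty_closedBall.mpr W.halfRadius_pos.le), h]

lemma cthickening_subset (hq : W.IsProfile s z q) :
    Metric.cthickening W.params.rc {z} ⊆ Metric.closedBall 0 W.halfRadius := by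
  rw [Metric.cthickening_singleton z W.params.rc_pos.le]
  refine Metric.closedBall_subset_closedBall' ?_
  rw [dist_zero_right]
  change W.halfRadius / 4 + ‖z‖ ≤ W.halfRadius
  linarith [hq.norm_le, hq.le_halfRadius, W.halfRadius_pos]

lemma falloff (hq : W.IsProfile s z q) (hx : ‖x‖ ≤ W.r) :
    W.params.cLow * ‖x - z‖ ^ W.β ≤ W.lam - W.density q x ∧
      W.lam - W.density q x ≤ W.params.cUp * ‖x - z‖ ^ W.β := by
  rw [hq.density_eq hx, sub_sub_cancel]
  constructor
  · calc W.slope / 2 ^ W.β * ‖x - z‖ ^ W.β = W.slope * (‖x - z‖ / 2) ^ W.β := by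
          rw [Real.div_rpow (norm_nonneg _) zero_le_two]
          ring
      _ ≤ W.slope * q x ^ W.β := W.slope_mul_rpow_mono (by positivity) (hq.lower x)
  · calc W.slope * q x ^ W.β ≤ W.slope * (2 * ‖x - z‖) ^ W.β :=
          W.slope_mul_rpow_mono (hq.nonneg x) (hq.upper x)
      _ = W.slope * 2 ^ W.β * ‖x - z‖ ^ W.β := by
          rw [Real.mul_rpow zero_le_two (norm_nonneg _)]
          ring

lemma separatedBy_empty (hq : W.IsProfile s z q) (r : ℝ) :
    SeparatedBy (W.density q) r (Metric.closedBall 0 W.halfRadius)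
      (levelSet (W.density q) (W.lam / 2) \ Metric.closedBall 0 W.halfRadius) ∅ := by
  rw [hq.levelSet_half, sdiff_self]
  refine ⟨fun x _ y hy => absurd hy (Set.notMem_empty y), ?_⟩
  have hinf : ((W.lam / 2 : ℝ) : EReal) ≤
      ⨅ x ∈ Metric.closedBall 0 W.halfRadius ∪ ∅, (W.density q x : EReal) := by
    refine le_iInf₂ fun x hx => EReal.coe_le_coe_iff.mpr ?_
    rw [Set.union_empty, ← hq.levelSet_half] at hx
    exact hx
  refine lt_of_lt_of_le ?_ hinf
  simp

theorem admissible (hq : W.IsProfile s z q) : Admissible W.params W.lam (W.density q) where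
  continuous := hq.continuous_density
  nonneg := hq.density_nonneg
  le_fmax := hq.density_le
  lintegral_eq_one := hq.lintegral_density
  lam0_lt := half_lt_self W.lam_pos
  separation := by
    rw [hq.levelComponents_top]
    rintro _ rfl
    refine ⟨Metric.closedBall 0 W.halfRadius, hq.levelComponents_half.ge rfl,
      fun C' hC' hne => absurd hC' hne, ⟨∅, hq.separatedBy_empty _⟩, hq.cthickening_subset,
      fun x hx => ?_⟩
    have hball := mem_closedBall_zero_iff.mp (hq.cthickening_subset hx.1)
    rw [Metric.infDist_singleton, dist_eq_norm]
    exact hq.falloff (hball.trans W.halfRadius_lt.le)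

theorem le_gap (hq : W.IsProfile s z q) :
    min (3 * W.lam / 4) (W.slope * (W.halfRadius / 8) ^ W.β) ≤
      gap (W.density q) W.lam W.params.rc := by
  set γ := min (3 * W.lam / 4) (W.slope * (W.halfRadius / 8) ^ W.β)
  have hγtail : γ ≤ 3 * W.lam / 4 := min_le_left _ _
  have hγpeak : γ ≤ W.slope * (W.halfRadius / 8) ^ W.β := min_le_right _ _
  refine le_sub_comm.mpr (Real.sSup_le ?_ (by linarith [W.lam_pos]))
  rintro _ ⟨x, hx, rfl⟩
  rw [hq.levelComponents_top, Set.biUnion_singleton] at hx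
  rcases le_total ‖x‖ W.r with h | h
  · have hdist : W.halfRadius / 4 < ‖x - z‖ := by
      rw [← dist_eq_norm]
      exact lt_of_not_ge fun hle => hx (Metric.mem_cthickening_of_dist_le x z _ _ rfl hle)
    have hmono := W.slope_mul_rpow_mono (by linarith [W.halfRadius_pos])
      (by linarith [hq.lower x] : W.halfRadius / 8 ≤ q x)
    rw [hq.density_eq h]
    linarith
  · linarith [hq.density_le_quarter h]

end IsProfile

end PeakData

end Construction

section LowerBound

lemma edist_le_hausdorffEDist_add {α : Type*} [PseudoEMetricSpace α] (x y : α) (T : Set α) :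
    edist x y ≤ Metric.hausdorffEDist {x} T + Metric.hausdorffEDist {y} T := by
  calc edist x y = Metric.infEDist x {y} := Metric.infEDist_singleton.symm
    _ ≤ Metric.hausdorffEDist {x} {y} :=
        Metric.infEDist_le_hausdorffEDist_of_mem (Set.mem_singleton x)
    _ ≤ Metric.hausdorffEDist {x} T + Metric.hausdorffEDist T {y} :=
        Metric.hausdorffEDist_triangle
    _ = _ := by rw [Metric.hausdorffEDist_comm (s := T)]

variable {D : ℕ}

namespace PeakData

variable {W : PeakData D} {s : ℝ} {z z' x : Euc D} {q q' : Euc D → ℝ}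

/-- The bound `κ (2 s)^β` on the change of the peak when the profile changes. -/
noncomputable def peakChange (W : PeakData D) (s : ℝ) : ℝ := W.slope * (2 * s) ^ W.β

/-- The bound on the change of the mass of the peak when the profile changes. -/
noncomputable def massChange (W : PeakData D) (s : ℝ) : ℝ :=
  W.peakChange s * (unitBallVol D * (2 * s) ^ D)

/-- A weight `w` with `(f' - f)² ≤ w f` for two densities `f`, `f'` with profiles at scale `s`: its
two terms account for the change of the peak and for that of the tail. -/
noncomputable def chiSqWeight (W : PeakData D) (s : ℝ) (x : Euc D) : ℝ :=
  (Metric.closedBall (0 : Euc D) (2 * s)).indicator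
    (fun _ => 2 / W.lam * W.peakChange s ^ 2) x + 2 * W.massChange s ^ 2 * W.tail x

/-- A bound on the integral of `chiSqWeight`, hence on the `χ²`-divergence of the two densities. -/
noncomputable def chiSqBound (W : PeakData D) (s : ℝ) : ℝ :=
  2 / W.lam * W.peakChange s ^ 2 * (unitBallVol D * (2 * s) ^ D) + 2 * W.massChange s ^ 2

lemma peakChange_nonneg (W : PeakData D) (hs : 0 ≤ s) : 0 ≤ W.peakChange s :=
  W.slope_mul_rpow_nonneg (by positivity)

lemma peakWeight_nonneg (W : PeakData D) (s : ℝ) : 0 ≤ 2 / W.lam * W.peakChange s ^ 2 :=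
  mul_nonneg (div_nonneg zero_le_two W.lam_pos.le) (sq_nonneg _)

lemma indicator_peakWeight_nonneg (W : PeakData D) (s : ℝ) (x : Euc D) :
    0 ≤ (Metric.closedBall (0 : Euc D) (2 * s)).indicator
      (fun _ => 2 / W.lam * W.peakChange s ^ 2) x :=
  Set.indicator_nonneg (fun _ _ => W.peakWeight_nonneg s) x

lemma tailWeight_nonneg (W : PeakData D) (s : ℝ) (x : Euc D) :
    0 ≤ 2 * W.massChange s ^ 2 * W.tail x :=
  mul_nonneg (by positivity) (W.tail_nonneg x)

lemma chiSqWeight_nonneg (W : PeakData D) (s : ℝ) (x : Euc D) : 0 ≤ W.chiSqWeight s x :=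
  add_nonneg (W.indicator_peakWeight_nonneg s x) (W.tailWeight_nonneg s x)

lemma chiSqBound_nonneg (W : PeakData D) (hs : 0 ≤ s) : 0 ≤ W.chiSqBound s := by
  have := unitBallVol_pos D
  exact add_nonneg (mul_nonneg (W.peakWeight_nonneg s) (by positivity)) (by positivity)

lemma lintegral_chiSqWeight_le (W : PeakData D) (hs : 0 < s) :
    ∫⁻ x, ENNReal.ofReal (W.chiSqWeight s x) ≤ ENNReal.ofReal (W.chiSqBound s) := by
  have hv := unitBallVol_pos D
  have hball := W.peakWeight_nonneg s
  simp_rw [chiSqWeight, ENNReal.ofReal_add (W.indicator_peakWeight_nonneg s _)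
    (W.tailWeight_nonneg s _), ENNReal.ofReal_mul (by positivity : 0 ≤ 2 * W.massChange s ^ 2)]
  rw [lintegral_add_right _ (W.continuous_tail.measurable.ennreal_ofReal.const_mul _),
    lintegral_const_mul _ W.continuous_tail.measurable.ennreal_ofReal, W.lintegral_tail, mul_one,
    chiSqBound, ENNReal.ofReal_add (mul_nonneg hball (by positivity)) (by positivity)]
  gcongr
  refine lintegral_ofReal_le_mul_volume hball (by positivity)
    (fun x => Set.indicator_le_self' (fun _ _ => hball) x) fun x hx => ?_
  rw [Set.indicator_of_notMem]
  rwa [Metric.mem_closedBall, dist_zero_right, not_le]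

/-- The constant `K` for which the `χ²`-divergence at scale `s` is at most `K (2 s)^(2β+D)`. -/
noncomputable def chiSqConst (W : PeakData D) : ℝ :=
  2 / W.lam * W.slope ^ 2 * unitBallVol D + 2 * W.slope ^ 2 * unitBallVol D ^ 2

lemma chiSqConst_pos (W : PeakData D) : 0 < W.chiSqConst := by
  have := W.lam_pos
  have := W.slope_pos
  have := unitBallVol_pos D
  unfold chiSqConst
  positivity

lemma chiSqBound_le (W : PeakData D) (hs0 : 0 < s) (hs1 : 2 * s ≤ 1) :
    W.chiSqBound s ≤ W.chiSqConst * (2 * s) ^ (2 * W.β + D) := by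
  have := W.lam_pos
  have hκ := W.slope_pos
  have hv := unitBallVol_pos D
  have hpow : (2 * s) ^ (2 * W.β + D) = ((2 * s) ^ W.β) ^ 2 * (2 * s) ^ D := by
    rw [Real.rpow_add (by positivity), Real.rpow_natCast, mul_comm 2 W.β,
      Real.rpow_mul (by positivity), Real.rpow_two]
  have hvol : (2 * s) ^ D * (2 * s) ^ D ≤ (2 * s) ^ D :=
    mul_le_of_le_one_right (by positivity) (pow_le_one₀ (by positivity) hs1)
  calc W.chiSqBound s = 2 / W.lam * W.slope ^ 2 * unitBallVol D *
        (((2 * s) ^ W.β) ^ 2 * (2 * s) ^ D) + 2 * W.slope ^ 2 * unitBallVol D ^ 2 *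
        ((2 * s) ^ W.β) ^ 2 * ((2 * s) ^ D * (2 * s) ^ D) := by
        rw [chiSqBound, massChange, peakChange]
        ring
    _ ≤ 2 / W.lam * W.slope ^ 2 * unitBallVol D * (((2 * s) ^ W.β) ^ 2 * (2 * s) ^ D) +
        2 * W.slope ^ 2 * unitBallVol D ^ 2 * ((2 * s) ^ W.β) ^ 2 * (2 * s) ^ D := by gcongr
    _ = W.chiSqConst * (2 * s) ^ (2 * W.β + D) := by
        rw [chiSqConst, hpow]
        ring

namespace IsProfile

lemma peak_eq_of_far (hq : W.IsProfile s z q) (hq' : W.IsProfile s z' q') (hx : 2 * s ≤ ‖x‖) :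
    W.peak q x = W.peak q' x := by
  rw [peak, peak, hq.far x hx, hq'.far x hx]

lemma peak_sub_le (hq : W.IsProfile s z q) (hq' : W.IsProfile s z' q') (hx : ‖x‖ ≤ 2 * s) :
    W.peak q x - W.peak q' x ≤ W.peakChange s := by
  have hxr : ‖x‖ ≤ W.r := hx.trans hq.two_mul_lt.le
  rw [hq.peak_eq hxr, hq'.peak_eq hxr, peakChange]
  linarith [W.slope_mul_rpow_nonneg (hq.nonneg x),
    W.slope_mul_rpow_mono (hq'.nonneg x) (hq'.near x hx)]

lemma peakMass_sub_le (hq : W.IsProfile s z q) (hq' : W.IsProfile s z' q') (hs : 0 < s) :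
    W.peakMass q - W.peakMass q' ≤ W.massChange s := by
  have hv := unitBallVol_pos D
  have hchange := W.peakChange_nonneg hs.le
  have hmass : 0 ≤ W.massChange s := mul_nonneg hchange (by positivity)
  rw [sub_le_iff_le_add', ← ENNReal.ofReal_le_ofReal_iff (add_nonneg (W.peakMass_nonneg q') hmass)]
  calc ENNReal.ofReal (W.peakMass q) = ∫⁻ x, ENNReal.ofReal (W.peak q x) := hq.ofReal_peakMass
    _ ≤ ∫⁻ x, (ENNReal.ofReal (W.peak q' x) + ENNReal.ofReal (W.peak q x - W.peak q' x)) := by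
        refine lintegral_mono fun x => le_trans (le_of_eq ?_) ENNReal.ofReal_add_le
        rw [add_sub_cancel]
    _ = ENNReal.ofReal (W.peakMass q') + ∫⁻ x, ENNReal.ofReal (W.peak q x - W.peak q' x) := by
        rw [lintegral_add_left hq'.continuous_peak.measurable.ennreal_ofReal, hq'.ofReal_peakMass]
    _ ≤ ENNReal.ofReal (W.peakMass q') + ENNReal.ofReal (W.massChange s) := by
        gcongr
        refine lintegral_ofReal_le_mul_volume hchange (by positivity) (fun x => ?_)
          fun x hx => (sub_eq_zero.mpr (hq.peak_eq_of_far hq' hx.le)).le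
        rcases le_total ‖x‖ (2 * s) with hx | hx
        · exact hq.peak_sub_le hq' hx
        · rwa [hq.peak_eq_of_far hq' hx, sub_self]
    _ = ENNReal.ofReal (W.peakMass q' + W.massChange s) :=
        (ENNReal.ofReal_add (W.peakMass_nonneg q') hmass).symm

lemma half_le_density (hq : W.IsProfile s z q) (hx : ‖x‖ ≤ 2 * s) :
    W.lam / 2 ≤ W.density q x := by
  have : x ∈ levelSet (W.density q) (W.lam / 2) := by
    rw [hq.levelSet_half, mem_closedBall_zero_iff]
    exact hx.trans hq.two_mul_le_halfRadius
  exact this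

lemma density_sub_sq_le_of_near (hq : W.IsProfile s z q) (hq' : W.IsProfile s z' q')
    (hx : ‖x‖ ≤ 2 * s) :
    (W.density q' x - W.density q x) ^ 2 ≤ 2 / W.lam * W.peakChange s ^ 2 * W.density q x := by
  have hlam := W.lam_pos
  have htail := W.tail_eq_zero x (hx.trans hq.two_mul_lt.le)
  have hsub : W.density q' x - W.density q x = W.peak q' x - W.peak q x := by
    rw [density, density, htail]
    ring
  calc (W.density q' x - W.density q x) ^ 2 ≤ W.peakChange s ^ 2 := by
        rw [hsub]
        exact sq_le_sq' (by linarith [hq.peak_sub_le hq' hx]) (hq'.peak_sub_le hq hx)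
    _ = 2 / W.lam * W.peakChange s ^ 2 * (W.lam / 2) := by field_simp
    _ ≤ 2 / W.lam * W.peakChange s ^ 2 * W.density q x := by
        gcongr
        exact hq.half_le_density hx

lemma density_sub_sq_le_of_far (hq : W.IsProfile s z q) (hq' : W.IsProfile s z' q') (hs : 0 < s)
    (hx : 2 * s ≤ ‖x‖) :
    (W.density q' x - W.density q x) ^ 2 ≤ 2 * W.massChange s ^ 2 * W.tail x * W.density q x := by
  have hsq : (W.peakMass q - W.peakMass q') ^ 2 ≤ W.massChange s ^ 2 :=
    sq_le_sq' (by linarith [hq'.peakMass_sub_le hq hs]) (hq.peakMass_sub_le hq' hs)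
  calc (W.density q' x - W.density q x) ^ 2 =
        (W.peakMass q - W.peakMass q') ^ 2 * W.tail x ^ 2 := by
        rw [density, density, hq.peak_eq_of_far hq' hx]
        ring
    _ ≤ W.massChange s ^ 2 * W.tail x ^ 2 := by gcongr
    _ = 2 * W.massChange s ^ 2 * W.tail x * (W.tail x / 2) := by ring
    _ ≤ 2 * W.massChange s ^ 2 * W.tail x * W.density q x :=
        mul_le_mul_of_nonneg_left (hq.tail_div_two_le_density x) (W.tailWeight_nonneg s x)

lemma density_sub_sq_le (hq : W.IsProfile s z q) (hq' : W.IsProfile s z' q') (hs : 0 < s)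
    (x : Euc D) :
    (W.density q' x - W.density q x) ^ 2 ≤ W.chiSqWeight s x * W.density q x := by
  rcases le_total ‖x‖ (2 * s) with hx | hx
  · refine (hq.density_sub_sq_le_of_near hq' hx).trans
      (mul_le_mul_of_nonneg_right ?_ (hq.density_nonneg x))
    rw [chiSqWeight, Set.indicator_of_mem (mem_closedBall_zero_iff.mpr hx)]
    exact le_add_of_nonneg_right (W.tailWeight_nonneg s x)
  · refine (hq.density_sub_sq_le_of_far hq' hs hx).trans
      (mul_le_mul_of_nonneg_right ?_ (hq.density_nonneg x))
    exact le_add_of_nonneg_left (W.indicator_peakWeight_nonneg s x)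

theorem one_quarter_le_sampleLaw_or (hq : W.IsProfile s z q) (hq' : W.IsProfile s z' q')
    (hs : 0 < s) {n : ℕ} (hn : n * W.chiSqBound s ≤ 1 / 2) {E₀ E₁ : Set (Fin n → Euc D)}
    (hE : E₀ ∪ E₁ = Set.univ) :
    1 / 4 ≤ sampleLaw (W.density q) n E₀ ∨ 1 / 4 ≤ sampleLaw (W.density q') n E₁ :=
  LevelSetDBSCAN.one_quarter_le_sampleLaw_or hq.continuous_density.measurable
    hq'.continuous_density.measurable hq.density_nonneg hq'.density_nonneg hq.lintegral_density
    hq'.lintegral_density (W.chiSqWeight_nonneg s) (hq.density_sub_sq_le hq' hs)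
    (W.chiSqBound_nonneg hs.le) (W.lintegral_chiSqWeight_le hs) hn hE

end IsProfile

theorem exists_isProfile_one_quarter_le (W : PeakData D) (hD : 1 ≤ D) (hs : 0 < s)
    (hsW : s ≤ W.halfRadius / 4) {n : ℕ} (hn : n * W.chiSqBound s ≤ 1 / 2)
    (T : (Fin n → Euc D) → Set (Euc D)) :
    ∃ z q, W.IsProfile s z q ∧ 1 / 4 ≤ sampleLaw (W.density q) n
      {X | ENNReal.ofReal (s / 3) < Metric.hausdorffEDist {z} (T X)} := by
  obtain ⟨z, hz⟩ := exists_norm_eq_of_one_le hD hs.le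
  have hq := isProfile_norm hs.le hsW
  have hq' := isProfile_shifted hz hsW
  have hE : {X | ENNReal.ofReal (s / 3) < Metric.hausdorffEDist {(0 : Euc D)} (T X)} ∪
      {X | ENNReal.ofReal (s / 3) < Metric.hausdorffEDist {z} (T X)} = Set.univ := by
    refine Set.eq_univ_of_forall fun X => ?_
    by_contra hX
    simp only [Set.mem_union, Set.mem_ofPred_eq, not_or, not_lt] at hX
    have hdist := (edist_le_hausdorffEDist_add 0 z (T X)).trans (add_le_add hX.1 hX.2)
    rw [edist_dist, dist_zero_left, hz, ← ENNReal.ofReal_add (by positivity) (by positivity),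
      ENNReal.ofReal_le_ofReal_iff (by positivity)] at hdist
    linarith
  rcases hq.one_quarter_le_sampleLaw_or hq' hs hn hE with h | h
  · exact ⟨0, _, hq, h⟩
  · exact ⟨z, _, hq', h⟩

end PeakData

lemma exists_pos_le_mul_rpow_le {t K p : ℝ} (ht : 0 < t) (hK : 0 < K) (hp : 0 < p) :
    ∃ y : ℝ, 0 < y ∧ y ≤ t ∧ K * y ^ p ≤ 1 / 2 := by
  refine ⟨min t ((1 / (2 * K)) ^ (1 / p)), lt_min ht (by positivity), min_le_left _ _, ?_⟩
  calc K * min t ((1 / (2 * K)) ^ (1 / p)) ^ p ≤ K * ((1 / (2 * K)) ^ (1 / p)) ^ p := by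
        gcongr
        exact min_le_right _ _
    _ = K * (1 / (2 * K)) := by
        rw [← Real.rpow_mul (by positivity), one_div_mul_cancel hp.ne', Real.rpow_one]
    _ = 1 / 2 := by field_simp

theorem exists_minimax_lower_bound (hD : 1 ≤ D) {β lam : ℝ} (hβ : 0 < β) (hlam : 0 < lam) :
    ∃ (P : Params) (γ c : ℝ), P.beta = β ∧ 0 < γ ∧ 0 < c ∧
      ∀ n : ℕ, 1 ≤ n → ∀ T : (Fin n → Euc D) → Set (Euc D),
        ∃ (f : Euc D → ℝ) (C : Set (Euc D)),
          Admissible P lam f ∧ γ ≤ gap f lam P.rc ∧ levelComponents f lam = {C} ∧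
          1 / 4 ≤ sampleLaw f n {X | ENNReal.ofReal (c * (n : ℝ) ^ (-(1 / (2 * β + D)))) <
            Metric.hausdorffEDist C (T X)} := by
  obtain ⟨W, rfl, rfl⟩ := exists_peakData hD hβ hlam
  have hhalf := W.halfRadius_pos
  have hp : 0 < 2 * W.β + D := by positivity
  obtain ⟨y, hy0, hyt, hyK⟩ :=
    exists_pos_le_mul_rpow_le (lt_min one_pos (half_pos hhalf)) W.chiSqConst_pos hp
  have hy1 : y ≤ 1 := hyt.trans (min_le_left _ _)
  have hy2 : y ≤ W.halfRadius / 2 := hyt.trans (min_le_right _ _)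
  refine ⟨W.params, min (3 * W.lam / 4) (W.slope * (W.halfRadius / 8) ^ W.β), y / 6, rfl,
    lt_min (by positivity) (mul_pos W.slope_pos (by positivity)), by positivity, fun n hn T => ?_⟩
  have hn1 : (1 : ℝ) ≤ n := by exact_mod_cast hn
  have hn0 : (0 : ℝ) < n := by linarith
  set τ := (n : ℝ) ^ (-(1 / (2 * W.β + D)))
  have hτ0 : 0 < τ := by positivity
  have hτ1 : τ ≤ 1 :=
    Real.rpow_le_one_of_one_le_of_nonpos hn1 (neg_nonpos.mpr (one_div_pos.mpr hp).le)
  have hτp : τ ^ (2 * W.β + D) = (n : ℝ)⁻¹ := by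
    rw [← Real.rpow_mul hn0.le, neg_mul, one_div_mul_cancel hp.ne', Real.rpow_neg_one]
  have hyτ : y * τ ≤ y := mul_le_of_le_one_right hy0.le hτ1
  have hχ : n * W.chiSqBound (y * τ / 2) ≤ 1 / 2 :=
    calc n * W.chiSqBound (y * τ / 2) ≤ n * (W.chiSqConst * (y * τ) ^ (2 * W.β + D)) := by
          have := W.chiSqBound_le (s := y * τ / 2) (by positivity) (by linarith)
          rw [mul_div_cancel₀ _ two_ne_zero] at this
          gcongr
      _ = W.chiSqConst * y ^ (2 * W.β + D) := by
          rw [Real.mul_rpow hy0.le hτ0.le, hτp]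
          field_simp
      _ ≤ 1 / 2 := hyK
  obtain ⟨z, q, hq, hprob⟩ :=
    W.exists_isProfile_one_quarter_le hD (by positivity) (by linarith) hχ T
  rw [show y * τ / 2 / 3 = y / 6 * τ by ring] at hprob
  exact ⟨W.density q, {z}, hq.admissible, hq.le_gap, hq.levelComponents_top, hprob⟩

end LowerBound

theorem mainTheorem4_general :
    (∃ C₀ : ℝ, 0 < C₀ ∧ ∀ (D : ℕ), 1 ≤ D → ∀ (δ : ℝ), 0 < δ → δ < 1 →
      ∀ P : Params,
      (∃ Kl Ku : ℝ, 0 < Kl ∧ 0 < Ku ∧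
        ∀ (lam : ℝ) (f : Euc D → ℝ), LevelRegular P lam f →
        ∀ n k : ℕ, 2 ≤ n → InRange Kl Ku P.beta 2 D n k →
          sampleLaw f n {X | ¬ AllRecovered
            (levelComponents f lam) (estClusters C₀ δ lam k X)
            (errBound C₀ δ lam P D n k)} ≤ ENNReal.ofReal δ) ∧
      (∀ γ : ℝ, 0 < γ → ∃ Kl Ku : ℝ, 0 < Kl ∧ 0 < Ku ∧
        ∀ (lam : ℝ) (f : Euc D → ℝ), LevelRegular P lam f →
        γ ≤ gap f lam P.rc →
        ∀ n k : ℕ, 2 ≤ n → InRange Kl Ku P.beta 3 D n k →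
          sampleLaw f n {X | ¬ NoFalseCluster
            (levelComponents f lam) (prunedClusters C₀ δ lam k X)
            (errBound C₀ δ lam P D n k)} ≤ ENNReal.ofReal δ) ∧
      (∀ a₁ a₂ : ℝ, 0 < a₁ → ∃ (N : ℕ) (R : ℝ), 0 < R ∧
        ∀ (lam : ℝ) (f : Euc D → ℝ), LevelRegular P lam f →
        ∀ n k : ℕ, N ≤ n →
          a₁ * (n : ℝ) ^ (2 * P.beta / (2 * P.beta + D)) ≤ k →
          (k : ℝ) ≤ a₂ * (n : ℝ) ^ (2 * P.beta / (2 * P.beta + D)) →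
          sampleLaw f n {X | ¬ AllRecovered
            (levelComponents f lam) (estClusters C₀ δ lam k X)
            (R * Real.log n ^ (1 / P.beta) * (n : ℝ) ^ (-(1 / (2 * P.beta + D))))}
              ≤ ENNReal.ofReal δ) ∧
      (∀ γ a₁ a₂ : ℝ, 0 < γ → 0 < a₁ → ∃ (N : ℕ) (R : ℝ), 0 < R ∧
        ∀ (lam : ℝ) (f : Euc D → ℝ), LevelRegular P lam f →
        γ ≤ gap f lam P.rc →
        ∀ n k : ℕ, N ≤ n →
          a₁ * (n : ℝ) ^ (2 * P.beta / (2 * P.beta + D)) ≤ k →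
          (k : ℝ) ≤ a₂ * (n : ℝ) ^ (2 * P.beta / (2 * P.beta + D)) →
          sampleLaw f n {X | ¬ NoFalseCluster
            (levelComponents f lam) (prunedClusters C₀ δ lam k X)
            (R * Real.log n ^ (1 / P.beta) * (n : ℝ) ^ (-(1 / (2 * P.beta + D))))}
              ≤ ENNReal.ofReal δ)) ∧
    (∀ (D : ℕ) (lam r : ℝ) (f : Euc D → ℝ), 0 < lam → 0 < r → Continuous f →
      Tendsto f (cocompact (Euc D)) (𝓝 0) → 0 < gap f lam r) ∧
    (∀ (D : ℕ), 1 ≤ D → ∀ (β lam : ℝ), 0 < β → 0 < lam →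
      ∃ (P : Params) (γ c : ℝ), P.beta = β ∧ 0 < γ ∧ 0 < c ∧
        ∀ n : ℕ, 1 ≤ n → ∀ T : (Fin n → Euc D) → Set (Euc D),
          ∃ (f : Euc D → ℝ) (C : Set (Euc D)),
            Admissible P lam f ∧ γ ≤ gap f lam P.rc ∧
            levelComponents f lam = {C} ∧
            1 / 4 ≤ sampleLaw f n {X |
              ENNReal.ofReal (c * (n : ℝ) ^ (-(1 / (2 * β + D)))) <
                Metric.hausdorffEDist C (T X)}) := by
  refine ⟨⟨10, by norm_num, fun D hD δ hδ hδ1 P => ⟨?_, ?_, ?_, ?_⟩⟩, ?_, ?_⟩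
  · exact exists_allRecovered hD hδ hδ1 P
  · exact fun γ hγ => exists_noFalseCluster hD hδ hδ1 P hγ
  · exact fun a₁ a₂ ha₁ => exists_allRecovered_rate hD hδ hδ1 P ha₁ a₂
  · exact fun γ a₁ a₂ hγ ha₁ => exists_noFalseCluster_rate hD hδ hδ1 P hγ ha₁ a₂
  · exact fun D lam r f hlam hr hf h0 => gap_pos hf h0 hlam hr
  · exact fun D hD β lam hβ hlam => exists_minimax_lower_bound hD hβ hlam

end LevelSetDBSCAN

theorem mainTheorem4 :
    -- upper bounds; `C₀` is a universal constant
    (∃ C₀ : ℝ, 0 < C₀ ∧ ∀ (D : ℕ), 1 ≤ D → ∀ (δ : ℝ), 0 < δ → δ < 1 →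
      ∀ P : LevelSetDBSCAN.Params,
      -- Hausdorff error
      (∃ Kl Ku : ℝ, 0 < Kl ∧ 0 < Ku ∧
        ∀ (lam : ℝ) (f : LevelSetDBSCAN.Euc D → ℝ), LevelSetDBSCAN.Admissible P lam f →
        ∀ n k : ℕ, 2 ≤ n → LevelSetDBSCAN.InRange Kl Ku P.beta 2 D n k →
          LevelSetDBSCAN.sampleLaw f n {X | ¬ LevelSetDBSCAN.AllRecovered
            (LevelSetDBSCAN.levelComponents f lam) (LevelSetDBSCAN.estClusters C₀ δ lam k X)
            (LevelSetDBSCAN.errBound C₀ δ lam P D n k)} ≤ ENNReal.ofReal δ) ∧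
      -- removal of false clusters
      (∀ γ : ℝ, 0 < γ → ∃ Kl Ku : ℝ, 0 < Kl ∧ 0 < Ku ∧
        ∀ (lam : ℝ) (f : LevelSetDBSCAN.Euc D → ℝ), LevelSetDBSCAN.Admissible P lam f →
        γ ≤ LevelSetDBSCAN.gap f lam P.rc →
        ∀ n k : ℕ, 2 ≤ n → LevelSetDBSCAN.InRange Kl Ku P.beta 3 D n k →
          LevelSetDBSCAN.sampleLaw f n {X | ¬ LevelSetDBSCAN.NoFalseCluster
            (LevelSetDBSCAN.levelComponents f lam) (LevelSetDBSCAN.prunedClusters C₀ δ lam k X)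
            (LevelSetDBSCAN.errBound C₀ δ lam P D n k)} ≤ ENNReal.ofReal δ) ∧
      -- rate for `k ≈ n^{2β/(2β+D)}`, for every true cluster
      (∀ a₁ a₂ : ℝ, 0 < a₁ → 0 < a₂ → ∃ (N : ℕ) (R : ℝ), 0 < R ∧
        ∀ (lam : ℝ) (f : LevelSetDBSCAN.Euc D → ℝ), LevelSetDBSCAN.Admissible P lam f →
        ∀ n k : ℕ, N ≤ n →
          a₁ * (n : ℝ) ^ (2 * P.beta / (2 * P.beta + D)) ≤ k →
          (k : ℝ) ≤ a₂ * (n : ℝ) ^ (2 * P.beta / (2 * P.beta + D)) →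
          LevelSetDBSCAN.sampleLaw f n {X | ¬ LevelSetDBSCAN.AllRecovered
            (LevelSetDBSCAN.levelComponents f lam) (LevelSetDBSCAN.estClusters C₀ δ lam k X)
            (R * Real.log n ^ (1 / P.beta) * (n : ℝ) ^ (-(1 / (2 * P.beta + D))))}
              ≤ ENNReal.ofReal δ) ∧
      -- rate for `k ≈ n^{2β/(2β+D)}`, for every cluster that survives the pruning
      (∀ γ a₁ a₂ : ℝ, 0 < γ → 0 < a₁ → 0 < a₂ → ∃ (N : ℕ) (R : ℝ), 0 < R ∧
        ∀ (lam : ℝ) (f : LevelSetDBSCAN.Euc D → ℝ), LevelSetDBSCAN.Admissible P lam f →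
        γ ≤ LevelSetDBSCAN.gap f lam P.rc →
        ∀ n k : ℕ, N ≤ n →
          a₁ * (n : ℝ) ^ (2 * P.beta / (2 * P.beta + D)) ≤ k →
          (k : ℝ) ≤ a₂ * (n : ℝ) ^ (2 * P.beta / (2 * P.beta + D)) →
          LevelSetDBSCAN.sampleLaw f n {X | ¬ LevelSetDBSCAN.NoFalseCluster
            (LevelSetDBSCAN.levelComponents f lam) (LevelSetDBSCAN.prunedClusters C₀ δ lam k X)
            (R * Real.log n ^ (1 / P.beta) * (n : ℝ) ^ (-(1 / (2 * P.beta + D))))}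
              ≤ ENNReal.ofReal δ)) ∧
    -- the gap is positive for densities vanishing at infinity
    (∀ (D : ℕ), 1 ≤ D → ∀ (P : LevelSetDBSCAN.Params) (lam : ℝ) (f : LevelSetDBSCAN.Euc D → ℝ),
      LevelSetDBSCAN.Admissible P lam f → Tendsto f (cocompact (LevelSetDBSCAN.Euc D)) (𝓝 0) →
      0 < LevelSetDBSCAN.gap f lam P.rc) ∧
    -- minimax lower bound: no estimator beats the rate `n^{-1/(2β+D)}`
    (∀ (D : ℕ), 1 ≤ D → ∀ (β lam : ℝ), 0 < β → 0 < lam →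
      ∃ (P : LevelSetDBSCAN.Params) (γ c : ℝ), P.beta = β ∧ 0 < γ ∧ 0 < c ∧
        ∀ n : ℕ, 1 ≤ n → ∀ T : (Fin n → LevelSetDBSCAN.Euc D) → Set (LevelSetDBSCAN.Euc D),
          ∃ (f : LevelSetDBSCAN.Euc D → ℝ) (C : Set (LevelSetDBSCAN.Euc D)),
            LevelSetDBSCAN.Admissible P lam f ∧ γ ≤ LevelSetDBSCAN.gap f lam P.rc ∧
            LevelSetDBSCAN.levelComponents f lam = {C} ∧
            1 / 4 ≤ LevelSetDBSCAN.sampleLaw f n {X |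
              ENNReal.ofReal (c * (n : ℝ) ^ (-(1 / (2 * β + D)))) <
                Metric.hausdorffEDist C (T X)}) := by
  obtain ⟨⟨C₀, hC₀, hupper⟩, hgap, hlower⟩ := LevelSetDBSCAN.mainTheorem4_general
  refine ⟨⟨C₀, hC₀, fun D hD δ hδ hδ1 P => ?_⟩, fun D _ P lam f hf =>
    hgap D lam P.rc f hf.levelRegular.lam_pos P.rc_pos hf.continuous, hlower⟩
  obtain ⟨⟨Kl, Ku, hKl, hKu, hrec⟩, hprune, hrecRate, hpruneRate⟩ := hupper D hD δ hδ hδ1 P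
  refine ⟨⟨Kl, Ku, hKl, hKu, fun lam f hf => hrec lam f hf.levelRegular⟩,
    fun γ hγ => ?_, fun a₁ a₂ ha₁ _ => ?_, fun γ a₁ a₂ hγ ha₁ _ => ?_⟩
  · obtain ⟨Kl, Ku, hKl, hKu, h⟩ := hprune γ hγ
    exact ⟨Kl, Ku, hKl, hKu, fun lam f hf => h lam f hf.levelRegular⟩
  · obtain ⟨N, R, hR, h⟩ := hrecRate a₁ a₂ ha₁
    exact ⟨N, R, hR, fun lam f hf => h lam f hf.levelRegular⟩
  · obtain ⟨N, R, hR, h⟩ := hpruneRate γ a₁ a₂ hγ ha₁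
    exact ⟨N, R, hR, fun lam f hf => h lam f hf.levelRegular⟩
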